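/- Let $q=e^{2\pi i\tau}$, $r=e^{2\pi i z}$ with $\tau$ in the upper half-plane $\mathbb H$ and $z\in\mathbb C$. For $a,b\in\{0,1\}$ put $\theta\left[{a\atop b}\right](\tau,z)=\sum_{\ell\in\mathbb Z}q^{\frac12(\ell+\frac a2)^2}r^{\ell+\frac a2}e^{i\pi\ell b}$, let $\vartheta_2,\vartheta_3,\vartheta_4$ be the functions with $(a,b)=(1,0),(0,0),(0,1)$, and $f_i(\tau,z)=\vartheta_i(\tau,z)/\vartheta_i(\tau,0)$. The umbral Jacobi forms are $$\psi_{0,1}=4(f_2^2+f_3^2+f_4^2),\quad \psi_{0,2}=2(f_2^2f_3^2+f_3^2f_4^2+f_4^2f_2^2),\quad \psi_{0,3}=4f_2^2f_3^2f_4^2,$$ $$\psi_{0,4}=\tfrac14(\psi_{0,1}\psi_{0,3}-\psi_{0,2}^2),\quad \psi_{0,6}=\psi_{0,2}\psi_{0,4}-\psi_{0,3}^2 .$$ With $\theta_{k,a}(\tau,z)=\sum_{m\in\mathbb Z}q^{k(m+\frac a{2k})^2}r^{k(m+\frac a{2k})}$, the normalized level-$k$ $\widehat{sl(2)}$ characters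 are $$\chi_{k,\lambda}=\frac{\theta_{k+2,\lambda+1}-\theta_{k+2,-\lambda-1}}{\theta_{2,1}-\theta_{2,-1}},\qquad 0\le\lambda\le k .$$ A weakly holomorphic vector-valued modular form (vvmf) of weight $0$ and rank $d$ for $SL(2,\mathbb Z)$ is a holomorphic $\mathbf g:\mathbb H\to\mathbb C^d$, meromorphic at the cusps, such that $\mathbf g(\gamma\tau)=\rho(\gamma)\mathbf g(\tau)$ for all $\gamma\in SL(2,\mathbb Z)$, for a homomorphism $\rho:SL(2,\mathbb Z)\to GL(d,\mathbb C)$ with $\rho(-1)=1$. We say that it has matrices $T,S$ if $\rho\left(\begin{smallmatrix}1&1\\0&1\end{smallmatrix}\right)=T$ and $\rho\left(\begin{smallmatrix}0&-1\\1&0\end{smallmatrix}\right)=S$; in particular $\mathbf g(\tau+1)=T\mathbf g(\tau)$ and $\mathbf g(-1/\tau)=S\mathbf g(\tau)$. **Theorem.** Let $N\in\{1,2,3,4,6\}$. There are unique functions $g_j:\mathbb H\to\mathbb C$, $1-N\le j\le N+1$, such that $$\psi_{0,N}(\tau,z)=\sum_{j=1-N}^{N+1}g_j(\tau)\,\chi_{4N,2N+2-2j}(\tau,z)$$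 for all $(\tau,z)$ with $\theta_{2,1}(\tau,z)\ne\theta_{2,-1}(\tau,z)$. They satisfy $g_j=g_{2-j}$. The vector $\mathbf g=(g_1,\dots,g_{N+1})^T$ is a weakly holomorphic vvmf of weight $0$ and rank $N+1$ for $SL(2,\mathbb Z)$, with the following matrices. * $N=1$: $T=\mathrm{diag}(e^{-i\pi/2},e^{i\pi/6})$, $S=\frac1{\sqrt3}\begin{pmatrix}-1&2\\1&1\end{pmatrix}$. * $N=2$: $T=\mathrm{diag}(e^{i\pi},e^{-i\pi/5},e^{i\pi/5})$, $S=\frac1{\sqrt5}\begin{pmatrix}1&-2&2\\-1&\frac{\sqrt5-1}2&\frac{\sqrt5+1}2\\1&\frac{\sqrt5+1}2&\frac{\sqrt5-1}2\end{pmatrix}$. * $N=3$: $T=\mathrm{diag}(e^{i\pi/2},e^{19i\pi/14},e^{-i\pi/14},e^{3i\pi/14})$, $$S=\frac1{\sqrt7}\begin{pmatrix}-1&2&-2&2\\1&-2\sin\frac{3\pi}{14}&-2\sin\frac{\pi}{14}&2\cos\frac\pi7\\-1&-2\sin\frac\pi{14}&2\cos\frac\pi7&2\sin\frac{3\pi}{14}\\1&2\cos\frac\pi7&2\sin\frac{3\pi}{14}&2\sin\frac\pi{14}\end{pmatrix}.$$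 * $N=6$: $T=\mathrm{diag}(e^{i\pi},e^{-i\pi/13},e^{-17i\pi/13},e^{-9i\pi/13},e^{-3i\pi/13},e^{i\pi/13},e^{3i\pi/13})$ and, with $C_n=2\cos\frac{n\pi}{13}$ and $D_n=2\sin\frac{n\pi}{26}$, $$S=\frac1{\sqrt{13}}\begin{pmatrix}1&-2&2&-2&2&-2&2\\-1&C_2&-D_5&D_1&D_3&-C_3&C_1\\1&-D_5&-D_3&C_1&-C_3&-D_1&C_2\\-1&D_1&C_1&-D_3&-C_2&D_5&C_3\\1&D_3&-C_3&-C_2&D_1&C_1&D_5\\-1&-C_3&-D_1&D_5&C_1&C_2&D_3\\1&C_1&C_2&C_3&D_5&D_3&D_1\end{pmatrix}.$$ * $N=4$: with indices $a,b\in\{0,\dots,4\}$, $T=\mathrm{diag}\big(e^{i\pi(9-(9-2a)^2)/36}\big)_a$ and $S_{ab}=\frac{2-\delta_{b,0}}3\sin\frac{\pi(9-2a)(9-2b)}{18}$. Here $\mathbf g$ is constant, $\mathbf g=(-1,0,0,1,0)^T$, so $$\psi_{0,4}=-\chi_{16,8}+(\chi_{16,2}+\chi_{16,14}).$$ Away from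 the zeros of the denominator, this combination $X$ satisfies $X(\tau+1,z)=X(\tau,z)$ and $X(-1/\tau,z/\tau)=e^{2\pi i\cdot4z^2/\tau}X(\tau,z)$. It is unique up to an overall constant: the vectors $v\in\mathbb C^5$ with $Tv=v$ and $Sv=v$ are exactly the multiples of $(-1,0,0,1,0)^T$. -/

import Mathlib

open scoped UpperHalfPlane MatrixGroups Matrix

noncomputable section

/-- The real-exponent powers `q ^ x` of `q = exp(2πiτ)`. -/
def qPow (τ : ℍ) (x : ℝ) : ℂ := Complex.exp (2 * Real.pi * Complex.I * x * (τ : ℂ))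

/-- The real-exponent powers `r ^ x` of `r = exp(2πiz)`. -/
def rPow (z : ℂ) (x : ℝ) : ℂ := Complex.exp (2 * Real.pi * Complex.I * x * z)

/-- The genus-one theta function with characteristics `a, b ∈ {0, 1}`:
`∑_ℓ q^((ℓ + a/2)²/2) r^(ℓ + a/2) e^(iπℓb)`. -/
def thetaCharacteristic (a b : ℕ) (τ : ℍ) (z : ℂ) : ℂ :=
  ∑' l : ℤ, qPow τ (((l : ℝ) + (a : ℝ) / 2) ^ 2 / 2) * rPow z ((l : ℝ) + (a : ℝ) / 2) *
    Complex.exp (Complex.I * Real.pi * l * b)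

/-- `f₂ = ϑ₂(τ,z) / ϑ₂(τ,0)`, where `ϑ₂ = θ[1,0]`. -/
def umbralF2 (τ : ℍ) (z : ℂ) : ℂ := thetaCharacteristic 1 0 τ z / thetaCharacteristic 1 0 τ 0

/-- `f₃ = ϑ₃(τ,z) / ϑ₃(τ,0)`, where `ϑ₃ = θ[0,0]`. -/
def umbralF3 (τ : ℍ) (z : ℂ) : ℂ := thetaCharacteristic 0 0 τ z / thetaCharacteristic 0 0 τ 0

/-- `f₄ = ϑ₄(τ,z) / ϑ₄(τ,0)`, where `ϑ₄ = θ[0,1]`. -/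
def umbralF4 (τ : ℍ) (z : ℂ) : ℂ := thetaCharacteristic 0 1 τ z / thetaCharacteristic 0 1 τ 0

def umbralPsi1 (τ : ℍ) (z : ℂ) : ℂ :=
  4 * (umbralF2 τ z ^ 2 + umbralF3 τ z ^ 2 + umbralF4 τ z ^ 2)

def umbralPsi2 (τ : ℍ) (z : ℂ) : ℂ :=
  2 * (umbralF2 τ z ^ 2 * umbralF3 τ z ^ 2 + umbralF3 τ z ^ 2 * umbralF4 τ z ^ 2 +
    umbralF4 τ z ^ 2 * umbralF2 τ z ^ 2)

def umbralPsi3 (τ : ℍ) (z : ℂ) : ℂ :=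
  4 * (umbralF2 τ z ^ 2 * umbralF3 τ z ^ 2 * umbralF4 τ z ^ 2)

def umbralPsi4 (τ : ℍ) (z : ℂ) : ℂ :=
  1 / 4 * (umbralPsi1 τ z * umbralPsi3 τ z - umbralPsi2 τ z ^ 2)

def umbralPsi6 (τ : ℍ) (z : ℂ) : ℂ :=
  umbralPsi2 τ z * umbralPsi4 τ z - umbralPsi3 τ z ^ 2

/-- The umbral Jacobi form `ψ_{0,N}`, of weight zero and index `N`, for `N = 1, 2, 3, 4, 6`
(the value for other `N` is irrelevant). -/
def umbralPsi (N : ℕ) : ℍ → ℂ → ℂ :=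
  match N with
  | 1 => umbralPsi1
  | 2 => umbralPsi2
  | 3 => umbralPsi3
  | 4 => umbralPsi4
  | 6 => umbralPsi6
  | _ => fun _ _ => 0

/-- The classical theta function
`θ_{k,a}(τ,z) = ∑_m q^(k(m + a/(2k))²) r^(k(m + a/(2k)))`. -/
def classicalTheta (k : ℕ) (a : ℤ) (τ : ℍ) (z : ℂ) : ℂ :=
  ∑' m : ℤ, qPow τ ((k : ℝ) * ((m : ℝ) + (a : ℝ) / (2 * k)) ^ 2) *
    rPow z ((k : ℝ) * ((m : ℝ) + (a : ℝ) / (2 * k)))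

/-- The Weyl-Kac denominator `θ_{2,1} - θ_{2,-1}`. -/
def sl2Denominator (τ : ℍ) (z : ℂ) : ℂ := classicalTheta 2 1 τ z - classicalTheta 2 (-1) τ z

/-- The normalized affine `sl(2)` character `χ_{k,l}` of level `k`, for `0 ≤ l ≤ k`, as a quotient;
it is meaningful away from the zeros of the denominator (where it has removable singularities). -/
def sl2Character (k l : ℕ) (τ : ℍ) (z : ℂ) : ℂ :=
  (classicalTheta (k + 2) ((l : ℤ) + 1) τ z - classicalTheta (k + 2) (-(l : ℤ) - 1) τ z) /
    sl2Denominator τ z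

/-- `ψ_{0,N}(τ,z) = ∑_{i=0}^{2N} c_i(τ) χ_{4N,2i}(τ,z)` wherever the characters are defined by the
quotient. The summation index is related to the index `j` of the coefficient `g_j` of
`χ_{4N,2N+2-2j}` by `i = N + 1 - j`, so that `j` runs from `1 - N` to `N + 1`. -/
def IsCharacterDecomposition (N : ℕ) (c : Fin (2 * N + 1) → ℍ → ℂ) : Prop :=
  ∀ (τ : ℍ) (z : ℂ), sl2Denominator τ z ≠ 0 →
    umbralPsi N τ z = ∑ i : Fin (2 * N + 1), c i τ * sl2Character (4 * N) (2 * (i : ℕ)) τ z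

/-- The vector `g = (g_1, …, g_{N+1})`, where `g_j` is the coefficient of `χ_{4N,2N+2-2j}`. The entry
with the zero-based index `a` is `g_{a+1}`, the coefficient of `χ_{4N,2(N-a)}`. -/
def coefficientVector (N : ℕ) (c : Fin (2 * N + 1) → ℍ → ℂ) (τ : ℍ) : Fin (N + 1) → ℂ :=
  fun a => c ⟨N - (a : ℕ), by omega⟩ τ

/-- `g` is a weakly holomorphic vector-valued modular form of integral weight `w`, rank `d` and
multiplier `ρ` for `SL(2,ℤ)`: `(ρ, w)` is an admissible multiplier system, `g` transforms with the
automorphy factor `ρ(γ) (cτ+d)^w`, is holomorphic on the upper half-plane, and is meromorphic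
(at most exponential growth in `Im τ`, i.e. at most a pole in `q`) at every cusp. -/
structure IsWeaklyHolomorphicVVMF {d : ℕ} (w : ℤ) (ρ : SL(2, ℤ) →* GL (Fin d) ℂ)
    (g : ℍ → Fin d → ℂ) : Prop where
  map_neg_one : (ρ (-1) : Matrix (Fin d) (Fin d) ℂ) = ((-1 : ℂ) ^ w) • 1
  transform : ∀ (γ : SL(2, ℤ)) (τ : ℍ),
    g (γ • τ) = ((((γ 1 0 : ℤ) : ℂ) * (τ : ℂ) + ((γ 1 1 : ℤ) : ℂ)) ^ w) •
      ((ρ γ : Matrix (Fin d) (Fin d) ℂ) *ᵥ g τ)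
  holomorphic : ∀ i : Fin d,
    MDifferentiable (modelWithCornersSelf ℂ ℂ) (modelWithCornersSelf ℂ ℂ) (fun τ : ℍ => g τ i)
  meromorphic_cusps : ∀ (γ : SL(2, ℤ)) (i : Fin d), ∃ A C M : ℝ, ∀ τ : ℍ,
    A ≤ τ.im → ‖g (γ • τ) i‖ ≤ C * Real.exp (M * τ.im)

/-- `g` is a weakly holomorphic vector-valued modular form of weight zero for `SL(2,ℤ)` with
`g(τ+1) = T g(τ)` and `g(-1/τ) = S g(τ)`. -/
def IsWeightZeroVVMF {d : ℕ} (T S : Matrix (Fin d) (Fin d) ℂ) (g : ℍ → Fin d → ℂ) : Prop :=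
  ∃ ρ : SL(2, ℤ) →* GL (Fin d) ℂ,
    (ρ ModularGroup.T : Matrix (Fin d) (Fin d) ℂ) = T ∧
    (ρ ModularGroup.S : Matrix (Fin d) (Fin d) ℂ) = S ∧
    IsWeaklyHolomorphicVVMF 0 ρ g

/-- The phase `e^(iπx)`. -/
def phase (x : ℝ) : ℂ := Complex.exp (Complex.I * Real.pi * x)

def umbralT1 : Matrix (Fin 2) (Fin 2) ℂ := Matrix.diagonal ![phase (-1 / 2), phase (1 / 6)]

def umbralS1 : Matrix (Fin 2) (Fin 2) ℂ :=
  ((1 / √3 : ℝ) • (!![-1, 2; 1, 1] : Matrix (Fin 2) (Fin 2) ℝ)).map Complex.ofReal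

def umbralT2 : Matrix (Fin 3) (Fin 3) ℂ :=
  Matrix.diagonal ![phase 1, phase (-1 / 5), phase (1 / 5)]

def umbralS2 : Matrix (Fin 3) (Fin 3) ℂ :=
  ((1 / √5 : ℝ) • (!![
     1, -2, 2;
    -1, (√5 - 1) / 2, (√5 + 1) / 2;
     1, (√5 + 1) / 2, (√5 - 1) / 2] : Matrix (Fin 3) (Fin 3) ℝ)).map Complex.ofReal

def umbralT3 : Matrix (Fin 4) (Fin 4) ℂ :=
  Matrix.diagonal ![phase (1 / 2), phase (19 / 14), phase (-1 / 14), phase (3 / 14)]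

open Real in
def umbralS3 : Matrix (Fin 4) (Fin 4) ℂ :=
  ((1 / √7 : ℝ) • (!![
    -1, 2, -2, 2;
     1, -2 * sin (3 * π / 14), -2 * sin (π / 14), 2 * cos (π / 7);
    -1, -2 * sin (π / 14), 2 * cos (π / 7), 2 * sin (3 * π / 14);
     1, 2 * cos (π / 7), 2 * sin (3 * π / 14), 2 * sin (π / 14)] :
      Matrix (Fin 4) (Fin 4) ℝ)).map Complex.ofReal

/-- For `N = 4` the entries are indexed by the weights `λ = 8, 6, 4, 2, 0`, and `λ + 1 = 9 - 2a`. -/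
def umbralT4 : Matrix (Fin 5) (Fin 5) ℂ :=
  Matrix.diagonal fun a => phase ((9 - (9 - 2 * ((a : ℕ) : ℝ)) ^ 2) / 36)

open Real in
def umbralS4 : Matrix (Fin 5) (Fin 5) ℂ :=
  Matrix.of fun a b =>
    (((if b = 0 then 1 else 2) / 3 *
      sin (π * (9 - 2 * ((a : ℕ) : ℝ)) * (9 - 2 * ((b : ℕ) : ℝ)) / 18) : ℝ) : ℂ)

def umbralT6 : Matrix (Fin 7) (Fin 7) ℂ :=
  Matrix.diagonal ![phase 1, phase (-1 / 13), phase (-17 / 13), phase (-9 / 13), phase (-3 / 13),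
    phase (1 / 13), phase (3 / 13)]

open Real in
def umbralS6 : Matrix (Fin 7) (Fin 7) ℂ :=
  ((1 / √13 : ℝ) • (!![
     1, -2, 2, -2, 2, -2, 2;
    -1, 2 * cos (2 * π / 13), -2 * sin (5 * π / 26), 2 * sin (π / 26), 2 * sin (3 * π / 26),
      -2 * cos (3 * π / 13), 2 * cos (π / 13);
     1, -2 * sin (5 * π / 26), -2 * sin (3 * π / 26), 2 * cos (π / 13), -2 * cos (3 * π / 13),
      -2 * sin (π / 26), 2 * cos (2 * π / 13);
    -1, 2 * sin (π / 26), 2 * cos (π / 13), -2 * sin (3 * π / 26), -2 * cos (2 * π / 13),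
      2 * sin (5 * π / 26), 2 * cos (3 * π / 13);
     1, 2 * sin (3 * π / 26), -2 * cos (3 * π / 13), -2 * cos (2 * π / 13), 2 * sin (π / 26),
      2 * cos (π / 13), 2 * sin (5 * π / 26);
    -1, -2 * cos (3 * π / 13), -2 * sin (π / 26), 2 * sin (5 * π / 26), 2 * cos (π / 13),
      2 * cos (2 * π / 13), 2 * sin (3 * π / 26);
     1, 2 * cos (π / 13), 2 * cos (2 * π / 13), 2 * cos (3 * π / 13), 2 * sin (5 * π / 26),
      2 * sin (3 * π / 26), 2 * sin (π / 26)] :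
      Matrix (Fin 7) (Fin 7) ℝ)).map Complex.ofReal

/-- The combination `-χ_{16,8} + (χ_{16,2} + χ_{16,14})`. -/
def umbralCombination4 (τ : ℍ) (z : ℂ) : ℂ :=
  -sl2Character 16 8 τ z + (sl2Character 16 2 τ z + sl2Character 16 14 τ z)

end

/-!
Multiplying `ψ_{0,N}` by the Weyl-Kac denominator `D = θ_{2,1} - θ_{2,-1}` gives, for fixed `τ`,
an odd entire function `∑ₙ h(n) q^(n²/(4(4N+2))) r^(n/2)` of `z`. Here `h` is odd because `D` is
odd and the `f_i²` are even, `h` vanishes at even `n` because `D` changes sign under `z ↦ z + 1`,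
and `h(n + 4N + 2) = -h(n)` because `D` changes sign under `z ↦ z + τ`, up to the automorphy
factor, while the `f_i²` do not. In particular `h` is `(8N+4)`-periodic, and the functions of `z`
given by odd periodic `h` supported on odd `n` are spanned by the numerators of the characters
`χ_{4N,2i}` (`IsEvenTheta.exists_decomposition`). Uniqueness of Fourier expansions makes the
coefficients unique (`coeff_eq_zero_of_sum_sl2Character_eq_zero`), and `h(4N + 2 - n) = h(n)` is
the symmetry `g_j = g_{2-j}`. Holomorphy in `τ` and the growth at the cusp pass from the Fourier
coefficients of `f_i²` and `D` to those of the product; the predicate `HasThetaExpansion` records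
exactly the data that is stable under products.

The numerators and `D` are theta series, so Poisson summation (the functional equation of
`jacobiTheta₂`) gives the transformation of the symmetrized characters under `τ ↦ -1/τ` by an
explicit matrix of sines `weilS N`, and under `τ ↦ τ + 1` by the diagonal matrix `weilT N`. Since
the characters are linearly independent, every element of the modular group acts on them by a
well-defined matrix, which yields a representation `weilRep N` without a presentation of
`SL(2,ℤ)`. As `ψ_{0,N}` is invariant, its coefficient vector transforms by the contragredient
representation (`isWeightZeroVVMF_coefficientVector`). For each `N` the matrices of the theorem
are `weilT N` and `weilS N`, because the sines agree up to reflections and, for small `N`, have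
closed forms.

For `N = 4` the addition formula for theta functions gives `ψ_{0,4}(τ,z) D(τ,z) = D(τ,3z)`
(`umbralPsi4_mul_sl2Denominator`). Sorting the terms of `D(τ,3z)` by residues modulo `36`
expresses it through the numerators of three characters with constant coefficients.
-/

/-! ### Exponentials -/

theorem qPow_add (τ : ℍ) (x y : ℝ) : qPow τ (x + y) = qPow τ x * qPow τ y := by
  rw [qPow, qPow, qPow, ← Complex.exp_add]; congr 1; push_cast; ring

theorem qPow_zero (τ : ℍ) : qPow τ 0 = 1 := by simp [qPow]

theorem qPow_ne_zero (τ : ℍ) (x : ℝ) : qPow τ x ≠ 0 := Complex.exp_ne_zero _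

theorem norm_qPow (τ : ℍ) (x : ℝ) : ‖qPow τ x‖ = Real.exp (-(2 * Real.pi * x * τ.im)) := by
  rw [qPow, Complex.norm_exp]
  congr 1
  simp [Complex.mul_re, Complex.mul_im]

theorem rPow_add (z : ℂ) (x y : ℝ) : rPow z (x + y) = rPow z x * rPow z y := by
  rw [rPow, rPow, rPow, ← Complex.exp_add]; congr 1; push_cast; ring

theorem rPow_zero_left (x : ℝ) : rPow 0 x = 1 := by simp [rPow]

theorem rPow_zero_right (z : ℂ) : rPow z 0 = 1 := by simp [rPow]

/-! ### Theta series with periodic coefficients -/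

/-- The index-`K/4` theta series `∑ₙ h(n) q^(n²/4K) r^(n/2)` with coefficients `h`. For bounded `h`
it converges absolutely; all theta functions here are of this form, with `h` periodic. -/
noncomputable def coeffTheta (K : ℕ) (h : ℤ → ℂ) (τ : ℍ) (z : ℂ) : ℂ :=
  ∑' n : ℤ, h n * qPow τ ((n : ℝ) ^ 2 / (4 * K)) * rPow z ((n : ℝ) / 2)

/-- The terms of these series are terms of `jacobiTheta₂` at `(z/2, τ/2K)`. -/
theorem gaussTerm_eq (K : ℕ) (n : ℤ) (τ : ℍ) (z : ℂ) :
    qPow τ ((n : ℝ) ^ 2 / (4 * K)) * rPow z ((n : ℝ) / 2) =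
      jacobiTheta₂_term n (z / 2) ((τ : ℂ) / (2 * K)) := by
  rw [qPow, rPow, jacobiTheta₂_term, ← Complex.exp_add]; congr 1; push_cast
  rw [← sub_eq_zero]
  by_cases hK : (K : ℂ) = 0
  · rw [hK]; ring_nf
  · field_simp; ring

theorem im_div_pos {K : ℕ} (hK : 0 < K) (τ : ℍ) : 0 < ((τ : ℂ) / (2 * K)).im := by
  have : (τ : ℂ) / (2 * K) = (τ : ℂ) / ((2 * K : ℝ) : ℂ) := by push_cast; rfl
  rw [this, Complex.div_ofReal_im]
  exact div_pos τ.im_pos (by positivity)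

theorem summable_coeffTheta {K : ℕ} (hK : 0 < K) {h : ℤ → ℂ} {C : ℝ} (hC : ∀ n, ‖h n‖ ≤ C)
    (τ : ℍ) (z : ℂ) :
    Summable fun n : ℤ => h n * qPow τ ((n : ℝ) ^ 2 / (4 * K)) * rPow z ((n : ℝ) / 2) := by
  have h1 := ((summable_jacobiTheta₂_term_iff (z / 2) _).2 (im_div_pos hK τ)).norm
  refine Summable.of_norm_bounded (h1.mul_left C) fun n => ?_
  rw [mul_assoc, gaussTerm_eq, norm_mul]
  exact mul_le_mul_of_nonneg_right (hC n) (norm_nonneg _)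

theorem hasSum_coeffTheta {K : ℕ} (hK : 0 < K) {h : ℤ → ℂ} {C : ℝ} (hC : ∀ n, ‖h n‖ ≤ C)
    (τ : ℍ) (z : ℂ) :
    HasSum (fun n : ℤ => h n * qPow τ ((n : ℝ) ^ 2 / (4 * K)) * rPow z ((n : ℝ) / 2))
      (coeffTheta K h τ z) := (summable_coeffTheta hK hC τ z).hasSum

theorem coeffTheta_add {K : ℕ} (hK : 0 < K) {h h' : ℤ → ℂ} {C C' : ℝ} (hC : ∀ n, ‖h n‖ ≤ C)
    (hC' : ∀ n, ‖h' n‖ ≤ C') (τ : ℍ) (z : ℂ) :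
    coeffTheta K (fun n => h n + h' n) τ z = coeffTheta K h τ z + coeffTheta K h' τ z := by
  rw [← ((hasSum_coeffTheta hK hC τ z).add (hasSum_coeffTheta hK hC' τ z)).tsum_eq, coeffTheta]
  congr 1; ext n; ring

theorem coeffTheta_sub {K : ℕ} (hK : 0 < K) {h h' : ℤ → ℂ} {C C' : ℝ} (hC : ∀ n, ‖h n‖ ≤ C)
    (hC' : ∀ n, ‖h' n‖ ≤ C') (τ : ℍ) (z : ℂ) :
    coeffTheta K (fun n => h n - h' n) τ z = coeffTheta K h τ z - coeffTheta K h' τ z := by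
  rw [← ((hasSum_coeffTheta hK hC τ z).sub (hasSum_coeffTheta hK hC' τ z)).tsum_eq, coeffTheta]
  congr 1; ext n; ring

theorem coeffTheta_smul (K : ℕ) (c : ℂ) (h : ℤ → ℂ) (τ : ℍ) (z : ℂ) :
    coeffTheta K (fun n => c * h n) τ z = c * coeffTheta K h τ z := by
  rw [coeffTheta, coeffTheta, ← tsum_mul_left]
  congr 1; ext n; ring

/-- The indicator function of the residue class of `a` modulo `m`. -/
def residueInd (m a n : ℤ) : ℂ := if m ∣ n - a then 1 else 0

theorem norm_residueInd_le (m a n : ℤ) : ‖residueInd m a n‖ ≤ 1 := by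
  unfold residueInd; split_ifs <;> simp

theorem classicalTheta_eq {K : ℕ} (hK : 0 < K) (a : ℤ) (τ : ℍ) (z : ℂ) :
    classicalTheta K a τ z = coeffTheta K (residueInd (2 * K) a) τ z := by
  have hK' : (K : ℝ) ≠ 0 := by positivity
  have h1 := hasSum_coeffTheta hK (norm_residueInd_le (2 * K) a) τ z
  have hinj : Function.Injective fun m : ℤ => 2 * K * m + a := by
    intro m m' h
    have h2 : (2 * K : ℤ) ≠ 0 := by positivity
    exact mul_left_cancel₀ h2 (add_right_cancel h)
  rw [← hinj.hasSum_iff] at h1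
  · rw [← h1.tsum_eq, classicalTheta]
    congr 1; ext m
    have : residueInd (2 * K) a (2 * K * m + a) = 1 := by simp [residueInd]
    simp only [Function.comp_apply, this, one_mul]
    congr 2
    · push_cast; field_simp; ring
    · push_cast; field_simp
  · intro n hn
    have : residueInd (2 * K) a n = 0 := by
      rw [residueInd, if_neg]
      rintro ⟨m, hm⟩
      exact hn ⟨m, by simp only; omega⟩
    simp [this]

theorem differentiable_classicalTheta {K : ℕ} (hK : 0 < K) (a : ℤ) (τ : ℍ) :
    Differentiable ℂ (classicalTheta K a τ) := by
  have hK' : (K : ℂ) ≠ 0 := by exact_mod_cast hK.ne'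
  have h0 : (0 : ℝ) < (2 * K * (τ : ℂ)).im := by
    have : (2 * K * (τ : ℂ)) = ((2 * K : ℝ) : ℂ) * τ := by push_cast; rfl
    rw [this, Complex.im_ofReal_mul]
    exact mul_pos (by positivity) τ.im_pos
  have h : classicalTheta K a τ = fun z => qPow τ ((a : ℝ) ^ 2 / (4 * K)) * rPow z ((a : ℝ) / 2) *
      jacobiTheta₂ (K * z + a * τ) (2 * K * τ) := by
    ext z
    rw [classicalTheta, jacobiTheta₂, ← tsum_mul_left]
    congr 1; ext m
    rw [qPow, qPow, rPow, rPow, jacobiTheta₂_term, ← Complex.exp_add, ← Complex.exp_add,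
      ← Complex.exp_add]
    congr 1
    push_cast
    field_simp
    ring
  rw [h]
  intro z
  have h1 := (differentiableAt_jacobiTheta₂_fst (K * z + a * τ) h0).comp z
    (by fun_prop : DifferentiableAt ℂ (fun z => (K : ℂ) * z + a * τ) z)
  have h2 : DifferentiableAt ℂ (fun z => rPow z ((a : ℝ) / 2)) z := by unfold rPow; fun_prop
  exact (h2.const_mul _).mul h1

/-! ### Modular transformations -/

/-- The automorphy factor `(-iτ/2K)^(1/2) e^(πi K z²/(2τ))` of the theta functions of level `K`
under `τ ↦ -1/τ`. -/
noncomputable def thetaFactor (K : ℕ) (τ : ℍ) (z : ℂ) : ℂ :=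
  (-Complex.I * ((τ : ℂ) / (2 * K))) ^ (1 / 2 : ℂ) *
    Complex.exp (Real.pi * Complex.I * K * z ^ 2 / (2 * τ))

theorem coe_S_smul (τ : ℍ) : ((ModularGroup.S • τ : ℍ) : ℂ) = -1 / (τ : ℂ) := by
  rw [UpperHalfPlane.modular_S_smul, neg_div, one_div, ← inv_neg]

theorem coe_T_smul (τ : ℍ) : ((ModularGroup.T • τ : ℍ) : ℂ) = 1 + (τ : ℂ) := by
  rw [UpperHalfPlane.modular_T_smul]
  simp

/-- The transformation of a classical theta function under `τ ↦ -1/τ`: the residue class is turned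
into an additive character. -/
theorem classicalTheta_S {K : ℕ} (hK : 0 < K) (a : ℤ) (τ : ℍ) (z : ℂ) :
    classicalTheta K a (ModularGroup.S • τ) (z / τ) =
      thetaFactor K τ z * coeffTheta K (fun n => phase (-(a * n / K : ℝ))) τ z := by
  have hK' : (K : ℂ) ≠ 0 := by exact_mod_cast hK.ne'
  have hτ : (τ : ℂ) ≠ 0 := UpperHalfPlane.ne_zero τ
  have e1 : coeffTheta K (fun n => phase (-(a * n / K : ℝ))) τ z =
      jacobiTheta₂ (z / 2 - a / (2 * K)) ((τ : ℂ) / (2 * K)) := by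
    rw [coeffTheta, jacobiTheta₂]
    congr 1; ext n
    rw [qPow, rPow, phase, jacobiTheta₂_term, ← Complex.exp_add, ← Complex.exp_add]
    congr 1
    push_cast
    field_simp
    ring
  have e2 : classicalTheta K a (ModularGroup.S • τ) (z / τ) =
      Complex.exp (-Real.pi * Complex.I * a ^ 2 / (2 * K * τ) + Real.pi * Complex.I * a * z / τ) *
      jacobiTheta₂ ((z / 2 - a / (2 * K)) / ((τ : ℂ) / (2 * K))) (-1 / ((τ : ℂ) / (2 * K))) := by
    rw [classicalTheta, jacobiTheta₂, ← tsum_mul_left]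
    congr 1; ext n
    rw [qPow, rPow, jacobiTheta₂_term, ← Complex.exp_add, ← Complex.exp_add, coe_S_smul]
    congr 1
    push_cast
    field_simp
    ring
  have h0 : (-Complex.I * ((τ : ℂ) / (2 * K))) ^ (1 / 2 : ℂ) ≠ 0 := by
    rw [Ne, Complex.cpow_eq_zero_iff]
    simp [hτ, hK']
  rw [e1, e2, jacobiTheta₂_functional_equation (z / 2 - a / (2 * K)) ((τ : ℂ) / (2 * K)),
    thetaFactor]
  rw [show ∀ A B C D E : ℂ, A * B * (1 / C * D * E) = (A / C) * (B * D) * E by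
    intros; ring, div_self h0, one_mul, ← Complex.exp_add]
  congr 2
  field_simp
  ring

theorem thetaFactor_ne_zero {K : ℕ} (hK : 0 < K) (τ : ℍ) (z : ℂ) : thetaFactor K τ z ≠ 0 := by
  have hK' : (K : ℂ) ≠ 0 := by exact_mod_cast hK.ne'
  refine mul_ne_zero ?_ (Complex.exp_ne_zero _)
  rw [Ne, Complex.cpow_eq_zero_iff]
  simp [UpperHalfPlane.ne_zero τ, hK']

/-- Comparison of the automorphy factors of level `K = 4N + 2` and level `2`. -/
theorem thetaFactor_eq (N : ℕ) (τ : ℍ) (z : ℂ) :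
    thetaFactor (4 * N + 2) τ z = ((1 / √(2 * N + 1) : ℝ) : ℂ) *
      Complex.exp (2 * Real.pi * Complex.I * N * z ^ 2 / τ) * thetaFactor 2 τ z := by
  have hτ : (τ : ℂ) ≠ 0 := UpperHalfPlane.ne_zero τ
  have h0 : (0 : ℝ) < 1 / (2 * N + 1) := by positivity
  have hN : (2 * N + 1 : ℂ) ≠ 0 := by exact_mod_cast (by positivity : (2 * N + 1 : ℕ) ≠ 0)
  have e1 : -Complex.I * ((τ : ℂ) / (2 * ((4 * N + 2 : ℕ) : ℂ))) =
      ((1 / (2 * N + 1) : ℝ) : ℂ) * (-Complex.I * ((τ : ℂ) / (2 * ((2 : ℕ) : ℂ)))) := by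
    have : (4 * N + 2 : ℂ) = 2 * (2 * N + 1) := by ring
    push_cast
    rw [this]
    field_simp
  have h1 : -Complex.I * ((τ : ℂ) / (2 * ((2 : ℕ) : ℂ))) ≠ 0 := by simp [hτ]
  have e2 : (-Complex.I * ((τ : ℂ) / (2 * ((4 * N + 2 : ℕ) : ℂ)))) ^ (1 / 2 : ℂ) =
      ((1 / √(2 * N + 1) : ℝ) : ℂ) *
        (-Complex.I * ((τ : ℂ) / (2 * ((2 : ℕ) : ℂ)))) ^ (1 / 2 : ℂ) := by
    rw [e1, Complex.cpow_def_of_ne_zero (mul_ne_zero (by exact_mod_cast h0.ne') h1),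
      Complex.log_ofReal_mul h0 h1, add_mul, Complex.exp_add, ← Complex.cpow_def_of_ne_zero h1]
    congr 1
    rw [show (1 / 2 : ℂ) = ((1 / 2 : ℝ) : ℂ) by push_cast; rfl, ← Complex.ofReal_mul,
      ← Complex.ofReal_exp]
    congr 1
    rw [← Real.rpow_def_of_pos h0, ← Real.sqrt_eq_rpow, Real.sqrt_div zero_le_one, Real.sqrt_one]
  rw [thetaFactor, thetaFactor, e2]
  rw [show ∀ A B C D E : ℂ, A * B * C = A * D * (B * E) ↔ A * B * C = A * B * (D * E) by
    intros; rw [show ∀ A B D E : ℂ, A * D * (B * E) = A * B * (D * E) by intros; ring],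
    ← Complex.exp_add]
  congr 2
  push_cast
  field_simp
  ring

theorem phase_add (x y : ℝ) : phase (x + y) = phase x * phase y := by
  rw [phase, phase, phase, ← Complex.exp_add]; congr 1; push_cast; ring

theorem phase_two_mul_int (m : ℤ) : phase (2 * m) = 1 := by
  rw [phase, Complex.exp_eq_one_iff]
  exact ⟨m, by push_cast; ring⟩

theorem phase_ne_zero (x : ℝ) : phase x ≠ 0 := Complex.exp_ne_zero _

theorem norm_phase (x : ℝ) : ‖phase x‖ = 1 := by
  rw [phase, show Complex.I * Real.pi * x = ((Real.pi * x : ℝ) : ℂ) * Complex.I by push_cast; ring,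
    Complex.norm_exp_ofReal_mul_I]

theorem phase_congr {x y : ℝ} (m : ℤ) (h : x = y + 2 * m) : phase x = phase y := by
  rw [h, phase_add, phase_two_mul_int, mul_one]

theorem qPow_T (τ : ℍ) (x : ℝ) : qPow (ModularGroup.T • τ) x = phase (2 * x) * qPow τ x := by
  rw [qPow, qPow, phase, ← Complex.exp_add, coe_T_smul]; congr 1; push_cast; ring

/-- If all indices in the support of `h` have the same square modulo `4K`, the theta series is an
eigenfunction of `τ ↦ τ + 1`. -/
theorem coeffTheta_T {K : ℕ} (hK : 0 < K) {h : ℤ → ℂ} (s : ℤ)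
    (hs : ∀ n, h n ≠ 0 → (4 * K : ℤ) ∣ n ^ 2 - s ^ 2) (τ : ℍ) (z : ℂ) :
    coeffTheta K h (ModularGroup.T • τ) z = phase (s ^ 2 / (2 * K)) * coeffTheta K h τ z := by
  have hK' : (K : ℝ) ≠ 0 := by positivity
  rw [coeffTheta, coeffTheta, ← tsum_mul_left]
  congr 1; ext n
  by_cases hn : h n = 0
  · simp [hn]
  obtain ⟨m, hm⟩ := hs n hn
  have hm' : (n : ℝ) ^ 2 = s ^ 2 + 4 * K * m := by
    have : (n : ℤ) ^ 2 = s ^ 2 + 4 * K * m := by linarith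
    exact_mod_cast this
  rw [qPow_T, phase_congr m (y := (s : ℝ) ^ 2 / (2 * K))]
  · ring
  · rw [hm']; field_simp; ring

/-! ### Numerators of the characters -/

/-- The numerator of the character `χ_{4N,2i}`. -/
noncomputable def charNum (N i : ℕ) (τ : ℍ) (z : ℂ) : ℂ :=
  classicalTheta (4 * N + 2) (2 * i + 1) τ z - classicalTheta (4 * N + 2) (-(2 * i + 1)) τ z

theorem sl2Character_eq (N i : ℕ) (τ : ℍ) (z : ℂ) :
    sl2Character (4 * N) (2 * i) τ z = charNum N i τ z / sl2Denominator τ z := by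
  rw [sl2Character, charNum]
  push_cast
  rw [neg_add, sub_eq_add_neg (-(2 * (i : ℤ)))]

theorem charNum_zero (τ : ℍ) (z : ℂ) : charNum 0 0 τ z = sl2Denominator τ z := by
  simp [charNum, sl2Denominator]

/-- The coefficients of the antisymmetrized theta function `θ_{K,s} - θ_{K,-s}`, with `m = 2K`. -/
def oddInd (m s n : ℤ) : ℂ := residueInd m s n - residueInd m (-s) n

theorem norm_oddInd_le (m s n : ℤ) : ‖oddInd m s n‖ ≤ 2 :=
  (norm_sub_le _ _).trans
    ((add_le_add (norm_residueInd_le _ _ _) (norm_residueInd_le _ _ _)).trans (by norm_num))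

theorem charNum_eq (N i : ℕ) (τ : ℍ) (z : ℂ) :
    charNum N i τ z = coeffTheta (4 * N + 2) (oddInd (8 * N + 4) (2 * i + 1)) τ z := by
  have hK : 0 < 4 * N + 2 := by omega
  have h8 : (8 * N + 4 : ℤ) = 2 * ((4 * N + 2 : ℕ) : ℤ) := by push_cast; ring
  rw [charNum, classicalTheta_eq hK, classicalTheta_eq hK, h8]
  exact (coeffTheta_sub hK (norm_residueInd_le _ _) (norm_residueInd_le _ _) τ z).symm

theorem residueInd_add_mul (m a n k : ℤ) : residueInd m a (n + m * k) = residueInd m a n := by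
  have : m ∣ n + m * k - a ↔ m ∣ n - a := by
    rw [show n + m * k - a = (n - a) + m * k by ring]
    exact dvd_add_left (dvd_mul_right m k)
  simp only [residueInd, this]

theorem periodic_add_mul {h : ℤ → ℂ} {m : ℤ} (hp : ∀ n, h (n + m) = h n) (n k : ℤ) :
    h (n + m * k) = h n := by
  have : Function.Periodic h m := hp
  simpa [mul_comm] using this.int_mul k n

/-- An odd function on `ℤ/(8N+4)` supported on odd residues is a combination of the coefficient
functions of the numerators of the characters `χ_{4N,2i}`. -/
theorem eq_sum_oddInd (N : ℕ) {h : ℤ → ℂ} (hodd : ∀ n, h (-n) = -h n)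
    (hper : ∀ n, h (n + (8 * N + 4)) = h n) (heven : ∀ n, h (2 * n) = 0) (n : ℤ) :
    h n = ∑ i ∈ Finset.range (2 * N + 1), h (2 * i + 1) * oddInd (8 * N + 4) (2 * i + 1) n := by
  set m : ℤ := 8 * N + 4 with hm
  -- reduce to a representative `r ∈ [0, m)`
  have hr : n = n % m + m * (n / m) := (Int.emod_add_mul_ediv n m).symm
  have hr0 : 0 ≤ n % m := Int.emod_nonneg n (by omega)
  have hr1 : n % m < m := Int.emod_lt_of_pos n (by omega)
  generalize n % m = r at hr hr0 hr1
  generalize n / m = k at hr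
  subst hr
  rw [periodic_add_mul hper]
  simp only [oddInd, residueInd_add_mul]
  have d1 : ∀ i ∈ Finset.range (2 * N + 1),
      residueInd m (2 * i + 1) r = if r = 2 * i + 1 then 1 else 0 := by
    intro i hi
    rw [Finset.mem_range] at hi
    unfold residueInd
    congr 1
    rw [eq_iff_iff]
    constructor
    · intro hd
      have := Int.eq_zero_of_abs_lt_dvd hd (by rw [abs_lt]; constructor <;> omega)
      omega
    · rintro rfl; simp
  have d2 : ∀ i ∈ Finset.range (2 * N + 1),
      residueInd m (-(2 * i + 1)) r = if m - r = 2 * i + 1 then 1 else 0 := by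
    intro i hi
    rw [Finset.mem_range] at hi
    unfold residueInd
    congr 1
    rw [eq_iff_iff]
    constructor
    · intro hd
      have hd' : m ∣ r - -(2 * i + 1) - m := dvd_sub_self_right.2 hd
      have := Int.eq_zero_of_abs_lt_dvd hd' (by rw [abs_lt]; constructor <;> omega)
      omega
    · intro h; exact ⟨1, by omega⟩
  rw [Finset.sum_congr rfl fun i hi => by rw [d1 i hi, d2 i hi]]
  rcases Int.even_or_odd' r with ⟨j, hj | hj⟩
  · rw [hj, heven, Finset.sum_eq_zero]
    intro i _
    rw [if_neg (by omega), if_neg (by omega)]; simp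
  · by_cases hlt : j < 2 * N + 1
    · lift j to ℕ using by omega
      rw [Finset.sum_eq_single j, if_pos hj, if_neg (by omega), hj]
      · simp
      · intro i hi hij
        rw [Finset.mem_range] at hi
        rw [if_neg (by omega), if_neg (by omega)]; simp
      · intro hj'; exact absurd (Finset.mem_range.2 (by omega)) hj'
    · obtain ⟨l, hl⟩ : ∃ l : ℕ, (l : ℤ) = 4 * N + 1 - j := ⟨(4 * N + 1 - j).toNat, by omega⟩
      rw [Finset.sum_eq_single l, if_neg (by omega), if_pos (by omega)]
      · have : h r = - h (2 * l + 1) := by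
          rw [← hodd, ← hper (-(2 * l + 1))]
          congr 1
          omega
        rw [this]; ring
      · intro i hi hij
        rw [Finset.mem_range] at hi
        rw [if_neg (by omega), if_neg (by omega)]; simp
      · intro hj'; exact absurd (Finset.mem_range.2 (by omega)) hj'

theorem coeffTheta_sum {ι : Type*} (s : Finset ι) {K : ℕ} (hK : 0 < K) (c : ι → ℂ)
    {h : ι → ℤ → ℂ} {C : ℝ} (hC : ∀ i n, ‖h i n‖ ≤ C) (τ : ℍ) (z : ℂ) :
    coeffTheta K (fun n => ∑ i ∈ s, c i * h i n) τ z =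
      ∑ i ∈ s, c i * coeffTheta K (h i) τ z := by
  rw [← (hasSum_sum fun i _ => (hasSum_coeffTheta hK (hC i) τ z).mul_left (c i)).tsum_eq,
    coeffTheta]
  congr 1; ext n
  rw [Finset.sum_mul, Finset.sum_mul]
  exact Finset.sum_congr rfl fun i _ => by ring

/-- Expansion of an odd theta function of index `N + 1/2` in numerators of characters. -/
theorem coeffTheta_eq_sum_charNum (N : ℕ) {h : ℤ → ℂ} (hodd : ∀ n, h (-n) = -h n)
    (hper : ∀ n, h (n + (8 * N + 4)) = h n) (heven : ∀ n, h (2 * n) = 0) (τ : ℍ) (z : ℂ) :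
    coeffTheta (4 * N + 2) h τ z =
      ∑ i ∈ Finset.range (2 * N + 1), h (2 * i + 1) * charNum N i τ z := by
  simp only [charNum_eq]
  rw [← coeffTheta_sum _ (by omega) (fun i : ℕ => h (2 * i + 1))
    (fun (i : ℕ) n => norm_oddInd_le (8 * N + 4) (2 * i + 1) n)]
  congr 1
  ext n
  exact eq_sum_oddInd N hodd hper heven n

/-! ### The symmetrized characters -/

/-- A family on `0, …, 2N` summed over the orbits `{N - a, N + a}` of the reflection at `N`. -/
def orbitSum (N : ℕ) (x : ℕ → ℂ) (a : ℕ) : ℂ := if a = 0 then x N else x (N - a) + x (N + a)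

theorem sum_range_eq_sum_orbitSum (N : ℕ) (c x : ℕ → ℂ)
    (hc : ∀ a ≤ N, c (N + a) = c (N - a)) :
    ∑ i ∈ Finset.range (2 * N + 1), c i * x i =
      ∑ a ∈ Finset.range (N + 1), c (N - a) * orbitSum N x a := by
  rw [show 2 * N + 1 = N + (N + 1) by ring, Finset.sum_range_add, Finset.sum_range_succ' _ N,
    Finset.sum_range_succ' _ N, ← Finset.sum_range_reflect, ← add_assoc, ← Finset.sum_add_distrib]
  congr 1
  refine Finset.sum_congr rfl fun a ha => ?_
  rw [Finset.mem_range] at ha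
  rw [orbitSum, if_neg (by omega), hc (a + 1) (by omega), show N - 1 - a = N - (a + 1) by omega]
  ring

/-- The symmetrized characters `χ_{4N,2N}` (for `a = 0`) and `χ_{4N,2(N-a)} + χ_{4N,2(N+a)}`. -/
noncomputable def symmChar (N a : ℕ) (τ : ℍ) (z : ℂ) : ℂ :=
  orbitSum N (fun i => sl2Character (4 * N) (2 * i) τ z) a

theorem symmChar_eq (N a : ℕ) (τ : ℍ) (z : ℂ) :
    symmChar N a τ z = orbitSum N (fun i => charNum N i τ z) a / sl2Denominator τ z := by
  simp only [symmChar, orbitSum, sl2Character_eq]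
  split_ifs
  · rfl
  · rw [add_div]

theorem charNum_T (N i : ℕ) (τ : ℍ) (z : ℂ) :
    charNum N i (ModularGroup.T • τ) z =
      phase ((2 * i + 1 : ℝ) ^ 2 / (8 * N + 4)) * charNum N i τ z := by
  rw [charNum_eq, charNum_eq, coeffTheta_T (by omega) (2 * i + 1)]
  · congr 2; push_cast; ring
  · intro n hn
    have h8 : (4 * ((4 * N + 2 : ℕ) : ℤ)) = 2 * (8 * N + 4) := by push_cast; ring
    -- `n = ± s + m k` with `s` odd and `m` divisible by `4`, so `n² - s² = m k (m k ± 2 s)`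
    have key : ∀ s k : ℤ, (2 * (8 * N + 4) : ℤ) ∣ (s + (8 * N + 4) * k) ^ 2 - s ^ 2 := fun s k =>
      ⟨s * k + (4 * N + 2) * k ^ 2, by ring⟩
    rw [h8]
    by_cases h1 : (8 * N + 4 : ℤ) ∣ n - (2 * i + 1)
    · obtain ⟨k, hk⟩ := h1
      rw [show n = (2 * i + 1) + (8 * N + 4) * k by linarith]
      exact key _ k
    · by_cases h2 : (8 * N + 4 : ℤ) ∣ n - -(2 * i + 1)
      · obtain ⟨k, hk⟩ := h2
        rw [show n = -(2 * i + 1) + (8 * N + 4) * k by linarith, ← neg_sq (2 * (i : ℤ) + 1)]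
        exact key _ k
      · exact absurd (by rw [oddInd, residueInd, residueInd, if_neg h1, if_neg h2, sub_zero]) hn

theorem sl2Denominator_T (τ : ℍ) (z : ℂ) :
    sl2Denominator (ModularGroup.T • τ) z = phase (1 / 4) * sl2Denominator τ z := by
  have := charNum_T 0 0 τ z
  rw [charNum_zero, charNum_zero] at this
  rw [this]; norm_num

/-- The `T`-matrix of the coefficient vector for general `N`. -/
noncomputable def weilT (N : ℕ) : Matrix (Fin (N + 1)) (Fin (N + 1)) ℂ :=
  Matrix.diagonal fun a => phase (((2 * N + 1) - (2 * N + 1 - 2 * ((a : ℕ) : ℝ)) ^ 2) /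
    (4 * (2 * N + 1)))

/-- The `S`-matrix of the coefficient vector for general `N`. -/
noncomputable def weilS (N : ℕ) : Matrix (Fin (N + 1)) (Fin (N + 1)) ℂ :=
  Matrix.of fun a b => (((if b = 0 then 1 else 2) / √(2 * N + 1) *
    Real.sin (Real.pi * (2 * N + 1 - 2 * ((a : ℕ) : ℝ)) * (2 * N + 1 - 2 * ((b : ℕ) : ℝ)) /
      (2 * (2 * N + 1))) : ℝ) : ℂ)

theorem symmChar_T (N : ℕ) (a : Fin (N + 1)) (τ : ℍ) (z : ℂ) :
    symmChar N a (ModularGroup.T • τ) z * weilT N a a = symmChar N a τ z := by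
  have hN : (2 * N + 1 : ℝ) ≠ 0 := by positivity
  have ha : (a : ℕ) ≤ N := by omega
  have h1 : orbitSum N (fun i => charNum N i (ModularGroup.T • τ) z) a =
      phase ((2 * N + 1 - 2 * ((a : ℕ) : ℝ)) ^ 2 / (8 * N + 4)) *
        orbitSum N (fun i => charNum N i τ z) a := by
    have e : (8 * N + 4 : ℝ) = 4 * (2 * N + 1) := by ring
    simp only [orbitSum, charNum_T]
    split_ifs with h0
    · simp [h0]
    · rw [mul_add]
      congr 2
      · congr 3; push_cast [ha]; ring
      · refine phase_congr (a : ℕ) ?_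
        rw [e]
        push_cast
        field_simp
        ring
  rw [symmChar_eq, symmChar_eq, h1, sl2Denominator_T, weilT, Matrix.diagonal_apply_eq,
    mul_div_mul_comm, mul_right_comm]
  rw [show phase (((2 * N + 1) - (2 * N + 1 - 2 * ((a : ℕ) : ℝ)) ^ 2) / (4 * (2 * N + 1))) =
    phase (1 / 4) / phase ((2 * N + 1 - 2 * ((a : ℕ) : ℝ)) ^ 2 / (8 * N + 4)) by
      rw [eq_div_iff (phase_ne_zero _), ← phase_add]
      congr 1
      have e : (8 * N + 4 : ℝ) = 4 * (2 * N + 1) := by ring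
      rw [e]; field_simp; ring]
  rw [div_mul_div_cancel₀ (phase_ne_zero _), div_self (phase_ne_zero _), one_mul]

theorem phase_neg_sub_phase (x : ℝ) :
    phase (-x) - phase x = -2 * Complex.I * (Real.sin (Real.pi * x) : ℝ) := by
  rw [phase, phase, Complex.ofReal_sin, Complex.sin]
  push_cast
  rw [show Complex.I * Real.pi * -x = -(Real.pi * x) * Complex.I by ring,
    show Complex.I * Real.pi * x = (Real.pi * x) * Complex.I by ring]
  linear_combination (Complex.exp (-(Real.pi * x) * Complex.I) -
    Complex.exp ((Real.pi * x) * Complex.I)) * Complex.I_mul_I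

theorem charNum_S (N i : ℕ) (τ : ℍ) (z : ℂ) :
    charNum N i (ModularGroup.S • τ) (z / τ) = thetaFactor (4 * N + 2) τ z *
      coeffTheta (4 * N + 2)
        (fun n => -2 * Complex.I * (Real.sin (Real.pi * ((2 * i + 1) * n / (4 * N + 2))) : ℝ))
        τ z := by
  have hK : 0 < 4 * N + 2 := by omega
  rw [charNum, classicalTheta_S hK, classicalTheta_S hK, ← mul_sub,
    ← coeffTheta_sub hK (fun n => (norm_phase _).le) (fun n => (norm_phase _).le)]
  congr 2; ext n
  rw [← phase_neg_sub_phase]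
  congr 2 <;> push_cast <;> ring

theorem sin_pi_mul_congr {x y : ℝ} (m : ℤ) (h : x = y + 2 * m) :
    Real.sin (Real.pi * x) = Real.sin (Real.pi * y) := by
  rw [h, show Real.pi * (y + 2 * m) = Real.pi * y + m * (2 * Real.pi) by ring,
    Real.sin_add_int_mul_two_pi]

theorem sin_pi_mul_congr_sub {x y : ℝ} (m : ℤ) (h : x = 1 - y + 2 * m) :
    Real.sin (Real.pi * x) = Real.sin (Real.pi * y) := by
  rw [sin_pi_mul_congr m h, mul_sub, mul_one, Real.sin_pi_sub]

theorem sl2Denominator_S (τ : ℍ) (z : ℂ) :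
    sl2Denominator (ModularGroup.S • τ) (z / τ) =
      -2 * Complex.I * thetaFactor 2 τ z * sl2Denominator τ z := by
  have := charNum_S 0 0 τ z
  rw [charNum_zero, coeffTheta_eq_sum_charNum] at this
  · rw [this]
    have : Real.sin (Real.pi * ((2 * ((0 : ℕ) : ℝ) + 1) * ((2 * ((0 : ℕ) : ℤ) + 1 : ℤ) : ℝ) /
        (4 * ((0 : ℕ) : ℝ) + 2))) = 1 := by
      conv_rhs => rw [← Real.sin_pi_div_two]
      congr 1; push_cast; ring
    rw [mul_zero, zero_add, mul_zero, zero_add, Finset.sum_range_one, this, charNum_zero,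
      Complex.ofReal_one]
    ring
  · intro n
    rw [← mul_neg, ← Complex.ofReal_neg, ← Real.sin_neg]
    congr 3; push_cast; ring
  · intro n
    congr 2
    refine sin_pi_mul_congr 1 ?_
    push_cast; ring
  · intro n
    have : Real.sin (Real.pi *
        ((2 * (0 : ℕ) + 1) * ((2 * n : ℤ) : ℝ) / (4 * (0 : ℕ) + 2))) = 0 := by
      rw [← Real.sin_int_mul_pi n]; congr 1; push_cast; ring
    rw [this]; simp

/-- The matrix of `S` on the symmetrized numerators. In general a single numerator is not
mapped to a combination of numerators, since even indices occur in its image; they cancel in the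
sum over an orbit. -/
theorem orbitSum_charNum_S (N : ℕ) {a : ℕ} (ha : a ≤ N) (τ : ℍ) (z : ℂ) :
    orbitSum N (fun i => charNum N i (ModularGroup.S • τ) (z / τ)) a =
      thetaFactor (4 * N + 2) τ z * ∑ b ∈ Finset.range (N + 1),
        (-2 * Complex.I * ((if a = 0 then 1 else 2) *
          Real.sin (Real.pi * (2 * N + 1 - 2 * (a : ℝ)) * (2 * N + 1 - 2 * (b : ℝ)) /
            (2 * (2 * N + 1))) : ℝ)) * orbitSum N (fun i => charNum N i τ z) b := by
  have hN : (4 * N + 2 : ℝ) ≠ 0 := by positivity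
  have hN' : (2 * N + 1 : ℝ) ≠ 0 := by positivity
  have hK : 0 < 4 * N + 2 := by omega
  set s : ℝ := 2 * N + 1 - 2 * a with hs
  -- the coefficients: the sine, made to vanish at even indices by the sum over the orbit
  set h : ℤ → ℂ := fun n => -2 * Complex.I *
    (orbitSum N (fun i => (Real.sin (Real.pi * ((2 * i + 1) * n / (4 * N + 2))) : ℝ)) a) with hh
  have hsin : ∀ n : ℤ, orbitSum N
      (fun i => ((Real.sin (Real.pi * ((2 * i + 1) * n / (4 * N + 2))) : ℝ) : ℂ)) a =
      if a = 0 then ((Real.sin (Real.pi * (s * n / (4 * N + 2))) : ℝ) : ℂ) else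
        ((Real.sin (Real.pi * (s * n / (4 * N + 2))) : ℝ) : ℂ) +
        ((Real.sin (Real.pi * (n - s * n / (4 * N + 2))) : ℝ) : ℂ) := by
    intro n
    simp only [orbitSum]
    split_ifs with h0
    · simp [hs, h0]
    · congr 4
      · rw [hs]; push_cast [ha]; ring
      · rw [hs]; push_cast; field_simp; ring
  have e1 : orbitSum N (fun i => charNum N i (ModularGroup.S • τ) (z / τ)) a =
      thetaFactor (4 * N + 2) τ z * coeffTheta (4 * N + 2) h τ z := by
    have hb : ∀ i : ℕ, ∀ n : ℤ, ‖(-2 * Complex.I *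
        (Real.sin (Real.pi * ((2 * i + 1) * n / (4 * N + 2))) : ℝ) : ℂ)‖ ≤ 2 := by
      intro i n
      rw [norm_mul, Complex.norm_real, Real.norm_eq_abs]
      have := Real.abs_sin_le_one (Real.pi * ((2 * i + 1) * n / (4 * N + 2)))
      have h2 : ‖(-2 * Complex.I : ℂ)‖ = 2 := by simp
      rw [h2]; linarith
    simp only [orbitSum, charNum_S, hh]
    split_ifs with h0
    · rfl
    · rw [← mul_add, ← coeffTheta_add hK (hb _) (hb _)]
      simp only [mul_add]
  rw [e1, coeffTheta_eq_sum_charNum, sum_range_eq_sum_orbitSum N (fun i : ℕ => h (2 * i + 1))]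
  · congr 1
    refine Finset.sum_congr rfl fun b hb => ?_
    have hb' : b ≤ N := by rw [Finset.mem_range] at hb; omega
    congr 1
    simp only [hh, hsin]
    congr 1
    have e2 : Real.pi * (s * ((2 * ((N - b : ℕ) : ℤ) + 1 : ℤ) : ℝ) / (4 * N + 2)) =
        Real.pi * s * (2 * N + 1 - 2 * (b : ℝ)) / (2 * (2 * N + 1)) := by
      push_cast [hb']
      rw [show (4 * N + 2 : ℝ) = 2 * (2 * N + 1) by ring]
      ring
    split_ifs with h0
    · rw [e2]; push_cast; ring
    · rw [sin_pi_mul_congr_sub (x := _ - _)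
        (y := s * ((2 * ((N - b : ℕ) : ℤ) + 1 : ℤ) : ℝ) / (4 * N + 2)) ((N - b : ℕ) : ℤ)
        (by push_cast; ring), e2]
      push_cast; ring
  · intro b hb
    simp only [hh, hsin]
    -- reflection `n ↦ 4N + 2 - n` of the argument
    have e : ((2 * ((N + b : ℕ) : ℤ) + 1 : ℤ) : ℝ) =
        (4 * N + 2) - ((2 * ((N - b : ℕ) : ℤ) + 1 : ℤ) : ℝ) := by push_cast [hb]; ring
    rw [e]
    generalize hm : (2 * ((N - b : ℕ) : ℤ) + 1 : ℤ) = m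
    have e3 : s * ((4 * N + 2) - m) / (4 * N + 2) = s - s * m / (4 * N + 2) := by field_simp
    rw [e3]
    have e4 : Real.sin (Real.pi * (s - s * m / (4 * N + 2))) =
        Real.sin (Real.pi * (s * m / (4 * N + 2))) :=
      sin_pi_mul_congr_sub (N - a) (by rw [hs]; push_cast; ring)
    have e5 : Real.sin (Real.pi * (4 * N + 2 - m - (s - s * m / (4 * N + 2)))) =
        Real.sin (Real.pi * (m - s * m / (4 * N + 2))) := by
      refine sin_pi_mul_congr_sub (N + a) ?_
      rw [hs]; push_cast; field_simp; ring
    rw [e4, e5]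
  · intro n
    simp only [hh, hsin]
    push_cast
    rw [mul_neg, neg_div, mul_neg, Complex.sin_neg, show -(n : ℂ) - -(s * n / (4 * N + 2)) =
      -(n - s * n / (4 * N + 2)) by ring, mul_neg, Complex.sin_neg]
    split_ifs <;> ring
  · intro n
    simp only [hh, hsin]
    rw [sin_pi_mul_congr (x := s * ((n + (8 * N + 4) : ℤ) : ℝ) / (4 * N + 2))
      (y := s * n / (4 * N + 2)) (2 * (N - a) + 1),
      sin_pi_mul_congr (x := ((n + (8 * N + 4) : ℤ) : ℝ) -
        s * ((n + (8 * N + 4) : ℤ) : ℝ) / (4 * N + 2))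
      (y := n - s * n / (4 * N + 2)) (2 * (N + a) + 1)]
    · rw [hs]; push_cast; field_simp; ring
    · rw [hs]; push_cast; field_simp; ring
  · intro n
    simp only [hh, hsin]
    split_ifs with h0
    · have : Real.sin (Real.pi * (s * ((2 * n : ℤ) : ℝ) / (4 * N + 2))) = 0 := by
        rw [← Real.sin_int_mul_pi n]; congr 1; rw [hs, h0]; push_cast; field_simp; ring
      rw [this]; simp
    · rw [show Real.pi * (((2 * n : ℤ) : ℝ) - s * ((2 * n : ℤ) : ℝ) / (4 * N + 2)) =
        n * (2 * Real.pi) - Real.pi * (s * ((2 * n : ℤ) : ℝ) / (4 * N + 2)) by push_cast; ring,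
        Real.sin_int_mul_two_pi_sub]
      push_cast; ring

/-- The vector of symmetrized characters. -/
noncomputable def symmCharVec (N : ℕ) (τ : ℍ) (z : ℂ) : Fin (N + 1) → ℂ :=
  fun a => symmChar N a τ z

theorem symmCharVec_T (N : ℕ) (τ : ℍ) (z : ℂ) :
    symmCharVec N (ModularGroup.T • τ) z ᵥ* weilT N = symmCharVec N τ z := by
  ext a
  have := symmChar_T N a τ z
  rw [weilT, Matrix.diagonal_apply_eq] at this
  rw [weilT, Matrix.vecMul_diagonal]
  exact this

theorem symmCharVec_S (N : ℕ) (τ : ℍ) (z : ℂ) :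
    symmCharVec N (ModularGroup.S • τ) (z / τ) =
      Complex.exp (2 * Real.pi * Complex.I * N * z ^ 2 / τ) • (symmCharVec N τ z ᵥ* weilS N) := by
  ext a
  have ha : (a : ℕ) ≤ N := by omega
  have h2 : (-2 * Complex.I * thetaFactor 2 τ z) ≠ 0 :=
    mul_ne_zero (by simp) (thetaFactor_ne_zero (by norm_num) τ z)
  simp only [symmCharVec, Pi.smul_apply, smul_eq_mul, Matrix.vecMul, dotProduct]
  rw [symmChar_eq, orbitSum_charNum_S N ha, sl2Denominator_S, thetaFactor_eq, Finset.sum_range,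
    mul_div_mul_comm, Finset.sum_div, Finset.mul_sum, Finset.mul_sum]
  refine Finset.sum_congr rfl fun b _ => ?_
  rw [symmChar_eq, weilS, Matrix.of_apply]
  have h3 : thetaFactor 2 τ z ≠ 0 := thetaFactor_ne_zero (by norm_num) τ z
  have hI := Complex.I_ne_zero
  simp only [show (a : Fin (N + 1)) = 0 ↔ (a : ℕ) = 0 from Fin.ext_iff]
  rw [show Real.pi * (2 * N + 1 - 2 * ((b : ℕ) : ℝ)) * (2 * N + 1 - 2 * ((a : ℕ) : ℝ)) =
    Real.pi * (2 * N + 1 - 2 * ((a : ℕ) : ℝ)) * (2 * N + 1 - 2 * ((b : ℕ) : ℝ)) by ring]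
  generalize Real.sin _ = w
  by_cases hD : sl2Denominator τ z = 0
  · simp [hD]
  have h5 : ((√(2 * N + 1) : ℝ) : ℂ) ≠ 0 := by
    exact_mod_cast (Real.sqrt_pos.2 (by positivity)).ne'
  push_cast
  field_simp

theorem classicalTheta_neg (K : ℕ) (a : ℤ) (τ : ℍ) (z : ℂ) :
    classicalTheta K a τ (-z) = classicalTheta K (-a) τ z := by
  rw [classicalTheta, classicalTheta, ← (Equiv.neg ℤ).tsum_eq]
  congr 1; ext m
  simp only [Equiv.neg_apply, rPow, qPow]
  push_cast
  congr 2 <;> ring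

theorem charNum_neg (N i : ℕ) (τ : ℍ) (z : ℂ) : charNum N i τ (-z) = -charNum N i τ z := by
  rw [charNum, charNum, classicalTheta_neg, classicalTheta_neg, neg_neg]; ring

theorem sl2Denominator_neg (τ : ℍ) (z : ℂ) : sl2Denominator τ (-z) = -sl2Denominator τ z := by
  rw [← charNum_zero, charNum_neg, charNum_zero]

theorem symmCharVec_neg (N : ℕ) (τ : ℍ) (z : ℂ) : symmCharVec N τ (-z) = symmCharVec N τ z := by
  ext a
  simp only [symmCharVec, symmChar, orbitSum, sl2Character_eq, charNum_neg, sl2Denominator_neg,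
    neg_div_neg_eq]

/-! ### Linear independence of the characters -/

theorem integral_rPow (n : ℤ) :
    ∫ x in (0 : ℝ)..2, rPow x ((n : ℝ) / 2) = if n = 0 then 2 else 0 := by
  split_ifs with h
  · simp [h, rPow]
  · have hc : (Real.pi * Complex.I * n : ℂ) ≠ 0 := by simp [h, Real.pi_ne_zero]
    have e : ∀ x : ℝ, rPow x ((n : ℝ) / 2) = Complex.exp (Real.pi * Complex.I * n * x) := by
      intro x; rw [rPow]; congr 1; push_cast; ring
    simp only [e]
    rw [integral_exp_mul_complex hc, div_eq_zero_iff, sub_eq_zero]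
    left
    rw [Complex.exp_eq_exp_iff_exists_int]
    exact ⟨n, by push_cast; ring⟩

theorem norm_rPow_ofReal (x y : ℝ) : ‖rPow x y‖ = 1 := by
  rw [rPow, show 2 * Real.pi * Complex.I * y * x = ((2 * Real.pi * y * x : ℝ) : ℂ) * Complex.I by
    push_cast; ring, Complex.norm_exp_ofReal_mul_I]

/-- Uniqueness of the coefficients of an absolutely convergent Fourier series. -/
theorem eq_zero_of_hasSum_rPow {a : ℤ → ℂ}
    (h : ∀ z : ℂ, HasSum (fun n : ℤ => a n * rPow z ((n : ℝ) / 2)) 0) (m : ℤ) : a m = 0 := by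
  have hs : Summable fun n => ‖a n‖ := by
    have := (h 0).summable.norm
    simpa [rPow_zero_left] using this
  have hi := intervalIntegral.hasSum_integral_of_dominated_convergence (μ := MeasureTheory.volume)
    (a := 0) (b := 2)
    (F := fun (n : ℤ) (x : ℝ) => a n * rPow x ((n : ℝ) / 2) * rPow x ((-m : ℤ) / 2 : ℝ))
    (f := fun _ => 0) (fun n _ => ‖a n‖)
    (fun n => by
      apply Continuous.aestronglyMeasurable
      unfold rPow; fun_prop)
    (fun n => by
      refine Filter.Eventually.of_forall fun x _ => ?_
      rw [norm_mul, norm_mul, norm_rPow_ofReal, norm_rPow_ofReal]; simp)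
    (Filter.Eventually.of_forall fun x _ => hs)
    (by simp)
    (Filter.Eventually.of_forall fun x _ => by
      simpa using (h x).mul_right (rPow x ((-m : ℤ) / 2 : ℝ)))
  have e : ∀ n : ℤ, (∫ x in (0 : ℝ)..2, a n * rPow x ((n : ℝ) / 2) * rPow x ((-m : ℤ) / 2 : ℝ)) =
      if n = m then 2 * a m else 0 := by
    intro n
    have : ∀ x : ℝ, a n * rPow x ((n : ℝ) / 2) * rPow x ((-m : ℤ) / 2 : ℝ) =
        a n * rPow x (((n - m : ℤ) : ℝ) / 2) := by
      intro x
      rw [mul_assoc, ← rPow_add]; congr 2; push_cast; ring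
    simp only [this]
    rw [intervalIntegral.integral_const_mul, integral_rPow]
    by_cases hnm : n = m
    · simp [hnm]; ring
    · simp [hnm, sub_eq_zero]
  simp only [e, intervalIntegral.integral_zero] at hi
  have := hi.unique (hasSum_ite_eq m (2 * a m))
  simpa using this.symm

theorem coeff_eq_zero_of_coeffTheta_eq_zero {K : ℕ} (hK : 0 < K) {h : ℤ → ℂ} {C : ℝ}
    (hC : ∀ n, ‖h n‖ ≤ C) {τ : ℍ} (h0 : ∀ z, coeffTheta K h τ z = 0) (n : ℤ) : h n = 0 := by
  have := eq_zero_of_hasSum_rPow (fun z => h0 z ▸ hasSum_coeffTheta hK hC τ z) n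
  exact (mul_eq_zero.1 this).resolve_right (qPow_ne_zero _ _)

theorem oddInd_apply (N : ℕ) {i j : ℕ} (hi : i < 2 * N + 1) (hj : j < 2 * N + 1) :
    oddInd (8 * N + 4) (2 * i + 1) (2 * j + 1) = if i = j then 1 else 0 := by
  have h2 : ¬ (8 * N + 4 : ℤ) ∣ (2 * j + 1) - -(2 * i + 1) := by
    intro hd
    have := Int.eq_zero_of_abs_lt_dvd hd (by rw [abs_lt]; constructor <;> omega)
    omega
  rw [oddInd, residueInd, residueInd, if_neg h2, sub_zero]
  congr 1
  rw [eq_iff_iff]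
  constructor
  · intro hd
    have := Int.eq_zero_of_abs_lt_dvd hd (by rw [abs_lt]; constructor <;> omega)
    omega
  · rintro rfl; simp

theorem coeff_eq_zero_of_sum_charNum_eq_zero (N : ℕ) {c : ℕ → ℂ} {τ : ℍ}
    (h : ∀ z, ∑ i ∈ Finset.range (2 * N + 1), c i * charNum N i τ z = 0) {j : ℕ}
    (hj : j < 2 * N + 1) : c j = 0 := by
  have hK : 0 < 4 * N + 2 := by omega
  simp only [charNum_eq] at h
  simp only [← coeffTheta_sum (Finset.range (2 * N + 1)) hK c
    (fun (i : ℕ) n => norm_oddInd_le (8 * N + 4) (2 * i + 1) n)] at h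
  have hC : ∀ n : ℤ, ‖∑ i ∈ Finset.range (2 * N + 1), c i * oddInd (8 * N + 4) (2 * i + 1) n‖ ≤
      ∑ i ∈ Finset.range (2 * N + 1), ‖c i‖ * 2 := fun n =>
    norm_sum_le_of_le _ fun i _ => by
      rw [norm_mul]
      exact mul_le_mul_of_nonneg_left (norm_oddInd_le _ _ _) (norm_nonneg _)
  have := coeff_eq_zero_of_coeffTheta_eq_zero hK hC h (2 * j + 1)
  rw [Finset.sum_congr rfl fun i hi => by rw [oddInd_apply N (Finset.mem_range.1 hi) hj]] at this
  simpa [hj] using this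

theorem differentiable_charNum (N i : ℕ) (τ : ℍ) : Differentiable ℂ (charNum N i τ) :=
  (differentiable_classicalTheta (by omega) _ τ).sub (differentiable_classicalTheta (by omega) _ τ)

theorem exists_sl2Denominator_ne_zero (τ : ℍ) : ∃ z, sl2Denominator τ z ≠ 0 := by
  by_contra! h
  have := coeff_eq_zero_of_sum_charNum_eq_zero 0 (c := fun _ => 1) (τ := τ)
    (fun z => by simp [charNum_zero, h z]) (j := 0) (by norm_num)
  exact one_ne_zero this

/-- The numerators are entire in `z` and the denominator is not identically zero, so that a linear
relation away from the zeros of the denominator holds everywhere. -/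
theorem coeff_eq_zero_of_sum_sl2Character_eq_zero (N : ℕ) {c : ℕ → ℂ} {τ : ℍ}
    (h : ∀ z, sl2Denominator τ z ≠ 0 →
      ∑ i ∈ Finset.range (2 * N + 1), c i * sl2Character (4 * N) (2 * i) τ z = 0) {j : ℕ}
    (hj : j < 2 * N + 1) : c j = 0 := by
  refine coeff_eq_zero_of_sum_charNum_eq_zero N (c := c) (τ := τ) ?_ hj
  set F : ℂ → ℂ := fun z => ∑ i ∈ Finset.range (2 * N + 1), c i * charNum N i τ z
  have hF : Differentiable ℂ F :=
    Differentiable.fun_sum fun i _ => (differentiable_charNum N i τ).const_mul _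
  have hD : Differentiable ℂ (sl2Denominator τ) := by
    have := differentiable_charNum 0 0 τ
    rwa [funext (charNum_zero τ)] at this
  have hFD : ∀ z ∈ Set.univ, F z * sl2Denominator τ z = 0 := by
    intro z _
    by_cases hz : sl2Denominator τ z = 0
    · rw [hz, mul_zero]
    · have := h z hz
      simp only [sl2Character_eq, ← mul_div_assoc, ← Finset.sum_div] at this
      rw [div_eq_zero_iff] at this
      rw [show F z = 0 from this.resolve_right hz, zero_mul]
  rcases AnalyticOnNhd.eq_zero_or_eq_zero_of_mul_eq_zero (U := Set.univ)
    (fun z _ => hF.analyticAt z) (fun z _ => hD.analyticAt z) hFD isPreconnected_univ with h1 | h1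
  · exact fun z => h1 z trivial
  · obtain ⟨z, hz⟩ := exists_sl2Denominator_ne_zero τ
    exact absurd (h1 z trivial) hz

/-- Linear independence of the symmetrized characters, for fixed `τ`. -/
theorem eq_zero_of_dotProduct_symmCharVec_eq_zero (N : ℕ) {v : Fin (N + 1) → ℂ} {τ : ℍ}
    (h : ∀ z, sl2Denominator τ z ≠ 0 → symmCharVec N τ z ⬝ᵥ v = 0) : v = 0 := by
  -- extend `v` to a reflection-symmetric family on `0, …, 2N`
  set w : ℕ → ℂ := fun a => if ha : a < N + 1 then v ⟨a, ha⟩ else 0 with hw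
  set c : ℕ → ℂ := fun i => if i ≤ N then w (N - i) else w (i - N) with hc
  have h1 : ∀ z, sl2Denominator τ z ≠ 0 →
      ∑ i ∈ Finset.range (2 * N + 1), c i * sl2Character (4 * N) (2 * i) τ z = 0 := by
    intro z hz
    rw [sum_range_eq_sum_orbitSum, Finset.sum_range, ← h z hz]
    · refine Finset.sum_congr rfl fun a _ => ?_
      have ha : (a : ℕ) < N + 1 := a.2
      rw [mul_comm]
      simp only [symmCharVec, symmChar, hc, hw]
      rw [if_pos (by omega), dif_pos (by omega)]
      congr 2; ext; simp only; omega
    · intro a ha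
      simp only [hc]
      rw [if_pos (show N - a ≤ N by omega), show N - (N - a) = a by omega]
      split_ifs with h2
      · rw [show N - (N + a) = a by omega]
      · rw [show N + a - N = a by omega]
  ext a
  have := coeff_eq_zero_of_sum_sl2Character_eq_zero N h1 (j := N - a) (by omega)
  simp only [hc, hw] at this
  rw [if_pos (by omega), dif_pos (by omega)] at this
  rw [Pi.zero_apply, ← this]
  congr 1; ext; simp only; omega

/-! ### Theta expansions with coefficients holomorphic in `τ` -/

/-- Majorization of the functions `a n` on `U` by a summable sequence, up to exponential growth in
`Im τ`. -/
def MajorizedOn (a : ℤ → ℍ → ℂ) (U : Set ℍ) : Prop :=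
  ∃ u : ℤ → ℝ, Summable u ∧ (∀ n, 0 ≤ u n) ∧
    ∃ M : ℝ, ∀ n, ∀ τ ∈ U, ‖a n τ‖ ≤ u n * Real.exp (M * τ.im)

theorem MajorizedOn.mono {a : ℤ → ℍ → ℂ} {U V : Set ℍ} (h : MajorizedOn a U) (hVU : V ⊆ U) :
    MajorizedOn a V := by
  obtain ⟨u, hu, hu0, M, hM⟩ := h
  exact ⟨u, hu, hu0, M, fun n τ hτ => hM n τ (hVU hτ)⟩

/-- The equivalence `(n, k) ↦ (k, n - k)` behind the Cauchy product over `ℤ`. -/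
def cauchyEquiv : ℤ × ℤ ≃ ℤ × ℤ where
  toFun x := (x.2, x.1 - x.2)
  invFun x := (x.1 + x.2, x.1)
  left_inv x := by ext <;> simp
  right_inv x := by ext <;> simp

/-- The Cauchy product of two doubly infinite sequences of functions. -/
noncomputable def cauchyProd (a b : ℤ → ℍ → ℂ) (n : ℤ) (τ : ℍ) : ℂ := ∑' k, a k τ * b (n - k) τ

theorem summable_cauchy_majorant {u v : ℤ → ℝ} (hu : Summable u) (hv : Summable v)
    (hu0 : ∀ n, 0 ≤ u n) (hv0 : ∀ n, 0 ≤ v n) :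
    Summable fun x : ℤ × ℤ => u x.2 * v (x.1 - x.2) :=
  cauchyEquiv.summable_iff.2 (hu.mul_of_nonneg hv hu0 hv0)

theorem MajorizedOn.cauchyProd {a b : ℤ → ℍ → ℂ} {U : Set ℍ} (ha : MajorizedOn a U)
    (hb : MajorizedOn b U) : MajorizedOn (cauchyProd a b) U := by
  obtain ⟨u, hu, hu0, M, hM⟩ := ha
  obtain ⟨v, hv, hv0, M', hM'⟩ := hb
  have hs := summable_cauchy_majorant hu hv hu0 hv0
  refine ⟨fun n => ∑' k, u k * v (n - k), hs.prod,
    fun n => tsum_nonneg fun k => mul_nonneg (hu0 _) (hv0 _), M + M', fun n τ hτ => ?_⟩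
  have h1 : ∀ k, ‖a k τ * b (n - k) τ‖ ≤ u k * v (n - k) * Real.exp ((M + M') * τ.im) := by
    intro k
    rw [norm_mul, add_mul, Real.exp_add, mul_mul_mul_comm]
    exact mul_le_mul (hM _ _ hτ) (hM' _ _ hτ) (norm_nonneg _)
      (mul_nonneg (hu0 _) (Real.exp_nonneg _))
  exact tsum_of_norm_bounded ((hs.prod_factor n).hasSum.mul_right _) h1

theorem MajorizedOn.add {a b : ℤ → ℍ → ℂ} {U : Set ℍ} (ha : MajorizedOn a U)
    (hb : MajorizedOn b U) : MajorizedOn (fun n τ => a n τ + b n τ) U := by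
  obtain ⟨u, hu, hu0, M, hM⟩ := ha
  obtain ⟨v, hv, hv0, M', hM'⟩ := hb
  refine ⟨fun n => u n + v n, hu.add hv, fun n => add_nonneg (hu0 n) (hv0 n), max M M',
    fun n τ hτ => (norm_add_le _ _).trans ?_⟩
  rw [add_mul]
  have hy := τ.im_pos.le
  refine add_le_add ((hM n τ hτ).trans ?_) ((hM' n τ hτ).trans ?_)
  · exact mul_le_mul_of_nonneg_left (Real.exp_le_exp.2
      (mul_le_mul_of_nonneg_right (le_max_left _ _) hy)) (hu0 n)
  · exact mul_le_mul_of_nonneg_left (Real.exp_le_exp.2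
      (mul_le_mul_of_nonneg_right (le_max_right _ _) hy)) (hv0 n)

theorem mdifferentiable_tsum {f : ℤ → ℍ → ℂ}
    (hf : ∀ k, MDifferentiable (modelWithCornersSelf ℂ ℂ) (modelWithCornersSelf ℂ ℂ) (f k))
    (hm : ∀ τ : ℍ, ∃ U ∈ nhds τ, MajorizedOn f U) :
    MDifferentiable (modelWithCornersSelf ℂ ℂ) (modelWithCornersSelf ℂ ℂ)
      (fun τ => ∑' k, f k τ) := by
  intro τ₀
  rw [UpperHalfPlane.mdifferentiableAt_iff]
  obtain ⟨U, hU, u, hu, hu0, M, hM⟩ := hm τ₀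
  -- shrink `U` so that the exponential factor is bounded
  set V : Set ℍ := interior U ∩ {τ : ℍ | τ.im < τ₀.im + 1} with hV
  have hVo : IsOpen V :=
    isOpen_interior.inter (isOpen_lt UpperHalfPlane.continuous_im continuous_const)
  have hVτ : τ₀ ∈ V := ⟨mem_interior_iff_mem_nhds.2 hU, by simp⟩
  have hso : IsOpen (((↑) : ℍ → ℂ) '' V) := UpperHalfPlane.isOpenEmbedding_coe.isOpenMap V hVo
  have key : DifferentiableOn ℂ (fun w => ∑' k, (f k ∘ UpperHalfPlane.ofComplex) w)
      (((↑) : ℍ → ℂ) '' V) := by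
    refine Complex.differentiableOn_tsum_of_summable_norm
      (hu.mul_right (Real.exp (|M| * (τ₀.im + 1)))) (fun k => ?_) hso ?_
    · rintro _ ⟨τ, _, rfl⟩
      exact (UpperHalfPlane.mdifferentiableAt_iff.1 (hf k τ)).differentiableWithinAt
    · rintro k _ ⟨τ, hτ, rfl⟩
      rw [Function.comp_apply, UpperHalfPlane.ofComplex_apply]
      refine (hM k τ (interior_subset hτ.1)).trans (mul_le_mul_of_nonneg_left ?_ (hu0 k))
      rw [Real.exp_le_exp]
      exact mul_le_mul (le_abs_self M) (le_of_lt hτ.2) τ.im_pos.le (abs_nonneg M)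
  exact (key.differentiableAt (hso.mem_nhds ⟨τ₀, hVτ, rfl⟩))

/-- `F(τ,z) = ∑ₙ aₙ(τ) r^(n/2)` is a theta function of index `K/2`, of sign `ε` under `z ↦ z + τ`,
of parity `p` under `z ↦ -z` and of sign `d` under `z ↦ z + 1`; all three are expressed through the
coefficients, which are holomorphic, locally uniformly summable, and of at most exponential growth
at the cusp. -/
structure IsThetaExpansion (K : ℤ) (ε p d : ℂ) (F : ℍ → ℂ → ℂ) (a : ℤ → ℍ → ℂ) : Prop where
  hasSum : ∀ τ z, HasSum (fun n : ℤ => a n τ * rPow z ((n : ℝ) / 2)) (F τ z)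
  quasi : ∀ n τ, a (n + 2 * K) τ = ε * qPow τ (((n : ℝ) + K) / 2) * a n τ
  neg : ∀ n τ, a (-n) τ = p * a n τ
  parity : ∀ n τ, (-1 : ℂ) ^ n * a n τ = d * a n τ
  holo : ∀ n, MDifferentiable (modelWithCornersSelf ℂ ℂ) (modelWithCornersSelf ℂ ℂ) (a n)
  locMaj : ∀ τ : ℍ, ∃ U ∈ nhds τ, MajorizedOn a U
  growth : MajorizedOn a {τ | 1 ≤ τ.im}

/-- The functions having a theta expansion. -/
def HasThetaExpansion (K : ℤ) (ε p d : ℂ) (F : ℍ → ℂ → ℂ) : Prop :=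
  ∃ a, IsThetaExpansion K ε p d F a

theorem MajorizedOn.mul_right_reindex {a b : ℤ → ℍ → ℂ} {U : Set ℍ} (ha : MajorizedOn a U)
    (hb : MajorizedOn b U) (n : ℤ) : MajorizedOn (fun k τ => a k τ * b (n - k) τ) U := by
  obtain ⟨u, hu, hu0, M, hM⟩ := ha
  obtain ⟨v, hv, hv0, M', hM'⟩ := hb
  refine ⟨fun k => u k * v (n - k),
    (summable_cauchy_majorant hu hv hu0 hv0).prod_factor n,
    fun k => mul_nonneg (hu0 _) (hv0 _), M + M', fun k τ hτ => ?_⟩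
  rw [norm_mul, add_mul, Real.exp_add, mul_mul_mul_comm]
  exact mul_le_mul (hM _ _ hτ) (hM' _ _ hτ) (norm_nonneg _)
    (mul_nonneg (hu0 _) (Real.exp_nonneg _))

/-- The transformation behaviour of a product is read off from the Cauchy product of the
coefficients by reindexing. -/
theorem HasThetaExpansion.mul {K L : ℤ} {ε p d ε' p' d' : ℂ} {F G : ℍ → ℂ → ℂ}
    (hF : HasThetaExpansion K ε p d F) (hG : HasThetaExpansion L ε' p' d' G) :
    HasThetaExpansion (K + L) (ε * ε') (p * p') (d * d') (fun τ z => F τ z * G τ z) := by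
  obtain ⟨a, ha⟩ := hF
  obtain ⟨b, hb⟩ := hG
  refine ⟨cauchyProd a b, ?_, ?_, ?_, ?_, ?_, ?_, ha.growth.cauchyProd hb.growth⟩
  · intro τ z
    have hs : Summable fun x : ℤ × ℤ => a x.1 τ * rPow z ((x.1 : ℝ) / 2) *
        (b x.2 τ * rPow z ((x.2 : ℝ) / 2)) :=
      summable_mul_of_summable_norm (R := ℂ) (f := fun n => a n τ * rPow z ((n : ℝ) / 2))
        (g := fun n => b n τ * rPow z ((n : ℝ) / 2)) (ha.hasSum τ z).summable.norm
        (hb.hasSum τ z).summable.norm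
    have h1 := (ha.hasSum τ z).mul (hb.hasSum τ z) hs
    have h2 : HasSum (fun x : ℤ × ℤ => a x.2 τ * b (x.1 - x.2) τ * rPow z ((x.1 : ℝ) / 2))
        (F τ z * G τ z) := by
      convert (cauchyEquiv.hasSum_iff (f := fun x : ℤ × ℤ => a x.1 τ * rPow z ((x.1 : ℝ) / 2) *
        (b x.2 τ * rPow z ((x.2 : ℝ) / 2)))).2 h1 using 2 with x
      simp only [Function.comp_apply, cauchyEquiv, Equiv.coe_fn_mk]
      rw [mul_mul_mul_comm, ← rPow_add]
      congr 2; push_cast; ring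
    have h3 : ∀ n : ℤ, HasSum (fun k : ℤ => a k τ * b (n - k) τ * rPow z ((n : ℝ) / 2))
        (cauchyProd a b n τ * rPow z ((n : ℝ) / 2)) := by
      intro n
      rw [cauchyProd, ← tsum_mul_right]
      exact (h2.summable.prod_factor n).hasSum
    exact h2.prod_fiberwise h3
  · intro n τ
    rw [cauchyProd, cauchyProd, ← (Equiv.addRight (2 * K)).tsum_eq, ← tsum_mul_left]
    congr 1; ext k
    rw [Equiv.coe_addRight, ha.quasi, show n + 2 * (K + L) - (k + 2 * K) = n - k + 2 * L by ring,
      hb.quasi, show ((n : ℝ) + ((K + L : ℤ) : ℝ)) / 2 =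
        ((k : ℝ) + K) / 2 + (((n - k : ℤ) : ℝ) + L) / 2 by push_cast; ring, qPow_add]
    ring
  · intro n τ
    rw [cauchyProd, cauchyProd, ← (Equiv.neg ℤ).tsum_eq, ← tsum_mul_left]
    congr 1; ext k
    rw [Equiv.neg_apply, ha.neg, show -n - -k = -(n - k) by ring, hb.neg]
    ring
  · intro n τ
    rw [cauchyProd, ← tsum_mul_left, ← tsum_mul_left]
    congr 1; ext k
    rw [show (-1 : ℂ) ^ n = (-1) ^ k * (-1) ^ (n - k) by
      rw [← zpow_add₀ (by norm_num)]; congr 1; ring]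
    rw [mul_mul_mul_comm, ha.parity, hb.parity]
    ring
  · intro n
    refine mdifferentiable_tsum (fun k => (ha.holo k).mul (hb.holo (n - k))) fun τ => ?_
    obtain ⟨U, hU, hU'⟩ := ha.locMaj τ
    obtain ⟨V, hV, hV'⟩ := hb.locMaj τ
    exact ⟨U ∩ V, Filter.inter_mem hU hV, (hU'.mono Set.inter_subset_left).mul_right_reindex
      (hV'.mono Set.inter_subset_right) n⟩
  · intro τ
    obtain ⟨U, hU, hU'⟩ := ha.locMaj τ
    obtain ⟨V, hV, hV'⟩ := hb.locMaj τ
    exact ⟨U ∩ V, Filter.inter_mem hU hV, (hU'.mono Set.inter_subset_left).cauchyProd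
      (hV'.mono Set.inter_subset_right)⟩

theorem HasThetaExpansion.add {K : ℤ} {ε p d : ℂ} {F G : ℍ → ℂ → ℂ}
    (hF : HasThetaExpansion K ε p d F) (hG : HasThetaExpansion K ε p d G) :
    HasThetaExpansion K ε p d (fun τ z => F τ z + G τ z) := by
  obtain ⟨a, ha⟩ := hF
  obtain ⟨b, hb⟩ := hG
  refine ⟨fun n τ => a n τ + b n τ, fun τ z => ?_, fun n τ => ?_, fun n τ => ?_, fun n τ => ?_,
    fun n => (ha.holo n).add (hb.holo n), fun τ => ?_, ha.growth.add hb.growth⟩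
  · simpa only [add_mul] using (ha.hasSum τ z).add (hb.hasSum τ z)
  · rw [ha.quasi, hb.quasi, mul_add]
  · rw [ha.neg, hb.neg, mul_add]
  · rw [mul_add, mul_add, ha.parity, hb.parity]
  · obtain ⟨U, hU, hU'⟩ := ha.locMaj τ
    obtain ⟨V, hV, hV'⟩ := hb.locMaj τ
    exact ⟨U ∩ V, Filter.inter_mem hU hV, (hU'.mono Set.inter_subset_left).add
      (hV'.mono Set.inter_subset_right)⟩

/-- Functions of `τ` alone are theta functions of index `0`. -/
theorem hasThetaExpansion_const {h : ℍ → ℂ}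
    (hh : MDifferentiable (modelWithCornersSelf ℂ ℂ) (modelWithCornersSelf ℂ ℂ) h) {C M : ℝ}
    (hg : ∀ τ : ℍ, 1 ≤ τ.im → ‖h τ‖ ≤ C * Real.exp (M * τ.im)) :
    HasThetaExpansion 0 1 1 1 (fun τ _ => h τ) := by
  have hsum : ∀ c : ℝ, Summable fun n : ℤ => if n = 0 then c else 0 := fun c =>
    (hasSum_ite_eq 0 c).summable
  have hmaj : ∀ {U : Set ℍ} {C M : ℝ}, 0 ≤ C →
      (∀ τ ∈ U, ‖h τ‖ ≤ C * Real.exp (M * τ.im)) →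
      MajorizedOn (fun n τ => if n = 0 then h τ else 0) U := by
    intro U C M hC hU
    refine ⟨fun n => if n = 0 then C else 0, hsum C,
      fun n => by dsimp only; split_ifs <;> simp [hC], M, fun n τ hτ => ?_⟩
    dsimp only
    split_ifs
    · exact hU τ hτ
    · simp
  refine ⟨fun n τ => if n = 0 then h τ else 0, ?_, ?_, ?_, ?_, ?_, ?_, ?_⟩
  · intro τ z
    convert hasSum_ite_eq (0 : ℤ) (h τ) using 2 with n
    split_ifs with hn
    · simp [hn, rPow_zero_right]
    · simp
  · intro n τ
    simp only [mul_zero, add_zero]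
    split_ifs with hn
    · simp [hn, qPow_zero]
    · simp
  · intro n τ; simp
  · intro n τ
    split_ifs with hn
    · simp [hn]
    · simp
  · intro n
    split_ifs
    · exact hh
    · exact mdifferentiable_const
  · intro τ₀
    have hc : ContinuousAt h τ₀ := (hh τ₀).continuousAt
    refine ⟨{τ | ‖h τ‖ < ‖h τ₀‖ + 1}, hc.norm.eventually_lt continuousAt_const (by simp),
      hmaj (C := ‖h τ₀‖ + 1) (M := 0) (by positivity) fun τ hτ => ?_⟩
    simpa using (le_of_lt hτ)
  · refine hmaj (C := |C|) (M := M) (abs_nonneg C) fun τ hτ => (hg τ hτ).trans ?_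
    exact mul_le_mul_of_nonneg_right (le_abs_self C) (Real.exp_nonneg _)

/-- The theta functions of index `1/2`. -/
theorem hasThetaExpansion_coeffTheta {h : ℤ → ℂ} {ε p d : ℂ} (hb : ∀ n, ‖h n‖ ≤ 1)
    (hε : ∀ n, h (n + 2) = ε * h n) (hp : ∀ n, h (-n) = p * h n)
    (hd : ∀ n : ℤ, (-1 : ℂ) ^ n * h n = d * h n) :
    HasThetaExpansion 1 ε p d (coeffTheta 2 h) := by
  have hmaj : ∀ {y : ℝ}, 0 < y →
      MajorizedOn (fun n τ => h n * qPow τ ((n : ℝ) ^ 2 / (4 * (2 : ℕ)))) {τ | y ≤ τ.im} := by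
    intro y hy
    set τy : ℍ := ⟨Complex.I * y, by simpa using hy⟩
    have hτy : τy.im = y := by simp [τy, UpperHalfPlane.im]
    have hs := (summable_coeffTheta (K := 2) (h := fun _ => 1) (C := 1) (by norm_num)
      (fun _ => by simp) τy 0).norm
    refine ⟨_, hs, fun n => norm_nonneg _, 0, fun n τ hτ => ?_⟩
    rw [rPow_zero_left, mul_one, one_mul, zero_mul, Real.exp_zero, mul_one, norm_mul, norm_qPow,
      norm_qPow, hτy]
    refine (mul_le_of_le_one_left (Real.exp_nonneg _) (hb n)).trans ?_
    rw [Real.exp_le_exp, neg_le_neg_iff]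
    exact mul_le_mul_of_nonneg_left hτ (by positivity)
  refine ⟨fun n τ => h n * qPow τ ((n : ℝ) ^ 2 / (4 * (2 : ℕ))),
    hasSum_coeffTheta (by norm_num) hb, ?_, ?_, ?_, ?_, ?_, hmaj one_pos⟩
  · intro n τ
    rw [show n + 2 * (1 : ℤ) = n + 2 by ring, hε, show (((n + 2 : ℤ) : ℝ)) ^ 2 / (4 * (2 : ℕ)) =
      ((n : ℝ) + ((1 : ℤ) : ℝ)) / 2 + (n : ℝ) ^ 2 / (4 * (2 : ℕ)) by push_cast; ring, qPow_add]
    ring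
  · intro n τ
    rw [hp, Int.cast_neg, neg_sq, mul_assoc]
  · intro n τ
    rw [← mul_assoc, hd, mul_assoc]
  · intro n
    rw [UpperHalfPlane.mdifferentiable_iff]
    have : DifferentiableOn ℂ (fun w : ℂ => h n *
        Complex.exp (2 * Real.pi * Complex.I * (((n : ℝ) ^ 2 / (4 * (2 : ℕ)) : ℝ) : ℂ) * w))
        {w | 0 < w.im} := by fun_prop
    refine this.congr fun w hw => ?_
    simp only [Function.comp_apply, qPow]
    rw [UpperHalfPlane.ofComplex_apply_of_im_pos hw]
  · intro τ
    refine ⟨{τ' | τ.im / 2 ≤ τ'.im}, ?_, hmaj (half_pos τ.im_pos)⟩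
    have : {τ' : ℍ | τ.im / 2 < τ'.im} ∈ nhds τ :=
      (isOpen_lt continuous_const UpperHalfPlane.continuous_im).mem_nhds
        (by simpa using half_lt_self τ.im_pos)
    refine Filter.mem_of_superset this fun τ' hτ' => ?_
    exact (le_of_lt hτ' : τ.im / 2 ≤ τ'.im)

/-- The value at `z = 0` of a function with a theta expansion is holomorphic in `τ`. -/
theorem HasThetaExpansion.mdifferentiable_zero {K : ℤ} {ε p d : ℂ} {F : ℍ → ℂ → ℂ}
    (hF : HasThetaExpansion K ε p d F) :
    MDifferentiable (modelWithCornersSelf ℂ ℂ) (modelWithCornersSelf ℂ ℂ) (fun τ => F τ 0) := by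
  obtain ⟨a, ha⟩ := hF
  have : (fun τ => F τ 0) = fun τ => ∑' n, a n τ := by
    ext τ
    rw [← (ha.hasSum τ 0).tsum_eq]
    simp [rPow_zero_left]
  rw [this]
  exact mdifferentiable_tsum ha.holo ha.locMaj

/-! ### The theta functions with characteristics -/

/-- A sum over an arithmetic progression as a sum over all integers. -/
theorem tsum_arith_eq (m a : ℤ) (hm : m ≠ 0) (f : ℤ → ℂ) :
    ∑' l : ℤ, f (m * l + a) = ∑' n : ℤ, residueInd m a n * f n := by
  have hinj : Function.Injective fun l : ℤ => m * l + a := fun l l' h =>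
    mul_left_cancel₀ hm (add_right_cancel h)
  rw [← hinj.tsum_eq (f := fun n => residueInd m a n * f n)]
  · congr 1; ext l
    simp [residueInd]
  · intro n hn
    rw [Function.mem_support] at hn
    unfold residueInd at hn
    by_cases h : m ∣ n - a
    · obtain ⟨l, hl⟩ := h
      exact ⟨l, by simp only; omega⟩
    · simp [h] at hn

/-- The coefficients of `ϑ₄`: `(-1)^(n/2)` at even `n`. -/
noncomputable def theta4Coeff (n : ℤ) : ℂ := residueInd 2 0 n * phase ((n : ℝ) / 2)

theorem theta2_eq (τ : ℍ) (z : ℂ) :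
    thetaCharacteristic 1 0 τ z = coeffTheta 2 (residueInd 2 1) τ z := by
  simp only [coeffTheta, mul_assoc]
  rw [← tsum_arith_eq 2 1 two_ne_zero, thetaCharacteristic]
  congr 1; ext l
  simp only [Nat.cast_zero, mul_zero, Complex.exp_zero, mul_one]
  congr 2 <;> push_cast <;> ring

theorem theta3_eq (τ : ℍ) (z : ℂ) :
    thetaCharacteristic 0 0 τ z = coeffTheta 2 (residueInd 2 0) τ z := by
  simp only [coeffTheta, mul_assoc]
  rw [← tsum_arith_eq 2 0 two_ne_zero, thetaCharacteristic]
  congr 1; ext l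
  simp only [Nat.cast_zero, mul_zero, Complex.exp_zero, mul_one]
  congr 2 <;> push_cast <;> ring

theorem theta4_eq (τ : ℍ) (z : ℂ) :
    thetaCharacteristic 0 1 τ z = coeffTheta 2 theta4Coeff τ z := by
  simp only [coeffTheta, theta4Coeff, mul_assoc]
  rw [← tsum_arith_eq 2 0 two_ne_zero (fun n => phase ((n : ℝ) / 2) *
    (qPow τ ((n : ℝ) ^ 2 / (4 * (2 : ℕ))) * rPow z ((n : ℝ) / 2))), thetaCharacteristic]
  congr 1; ext l
  rw [mul_comm]
  congr 1
  · rw [phase]; congr 1; push_cast; ring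
  · congr 2 <;> push_cast <;> ring

theorem phase_int (n : ℤ) : phase n = (-1 : ℂ) ^ n := by
  rw [phase, show Complex.I * Real.pi * ((n : ℝ) : ℂ) = n * (Real.pi * Complex.I) by
    push_cast; ring, Complex.exp_int_mul, Complex.exp_pi_mul_I]

theorem residueInd_two_zero (n : ℤ) : residueInd 2 0 n = if Even n then 1 else 0 := by
  simp [residueInd, even_iff_two_dvd]

theorem residueInd_two_one (n : ℤ) : residueInd 2 1 n = if Even n then 0 else 1 := by
  unfold residueInd
  rcases Int.even_or_odd' n with ⟨k, rfl | rfl⟩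
  · rw [if_neg (by omega), if_pos (by simp)]
  · rw [if_pos (by omega), if_neg (by simp)]

theorem theta4Coeff_two_mul (k : ℤ) : theta4Coeff (2 * k) = (-1) ^ k := by
  rw [theta4Coeff, residueInd_two_zero, if_pos (by simp), one_mul, ← phase_int]
  congr 1; push_cast; ring

theorem theta4Coeff_odd (k : ℤ) : theta4Coeff (2 * k + 1) = 0 := by
  rw [theta4Coeff, residueInd_two_zero, if_neg (by simp), zero_mul]

theorem norm_theta4Coeff_le (n : ℤ) : ‖theta4Coeff n‖ ≤ 1 := by
  rw [theta4Coeff, norm_mul, norm_phase, mul_one]; exact norm_residueInd_le _ _ _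

theorem hasThetaExpansion_theta2 : HasThetaExpansion 1 1 1 (-1) (thetaCharacteristic 1 0) := by
  rw [show thetaCharacteristic 1 0 = coeffTheta 2 (residueInd 2 1) from
    funext₂ theta2_eq]
  refine hasThetaExpansion_coeffTheta (norm_residueInd_le _ _) (fun n => ?_) (fun n => ?_)
    fun n => ?_
  · simp only [residueInd_two_one, Int.even_add, even_two, iff_true, one_mul]
  · simp only [residueInd_two_one, even_neg, one_mul]
  · rw [residueInd_two_one]
    split_ifs with h
    · simp
    · rw [(Int.not_even_iff_odd.1 h).neg_one_zpow]

theorem hasThetaExpansion_theta3 : HasThetaExpansion 1 1 1 1 (thetaCharacteristic 0 0) := by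
  rw [show thetaCharacteristic 0 0 = coeffTheta 2 (residueInd 2 0) from
    funext₂ theta3_eq]
  refine hasThetaExpansion_coeffTheta (norm_residueInd_le _ _) (fun n => ?_) (fun n => ?_)
    fun n => ?_
  · simp only [residueInd_two_zero, Int.even_add, even_two, iff_true, one_mul]
  · simp only [residueInd_two_zero, even_neg, one_mul]
  · rw [residueInd_two_zero]
    split_ifs with h
    · rw [h.neg_one_zpow]
    · simp

theorem hasThetaExpansion_theta4 : HasThetaExpansion 1 (-1) 1 1 (thetaCharacteristic 0 1) := by
  rw [show thetaCharacteristic 0 1 = coeffTheta 2 theta4Coeff from funext₂ theta4_eq]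
  refine hasThetaExpansion_coeffTheta norm_theta4Coeff_le (fun n => ?_) (fun n => ?_)
    fun n => ?_ <;> rcases Int.even_or_odd' n with ⟨k, rfl | rfl⟩
  · rw [show 2 * k + 2 = 2 * (k + 1) by ring, theta4Coeff_two_mul, theta4Coeff_two_mul,
      zpow_add₀ (by norm_num)]
    simp
  · rw [show 2 * k + 1 + 2 = 2 * (k + 1) + 1 by ring, theta4Coeff_odd, theta4Coeff_odd, mul_zero]
  · rw [← mul_neg, theta4Coeff_two_mul, theta4Coeff_two_mul, zpow_neg, ← inv_zpow]
    norm_num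
  · rw [show -(2 * k + 1) = 2 * (-k - 1) + 1 by ring, theta4Coeff_odd, theta4Coeff_odd, mul_zero]
  · rw [(even_two_mul k).neg_one_zpow]
  · rw [theta4Coeff_odd]; simp

theorem sl2Denominator_eq (τ : ℍ) (z : ℂ) : sl2Denominator τ z = coeffTheta 2 (oddInd 4 1) τ z := by
  rw [← charNum_zero, charNum_eq]
  norm_num

theorem oddInd_four_one_cases (n : ℤ) :
    oddInd 4 1 n = if n % 4 = 1 then 1 else if n % 4 = 3 then -1 else 0 := by
  unfold oddInd residueInd
  have h1 : (4 ∣ n - 1) ↔ n % 4 = 1 := by omega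
  have h2 : (4 ∣ n - -1) ↔ n % 4 = 3 := by omega
  rw [if_congr h1 rfl rfl, if_congr h2 rfl rfl]
  split_ifs <;> first | omega | simp

theorem hasThetaExpansion_sl2Denominator :
    HasThetaExpansion 1 (-1) (-1) (-1) sl2Denominator := by
  rw [show sl2Denominator = coeffTheta 2 (oddInd 4 1) from funext₂ sl2Denominator_eq]
  refine hasThetaExpansion_coeffTheta (fun n => ?_) (fun n => ?_) (fun n => ?_) fun n => ?_
  · rw [oddInd_four_one_cases]; split_ifs <;> simp
  · simp only [oddInd_four_one_cases]
    split_ifs <;> first | omega | simp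
  · simp only [oddInd_four_one_cases]
    split_ifs <;> first | omega | simp
  · rw [oddInd_four_one_cases]
    split_ifs with h1 h2
    · rw [(Int.odd_iff.2 (by omega) : Odd n).neg_one_zpow]
    · rw [(Int.odd_iff.2 (by omega) : Odd n).neg_one_zpow]
    · simp

/-! ### Modular transformations of the theta functions -/

theorem theta2_T (τ : ℍ) (z : ℂ) : thetaCharacteristic 1 0 (ModularGroup.T • τ) z =
    phase (1 / 4) * thetaCharacteristic 1 0 τ z := by
  rw [theta2_eq, theta2_eq, coeffTheta_T (by norm_num) 1]
  · norm_num
  · intro n hn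
    rw [residueInd_two_one] at hn
    obtain ⟨k, rfl⟩ : Odd n := by
      rw [← Int.not_even_iff_odd]; intro h; simp [h] at hn
    have : (8 : ℤ) ∣ 4 * (k * (k + 1)) := by
      obtain ⟨j, hj⟩ := Int.even_mul_succ_self k
      exact ⟨j, by rw [hj]; ring⟩
    convert this using 1
    push_cast; ring

theorem phase_sq (k : ℤ) : phase ((k : ℝ) ^ 2) = (-1) ^ k := by
  rw [← phase_int]
  obtain ⟨j, hj⟩ := Int.even_mul_pred_self k
  refine phase_congr j ?_
  have : (k : ℝ) * (k - 1) = j + j := by exact_mod_cast hj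
  linear_combination this

theorem theta3_T (τ : ℍ) (z : ℂ) :
    thetaCharacteristic 0 0 (ModularGroup.T • τ) z = thetaCharacteristic 0 1 τ z := by
  rw [theta3_eq, theta4_eq, coeffTheta, coeffTheta]
  congr 1; ext n
  rcases Int.even_or_odd' n with ⟨k, rfl | rfl⟩
  · rw [theta4Coeff_two_mul, qPow_T, residueInd_two_zero, if_pos (by simp), ← phase_sq, one_mul]
    congr 3; push_cast; ring
  · rw [theta4Coeff_odd, residueInd_two_zero, if_neg (by simp)]
    simp

theorem theta4_T (τ : ℍ) (z : ℂ) :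
    thetaCharacteristic 0 1 (ModularGroup.T • τ) z = thetaCharacteristic 0 0 τ z := by
  rw [theta3_eq, theta4_eq, coeffTheta, coeffTheta]
  congr 1; ext n
  rcases Int.even_or_odd' n with ⟨k, rfl | rfl⟩
  · rw [theta4Coeff_two_mul, qPow_T, residueInd_two_zero, if_pos (by simp), ← phase_sq, ← mul_assoc,
      ← phase_add, show ((k : ℝ) ^ 2 + 2 * (((2 * k : ℤ) : ℝ) ^ 2 / (4 * ((2 : ℕ) : ℝ)))) =
        2 * ((k ^ 2 : ℤ) : ℝ) by push_cast; ring, phase_two_mul_int]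
  · rw [theta4Coeff_odd, residueInd_two_zero, if_neg (by simp)]
    simp

theorem residueInd_two_eq_add (a n : ℤ) :
    residueInd 2 a n = residueInd 4 a n + residueInd 4 (a + 2) n := by
  unfold residueInd
  split_ifs <;> first | omega | simp

theorem theta4Coeff_eq_sub (n : ℤ) : theta4Coeff n = residueInd 4 0 n - residueInd 4 2 n := by
  rcases Int.even_or_odd' n with ⟨k, rfl | rfl⟩
  · rw [theta4Coeff_two_mul]
    unfold residueInd
    rcases Int.even_or_odd' k with ⟨j, rfl | rfl⟩
    · rw [if_pos (by omega), if_neg (by omega), (even_two_mul j).neg_one_zpow]; simp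
    · rw [if_neg (by omega), if_pos (by omega), (odd_two_mul_add_one j).neg_one_zpow]; simp
  · rw [theta4Coeff_odd]
    unfold residueInd
    rw [if_neg (by omega), if_neg (by omega), sub_zero]

theorem theta2_eq_classical (τ : ℍ) (z : ℂ) : thetaCharacteristic 1 0 τ z =
    classicalTheta 2 (-1) τ z + classicalTheta 2 1 τ z := by
  rw [theta2_eq, classicalTheta_eq (by norm_num), classicalTheta_eq (by norm_num),
    ← coeffTheta_add (by norm_num) (norm_residueInd_le _ _) (norm_residueInd_le _ _)]
  congr 1; ext n
  have h : residueInd 2 1 n = residueInd 2 (-1) n := by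
    unfold residueInd; congr 1; rw [eq_iff_iff]; omega
  rw [h, residueInd_two_eq_add]; rfl

theorem theta3_eq_classical (τ : ℍ) (z : ℂ) : thetaCharacteristic 0 0 τ z =
    classicalTheta 2 0 τ z + classicalTheta 2 2 τ z := by
  rw [theta3_eq, classicalTheta_eq (by norm_num), classicalTheta_eq (by norm_num),
    ← coeffTheta_add (by norm_num) (norm_residueInd_le _ _) (norm_residueInd_le _ _)]
  congr 1; ext n
  exact residueInd_two_eq_add 0 n

theorem theta4_eq_classical (τ : ℍ) (z : ℂ) : thetaCharacteristic 0 1 τ z =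
    classicalTheta 2 0 τ z - classicalTheta 2 2 τ z := by
  rw [theta4_eq, classicalTheta_eq (by norm_num), classicalTheta_eq (by norm_num),
    ← coeffTheta_sub (by norm_num) (norm_residueInd_le _ _) (norm_residueInd_le _ _)]
  congr 1; ext n
  exact theta4Coeff_eq_sub n

theorem theta2_S (τ : ℍ) (z : ℂ) : thetaCharacteristic 1 0 (ModularGroup.S • τ) (z / τ) =
    2 * thetaFactor 2 τ z * thetaCharacteristic 0 1 τ z := by
  rw [theta2_eq_classical, classicalTheta_S (by norm_num), classicalTheta_S (by norm_num),
    ← mul_add, ← coeffTheta_add (by norm_num) (fun n => (norm_phase _).le)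
      (fun n => (norm_phase _).le), mul_comm 2 (thetaFactor 2 τ z),
    mul_assoc (thetaFactor 2 τ z), theta4_eq, ← coeffTheta_smul 2 2]
  refine congrArg (fun h => thetaFactor 2 τ z * coeffTheta 2 h τ z) (funext fun n => ?_)
  rcases Int.even_or_odd' n with ⟨k, rfl | rfl⟩
  · rw [theta4Coeff_two_mul, ← phase_int]
    have h1 : phase (-((((-1 : ℤ) : ℝ) * ((2 * k : ℤ) : ℝ) / ((2 : ℕ) : ℝ) : ℝ))) = phase k :=
      phase_congr 0 (by push_cast; ring)
    have h2 : phase (-((((1 : ℤ) : ℝ) * ((2 * k : ℤ) : ℝ) / ((2 : ℕ) : ℝ) : ℝ))) = phase k :=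
      phase_congr (-k) (by push_cast; ring)
    rw [h1, h2, two_mul]
  · rw [theta4Coeff_odd, mul_zero, show phase (-((((1 : ℤ) : ℝ) * ((2 * k + 1 : ℤ) : ℝ) /
      ((2 : ℕ) : ℝ) : ℝ))) = phase (-((((-1 : ℤ) : ℝ) * ((2 * k + 1 : ℤ) : ℝ) /
      ((2 : ℕ) : ℝ) : ℝ)) + 1) * 1 by
        rw [mul_one]; refine phase_congr (-k - 1) ?_; push_cast; ring, phase_add,
      show (1 : ℝ) = ((1 : ℤ) : ℝ) by simp, phase_int]
    norm_num

theorem theta3_S (τ : ℍ) (z : ℂ) : thetaCharacteristic 0 0 (ModularGroup.S • τ) (z / τ) =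
    2 * thetaFactor 2 τ z * thetaCharacteristic 0 0 τ z := by
  rw [theta3_eq_classical, classicalTheta_S (by norm_num), classicalTheta_S (by norm_num),
    ← mul_add, ← coeffTheta_add (by norm_num) (fun n => (norm_phase _).le)
      (fun n => (norm_phase _).le), mul_comm 2 (thetaFactor 2 τ z),
    mul_assoc (thetaFactor 2 τ z), theta3_eq, ← coeffTheta_smul 2 2]
  refine congrArg (fun h => thetaFactor 2 τ z * coeffTheta 2 h τ z) (funext fun n => ?_)
  have h1 : phase (-((((0 : ℤ) : ℝ) * (n : ℝ) / ((2 : ℕ) : ℝ) : ℝ))) = 1 := by simp [phase]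
  have h2 : phase (-((((2 : ℤ) : ℝ) * (n : ℝ) / ((2 : ℕ) : ℝ) : ℝ))) = (-1) ^ n := by
    rw [← phase_int]; refine phase_congr (-n) ?_; push_cast; ring
  rw [h1, h2, residueInd_two_zero]
  split_ifs with h
  · rw [h.neg_one_zpow]; norm_num
  · rw [(Int.not_even_iff_odd.1 h).neg_one_zpow]; norm_num

theorem theta4_S (τ : ℍ) (z : ℂ) : thetaCharacteristic 0 1 (ModularGroup.S • τ) (z / τ) =
    2 * thetaFactor 2 τ z * thetaCharacteristic 1 0 τ z := by
  rw [theta4_eq_classical, classicalTheta_S (by norm_num), classicalTheta_S (by norm_num),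
    ← mul_sub, ← coeffTheta_sub (by norm_num) (fun n => (norm_phase _).le)
      (fun n => (norm_phase _).le), mul_comm 2 (thetaFactor 2 τ z),
    mul_assoc (thetaFactor 2 τ z), theta2_eq, ← coeffTheta_smul 2 2]
  refine congrArg (fun h => thetaFactor 2 τ z * coeffTheta 2 h τ z) (funext fun n => ?_)
  have h1 : phase (-((((0 : ℤ) : ℝ) * (n : ℝ) / ((2 : ℕ) : ℝ) : ℝ))) = 1 := by simp [phase]
  have h2 : phase (-((((2 : ℤ) : ℝ) * (n : ℝ) / ((2 : ℕ) : ℝ) : ℝ))) = (-1) ^ n := by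
    rw [← phase_int]; refine phase_congr (-n) ?_; push_cast; ring
  rw [h1, h2, residueInd_two_one]
  split_ifs with h
  · rw [h.neg_one_zpow]; norm_num
  · rw [(Int.not_even_iff_odd.1 h).neg_one_zpow]; norm_num

/-! ### Theta constants -/

theorem theta3_zero (τ : ℍ) : thetaCharacteristic 0 0 τ 0 = jacobiTheta τ := by
  rw [thetaCharacteristic, jacobiTheta]
  congr 1; ext l
  rw [rPow_zero_left, qPow, mul_one, ← Complex.exp_add]
  congr 1; push_cast; ring

theorem norm_jacobiTheta_ge {τ : ℍ} (hτ : 3 ≤ 4 * τ.im ^ 2) : 1 / 2 ≤ ‖jacobiTheta τ‖ := by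
  have hy : (4 / 5 : ℝ) ≤ τ.im := by nlinarith [τ.im_pos]
  have h1 := norm_jacobiTheta_sub_one_le τ.im_pos
  have h2 : Real.exp (-Real.pi * (τ : ℂ).im) ≤ 1 / 5 := by
    have : Real.exp (-Real.pi * (τ : ℂ).im) ≤ Real.exp (-2) := by
      rw [Real.exp_le_exp]
      have := Real.pi_gt_three
      have e : (τ : ℂ).im = τ.im := rfl
      rw [e]; nlinarith
    refine this.trans ?_
    rw [Real.exp_neg, ← one_div]
    apply one_div_le_one_div_of_le (by norm_num)
    have h1 := Real.exp_one_gt_d9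
    rw [show (2 : ℝ) = 1 + 1 by norm_num, Real.exp_add]
    nlinarith
  set e := Real.exp (-Real.pi * (τ : ℂ).im)
  have he : 0 < e := Real.exp_pos _
  have h3 : 2 / (1 - e) * e ≤ 1 / 2 := by
    rw [div_mul_eq_mul_div, div_le_iff₀ (by linarith)]; linarith
  have h4 : ‖(1 : ℂ)‖ ≤ ‖jacobiTheta τ‖ + ‖jacobiTheta τ - 1‖ := by
    have := norm_sub_le (jacobiTheta τ) (jacobiTheta τ - 1)
    simpa using this
  rw [norm_one] at h4
  have h5 : ‖jacobiTheta τ - 1‖ ≤ 1 / 2 := h1.trans h3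
  linarith

theorem norm_theta3_ge {τ : ℍ} (hτ : 3 ≤ 4 * τ.im ^ 2) :
    1 / 2 ≤ ‖thetaCharacteristic 0 0 τ 0‖ := by
  rw [theta3_zero]; exact norm_jacobiTheta_ge hτ

theorem im_T_smul (τ : ℍ) : (ModularGroup.T • τ).im = τ.im := by
  have := congrArg Complex.im (coe_T_smul τ)
  simpa using this

theorem norm_theta4_ge {τ : ℍ} (hτ : 3 ≤ 4 * τ.im ^ 2) :
    1 / 2 ≤ ‖thetaCharacteristic 0 1 τ 0‖ := by
  rw [← theta3_T]
  exact norm_theta3_ge (by rwa [im_T_smul])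

/-- `ϑ₂(τ,0) = 2 q^(1/8) (1 + q + q³ + ⋯)`. -/
theorem norm_theta2_ge {τ : ℍ} (hτ : 3 ≤ 4 * τ.im ^ 2) :
    Real.exp (-(Real.pi / 4 * τ.im)) ≤ ‖thetaCharacteristic 1 0 τ 0‖ := by
  have hy : (4 / 5 : ℝ) ≤ τ.im := by nlinarith [τ.im_pos]
  set x : ℝ := Real.exp (-(2 * Real.pi * τ.im)) with hx
  have hx0 : 0 < x := Real.exp_pos _
  have hx5 : x ≤ 1 / 5 := by
    have : x ≤ Real.exp (-2) := by
      rw [hx, Real.exp_le_exp]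
      nlinarith [Real.pi_gt_three]
    refine this.trans ?_
    rw [Real.exp_neg, ← one_div]
    apply one_div_le_one_div_of_le (by norm_num)
    have h1 := Real.exp_one_gt_d9
    rw [show (2 : ℝ) = 1 + 1 by norm_num, Real.exp_add]
    nlinarith
  -- the terms `q^(l(l+1)/2)`, `l ≥ 0`, bounded by a geometric series
  set t : ℕ → ℂ := fun l => qPow τ ((l : ℝ) * (l + 1) / 2) with ht
  have hgeo := hasSum_geometric_of_lt_one hx0.le (by linarith : x < 1)
  have htx : ∀ l, ‖t l‖ ≤ x ^ l := by
    intro l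
    rw [ht, norm_qPow, hx, ← Real.exp_nat_mul, Real.exp_le_exp]
    have h1 : (l : ℝ) ≤ (l : ℝ) * (l + 1) / 2 := by
      rcases Nat.eq_zero_or_pos l with h | h
      · simp [h]
      · have : (1 : ℝ) ≤ l := by exact_mod_cast h
        nlinarith
    have h2 : 0 ≤ 2 * Real.pi * τ.im := by have := τ.im_pos; positivity
    nlinarith
  have hts : Summable t := Summable.of_norm_bounded hgeo.summable htx
  have h0 : ‖(∑' l, t l) - 1‖ ≤ 1 / 4 := by
    have h1 := hts.hasSum
    rw [← hasSum_nat_add_iff' 1] at h1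
    have h2 := hgeo
    rw [← hasSum_nat_add_iff' 1] at h2
    have h3 := h1.norm_le_of_bounded h2 fun l => htx (l + 1)
    simp only [Finset.sum_range_one, pow_zero] at h3
    have h4 : t 0 = 1 := by simp [ht, qPow_zero]
    rw [h4] at h3
    refine h3.trans ?_
    have h5 : (1 - x)⁻¹ ≤ 5 / 4 := by
      rw [← one_div, div_le_iff₀ (by linarith)]; linarith
    linarith
  have hsum : thetaCharacteristic 1 0 τ 0 = qPow τ (1 / 8) * (2 * ∑' l, t l) := by
    rw [thetaCharacteristic, two_mul]
    have e : ∀ l : ℤ, qPow τ (((l : ℝ) + ((1 : ℕ) : ℝ) / 2) ^ 2 / 2) *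
        rPow 0 ((l : ℝ) + ((1 : ℕ) : ℝ) / 2) * Complex.exp (Complex.I * Real.pi * l * (0 : ℕ)) =
        qPow τ (1 / 8) * qPow τ ((l : ℝ) * (l + 1) / 2) := by
      intro l
      rw [rPow_zero_left, ← qPow_add]
      simp only [Nat.cast_zero, mul_zero, Complex.exp_zero, mul_one]
      congr 1; push_cast; ring
    simp only [e]
    rw [tsum_mul_left]
    congr 1
    refine HasSum.tsum_eq (HasSum.of_nat_of_neg_add_one ?_ ?_)
    · exact hts.hasSum
    · have e2 : ∀ l : ℕ,
          qPow τ (((-((l : ℤ) + 1) : ℤ) : ℝ) * (((-((l : ℤ) + 1) : ℤ) : ℝ) + 1) / 2) = t l := by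
        intro l
        simp only [ht]
        congr 1; push_cast; ring
      simp only [e2]
      exact hts.hasSum
  rw [hsum, norm_mul, norm_mul, norm_qPow]
  have h6 : 3 / 4 ≤ ‖∑' l, t l‖ := by
    have h7 : ‖(1 : ℂ)‖ ≤ ‖∑' l, t l‖ + ‖(∑' l, t l) - 1‖ := by
      have := norm_sub_le (∑' l, t l) ((∑' l, t l) - 1)
      simpa using this
    rw [norm_one] at h7; linarith
  have h8 : Real.exp (-(Real.pi / 4 * τ.im)) = Real.exp (-(2 * Real.pi * (1 / 8) * τ.im)) := by
    congr 1; ring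
  rw [h8]
  refine le_mul_of_one_le_right (Real.exp_nonneg _) ?_
  rw [Complex.norm_ofNat]; linarith

/-- The zero set of `ϑ₂ϑ₃ϑ₄` is `SL(2,ℤ)`-invariant and does not meet the fundamental domain. -/
theorem thetaConstants_mul_ne_zero (τ : ℍ) : thetaCharacteristic 1 0 τ 0 *
    thetaCharacteristic 0 0 τ 0 * thetaCharacteristic 0 1 τ 0 ≠ 0 := by
  set P : ℍ → ℂ := fun τ => thetaCharacteristic 1 0 τ 0 *
    thetaCharacteristic 0 0 τ 0 * thetaCharacteristic 0 1 τ 0 with hP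
  have hinv : ∀ γ : SL(2, ℤ), ∀ τ, P (γ • τ) = 0 ↔ P τ = 0 := by
    intro γ
    have hγ : γ ∈ Subgroup.closure {ModularGroup.S, ModularGroup.T} := by
      rw [SpecialLinearGroup.SL2Z_generators]; trivial
    induction hγ using Subgroup.closure_induction with
    | mem x hx =>
      intro τ
      rcases hx with rfl | rfl
      · have h2 := theta2_S τ 0
        have h3 := theta3_S τ 0
        have h4 := theta4_S τ 0
        rw [zero_div] at h2 h3 h4
        simp only [hP, h2, h3, h4]
        have := thetaFactor_ne_zero (K := 2) (by norm_num) τ 0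
        simp only [mul_eq_zero, this, OfNat.ofNat_ne_zero, or_false, false_or]
        tauto
      · simp only [hP, theta2_T, theta3_T, theta4_T, mul_eq_zero, phase_ne_zero, false_or]
        tauto
    | one => intro τ; rw [one_smul]
    | mul x y _ _ hx hy => intro τ; rw [mul_smul, hx, hy]
    | inv x _ hx => intro τ; rw [← hx, smul_inv_smul]
  obtain ⟨γ, hγ⟩ := ModularGroup.exists_smul_mem_fd τ
  have him := ModularGroup.three_le_four_mul_im_sq_of_mem_fd hγ
  have h2 := norm_theta2_ge him
  have h3 := norm_theta3_ge him
  have h4 := norm_theta4_ge him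
  intro h0
  rw [show thetaCharacteristic 1 0 τ 0 * thetaCharacteristic 0 0 τ 0 * thetaCharacteristic 0 1 τ 0 =
    P τ from rfl, ← hinv γ] at h0
  simp only [hP, mul_eq_zero] at h0
  rcases h0 with (h0 | h0) | h0
  · rw [h0, norm_zero] at h2
    exact absurd h2 (not_le.2 (Real.exp_pos _))
  · rw [h0, norm_zero] at h3; norm_num at h3
  · rw [h0, norm_zero] at h4; norm_num at h4

theorem theta2_zero_ne_zero (τ : ℍ) : thetaCharacteristic 1 0 τ 0 ≠ 0 :=
  left_ne_zero_of_mul (left_ne_zero_of_mul (thetaConstants_mul_ne_zero τ))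

theorem theta3_zero_ne_zero (τ : ℍ) : thetaCharacteristic 0 0 τ 0 ≠ 0 :=
  right_ne_zero_of_mul (left_ne_zero_of_mul (thetaConstants_mul_ne_zero τ))

theorem theta4_zero_ne_zero (τ : ℍ) : thetaCharacteristic 0 1 τ 0 ≠ 0 :=
  right_ne_zero_of_mul (thetaConstants_mul_ne_zero τ)

/-! ### The umbral Jacobi forms -/

theorem HasThetaExpansion.div_sq {ε p d : ℂ} (hε : ε * ε = 1) (hp : p * p = 1) (hd : d * d = 1)
    {F : ℍ → ℂ → ℂ} (hF : HasThetaExpansion 1 ε p d F) (h0 : ∀ τ, F τ 0 ≠ 0) {c M : ℝ} (hc : 0 < c)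
    (hg : ∀ τ : ℍ, 1 ≤ τ.im → c * Real.exp (-(M * τ.im)) ≤ ‖F τ 0‖) :
    HasThetaExpansion 2 1 1 1 (fun τ z => (F τ z / F τ 0) ^ 2) := by
  have hm : MDifferentiable (modelWithCornersSelf ℂ ℂ) (modelWithCornersSelf ℂ ℂ)
      (fun τ => ((F τ 0) ^ 2)⁻¹) := by
    have := UpperHalfPlane.mdifferentiable_iff.1 hF.mdifferentiable_zero
    rw [UpperHalfPlane.mdifferentiable_iff]
    exact (this.pow 2).inv fun w _ => pow_ne_zero 2 (h0 _)
  have h1 := hasThetaExpansion_const hm (C := (c ^ 2)⁻¹) (M := 2 * M) fun τ hτ => by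
    rw [norm_inv, norm_pow]
    have h2 : 0 < c * Real.exp (-(M * τ.im)) := by positivity
    have h3 : (c ^ 2)⁻¹ * Real.exp (2 * M * τ.im) = ((c * Real.exp (-(M * τ.im))) ^ 2)⁻¹ := by
      rw [mul_pow, mul_inv, ← Real.exp_nat_mul, ← Real.exp_neg]
      congr 2; push_cast; ring
    rw [h3]
    exact inv_anti₀ (by positivity) (pow_le_pow_left₀ h2.le (hg τ hτ) 2)
  have h2 := h1.mul (hF.mul hF)
  rw [hε, hp, hd, mul_one] at h2
  have e : (fun τ z => (F τ z / F τ 0) ^ 2) = fun τ z => (F τ 0 ^ 2)⁻¹ * (F τ z * F τ z) := by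
    ext τ z; rw [div_pow, div_eq_inv_mul, sq (F τ z)]
  rw [e]
  exact h2

theorem three_le_of_one_le_im {τ : ℍ} (hτ : 1 ≤ τ.im) : 3 ≤ 4 * τ.im ^ 2 := by nlinarith

theorem hasThetaExpansion_umbralF2_sq : HasThetaExpansion 2 1 1 1 (fun τ z => umbralF2 τ z ^ 2) :=
  hasThetaExpansion_theta2.div_sq (by norm_num) (by norm_num) (by norm_num) theta2_zero_ne_zero
    one_pos (M := Real.pi / 4) fun τ hτ => by
      rw [one_mul]; exact norm_theta2_ge (three_le_of_one_le_im hτ)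

theorem hasThetaExpansion_umbralF3_sq : HasThetaExpansion 2 1 1 1 (fun τ z => umbralF3 τ z ^ 2) :=
  hasThetaExpansion_theta3.div_sq (by norm_num) (by norm_num) (by norm_num) theta3_zero_ne_zero
    (c := 1 / 2) (by norm_num) (M := 0) fun τ hτ => by
      simpa using norm_theta3_ge (three_le_of_one_le_im hτ)

theorem hasThetaExpansion_umbralF4_sq : HasThetaExpansion 2 1 1 1 (fun τ z => umbralF4 τ z ^ 2) :=
  hasThetaExpansion_theta4.div_sq (by norm_num) (by norm_num) (by norm_num) theta4_zero_ne_zero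
    (c := 1 / 2) (by norm_num) (M := 0) fun τ hτ => by
      simpa using norm_theta4_ge (three_le_of_one_le_im hτ)

/-- The even theta functions of integral index with trivial signs, such as the `f_i²` (index `1`)
and `ψ_{0,N}` (index `N`). -/
def IsEvenTheta (N : ℕ) (F : ℍ → ℂ → ℂ) : Prop := HasThetaExpansion (2 * N) 1 1 1 F

theorem IsEvenTheta.mul {N N' : ℕ} {F G : ℍ → ℂ → ℂ} (hF : IsEvenTheta N F)
    (hG : IsEvenTheta N' G) : IsEvenTheta (N + N') (fun τ z => F τ z * G τ z) := by
  have := HasThetaExpansion.mul hF hG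
  simp only [mul_one] at this
  unfold IsEvenTheta
  push_cast
  rwa [mul_add]

theorem IsEvenTheta.add {N : ℕ} {F G : ℍ → ℂ → ℂ} (hF : IsEvenTheta N F)
    (hG : IsEvenTheta N G) : IsEvenTheta N (fun τ z => F τ z + G τ z) :=
  HasThetaExpansion.add hF hG

theorem IsEvenTheta.const_mul {N : ℕ} {F : ℍ → ℂ → ℂ} (hF : IsEvenTheta N F) (c : ℂ) :
    IsEvenTheta N (fun τ z => c * F τ z) := by
  have h1 : IsEvenTheta 0 (fun _ _ => c) := by
    have := hasThetaExpansion_const (h := fun _ => c) mdifferentiable_const (C := ‖c‖) (M := 0)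
      fun τ _ => by simp
    simpa [IsEvenTheta] using this
  simpa using h1.mul hF

theorem IsEvenTheta.sub {N : ℕ} {F G : ℍ → ℂ → ℂ} (hF : IsEvenTheta N F)
    (hG : IsEvenTheta N G) : IsEvenTheta N (fun τ z => F τ z - G τ z) := by
  simpa [sub_eq_add_neg] using hF.add (hG.const_mul (-1))

theorem isEvenTheta_umbralPsi1 : IsEvenTheta 1 umbralPsi1 :=
  ((IsEvenTheta.add (N := 1) hasThetaExpansion_umbralF2_sq hasThetaExpansion_umbralF3_sq).add
    hasThetaExpansion_umbralF4_sq).const_mul 4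

theorem isEvenTheta_umbralPsi2 : IsEvenTheta 2 umbralPsi2 :=
  (((IsEvenTheta.mul (N := 1) (N' := 1) hasThetaExpansion_umbralF2_sq
    hasThetaExpansion_umbralF3_sq).add
    (IsEvenTheta.mul (N := 1) (N' := 1) hasThetaExpansion_umbralF3_sq
      hasThetaExpansion_umbralF4_sq)).add
    (IsEvenTheta.mul (N := 1) (N' := 1) hasThetaExpansion_umbralF4_sq
      hasThetaExpansion_umbralF2_sq)).const_mul 2

theorem isEvenTheta_umbralPsi3 : IsEvenTheta 3 umbralPsi3 :=
  ((IsEvenTheta.mul (N := 1) (N' := 1) hasThetaExpansion_umbralF2_sq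
    hasThetaExpansion_umbralF3_sq).mul (N' := 1) hasThetaExpansion_umbralF4_sq).const_mul 4

theorem isEvenTheta_umbralPsi4 : IsEvenTheta 4 umbralPsi4 := by
  have h := ((isEvenTheta_umbralPsi1.mul isEvenTheta_umbralPsi3).sub
    (isEvenTheta_umbralPsi2.mul isEvenTheta_umbralPsi2)).const_mul (1 / 4)
  simp only [← sq] at h
  exact h

theorem isEvenTheta_umbralPsi6 : IsEvenTheta 6 umbralPsi6 := by
  have h := (isEvenTheta_umbralPsi2.mul isEvenTheta_umbralPsi4).sub
    (isEvenTheta_umbralPsi3.mul isEvenTheta_umbralPsi3)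
  simp only [← sq] at h
  exact h

theorem isEvenTheta_umbralPsi {N : ℕ} (hN : N ∈ ({1, 2, 3, 4, 6} : Finset ℕ)) :
    IsEvenTheta N (umbralPsi N) := by
  simp only [Finset.mem_insert, Finset.mem_singleton] at hN
  rcases hN with rfl | rfl | rfl | rfl | rfl
  exacts [isEvenTheta_umbralPsi1, isEvenTheta_umbralPsi2, isEvenTheta_umbralPsi3,
    isEvenTheta_umbralPsi4, isEvenTheta_umbralPsi6]

theorem umbralF2_T (τ : ℍ) (z : ℂ) : umbralF2 (ModularGroup.T • τ) z = umbralF2 τ z := by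
  rw [umbralF2, theta2_T, theta2_T, mul_div_mul_left _ _ (phase_ne_zero _), umbralF2]

theorem umbralF3_T (τ : ℍ) (z : ℂ) : umbralF3 (ModularGroup.T • τ) z = umbralF4 τ z := by
  rw [umbralF3, theta3_T, theta3_T, umbralF4]

theorem umbralF4_T (τ : ℍ) (z : ℂ) : umbralF4 (ModularGroup.T • τ) z = umbralF3 τ z := by
  rw [umbralF4, theta4_T, theta4_T, umbralF3]

theorem thetaFactor_div (τ : ℍ) (z x y : ℂ) :
    2 * thetaFactor 2 τ z * x / (2 * thetaFactor 2 τ 0 * y) =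
      Complex.exp (Real.pi * Complex.I * z ^ 2 / τ) * (x / y) := by
  have h0 := thetaFactor_ne_zero (K := 2) (by norm_num) τ 0
  have h : thetaFactor 2 τ z =
      Complex.exp (Real.pi * Complex.I * z ^ 2 / τ) * thetaFactor 2 τ 0 := by
    rw [thetaFactor, thetaFactor, mul_left_comm, ← Complex.exp_add]
    congr 2
    have hτ : (τ : ℂ) ≠ 0 := UpperHalfPlane.ne_zero τ
    push_cast
    field_simp
    ring
  rw [h, show 2 * (Complex.exp (Real.pi * Complex.I * z ^ 2 / τ) * thetaFactor 2 τ 0) * x =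
    (2 * thetaFactor 2 τ 0) * (Complex.exp (Real.pi * Complex.I * z ^ 2 / τ) * x) by ring,
    mul_div_mul_left _ _ (mul_ne_zero two_ne_zero h0), mul_div_assoc]

theorem umbralF2_S (τ : ℍ) (z : ℂ) : umbralF2 (ModularGroup.S • τ) (z / τ) =
    Complex.exp (Real.pi * Complex.I * z ^ 2 / τ) * umbralF4 τ z := by
  have h0 := theta2_S τ 0
  rw [zero_div] at h0
  rw [umbralF2, theta2_S, h0, thetaFactor_div, umbralF4]

theorem umbralF3_S (τ : ℍ) (z : ℂ) : umbralF3 (ModularGroup.S • τ) (z / τ) =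
    Complex.exp (Real.pi * Complex.I * z ^ 2 / τ) * umbralF3 τ z := by
  have h0 := theta3_S τ 0
  rw [zero_div] at h0
  rw [umbralF3, theta3_S, h0, thetaFactor_div, umbralF3]

theorem umbralF4_S (τ : ℍ) (z : ℂ) : umbralF4 (ModularGroup.S • τ) (z / τ) =
    Complex.exp (Real.pi * Complex.I * z ^ 2 / τ) * umbralF2 τ z := by
  have h0 := theta4_S τ 0
  rw [zero_div] at h0
  rw [umbralF4, theta4_S, h0, thetaFactor_div, umbralF2]

/-- `T` exchanges `f₃` and `f₄`, and `ψ_{0,N}` is symmetric in the `f_i²`. -/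
theorem umbralPsi_T {N : ℕ} (hN : N ∈ ({1, 2, 3, 4, 6} : Finset ℕ)) (τ : ℍ) (z : ℂ) :
    umbralPsi N (ModularGroup.T • τ) z = umbralPsi N τ z := by
  simp only [Finset.mem_insert, Finset.mem_singleton] at hN
  rcases hN with rfl | rfl | rfl | rfl | rfl <;>
  simp only [umbralPsi, umbralPsi1, umbralPsi2, umbralPsi3, umbralPsi4, umbralPsi6, umbralF2_T,
    umbralF3_T, umbralF4_T] <;> ring

/-- `S` exchanges `f₂` and `f₄` up to the automorphy factor, and `ψ_{0,N}` is symmetric and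
homogeneous of degree `N` in the `f_i²`. -/
theorem umbralPsi_S {N : ℕ} (hN : N ∈ ({1, 2, 3, 4, 6} : Finset ℕ)) (τ : ℍ) (z : ℂ) :
    umbralPsi N (ModularGroup.S • τ) (z / τ) =
      Complex.exp (2 * Real.pi * Complex.I * N * z ^ 2 / τ) * umbralPsi N τ z := by
  have e : Complex.exp (2 * Real.pi * Complex.I * N * z ^ 2 / τ) =
      Complex.exp (Real.pi * Complex.I * z ^ 2 / τ) ^ (2 * N) := by
    rw [← Complex.exp_nat_mul]; congr 1; push_cast; ring
  rw [e]
  simp only [Finset.mem_insert, Finset.mem_singleton] at hN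
  rcases hN with rfl | rfl | rfl | rfl | rfl <;>
  simp only [umbralPsi, umbralPsi1, umbralPsi2, umbralPsi3, umbralPsi4, umbralPsi6, umbralF2_S,
    umbralF3_S, umbralF4_S] <;> ring

/-! ### Existence of the decomposition -/

/-- The coefficient at `r^(n/2)` of `F D`, divided by `q^(n²/8(2N+1))`, is an odd function of
`n mod 8N + 4` supported on odd `n` and symmetric under `n ↦ 4N + 2 - n`. The coefficients of the
characters are its values at `1, 3, …, 4N + 1`. -/
theorem IsEvenTheta.exists_decomposition {N : ℕ} {F : ℍ → ℂ → ℂ} (hF : IsEvenTheta N F) :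
    ∃ c : ℕ → ℍ → ℂ,
      (∀ τ z, sl2Denominator τ z ≠ 0 →
        F τ z = ∑ i ∈ Finset.range (2 * N + 1), c i τ * sl2Character (4 * N) (2 * i) τ z) ∧
      (∀ i ≤ 2 * N, c (2 * N - i) = c i) ∧
      (∀ i, MDifferentiable (modelWithCornersSelf ℂ ℂ) (modelWithCornersSelf ℂ ℂ) (c i)) ∧
      ∀ i, ∃ C M : ℝ, ∀ τ : ℍ, 1 ≤ τ.im → ‖c i τ‖ ≤ C * Real.exp (M * τ.im) := by
  obtain ⟨a, ha⟩ := HasThetaExpansion.mul hF hasThetaExpansion_sl2Denominator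
  simp only [one_mul] at ha
  set h : ℤ → ℍ → ℂ := fun n τ => a n τ * qPow τ (-((n : ℝ) ^ 2 / (4 * (4 * N + 2 : ℕ)))) with hh
  have hN : (4 * N + 2 : ℝ) ≠ 0 := by positivity
  have hah : ∀ n τ, h n τ * qPow τ ((n : ℝ) ^ 2 / (4 * (4 * N + 2 : ℕ))) = a n τ := by
    intro n τ
    simp only [hh]
    rw [mul_assoc, ← qPow_add, neg_add_cancel, qPow_zero, mul_one]
  have hodd : ∀ τ n, h (-n) τ = -h n τ := by
    intro τ n
    simp only [hh]
    rw [ha.neg, Int.cast_neg, neg_sq]; ring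
  have hanti : ∀ τ n, h (n + (4 * N + 2)) τ = -h n τ := by
    intro τ n
    simp only [hh]
    rw [show n + (4 * N + 2 : ℤ) = n + 2 * (2 * N + 1) by ring, ha.quasi,
      mul_right_comm, mul_assoc (-1 : ℂ), ← qPow_add, mul_assoc, mul_comm (qPow _ _), neg_one_mul]
    congr 3
    push_cast
    field_simp
    ring
  have hper : ∀ τ n, h (n + (8 * N + 4)) τ = h n τ := by
    intro τ n
    rw [show n + (8 * N + 4 : ℤ) = n + (4 * N + 2) + (4 * N + 2) by ring, hanti, hanti, neg_neg]
  have heven : ∀ τ n, h (2 * n) τ = 0 := by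
    intro τ n
    have := ha.parity (2 * n) τ
    rw [(even_two_mul n).neg_one_zpow] at this
    have h0 : a (2 * n) τ = 0 := by linear_combination this / 2
    simp only [hh, h0, zero_mul]
  refine ⟨fun i => h (2 * i + 1), ?_, ?_, ?_, ?_⟩
  · intro τ z hz
    have h1 : F τ z * sl2Denominator τ z = coeffTheta (4 * N + 2) (fun n => h n τ) τ z := by
      rw [← (ha.hasSum τ z).tsum_eq, coeffTheta]
      simp only [hah]
    rw [coeffTheta_eq_sum_charNum N (hodd τ) (hper τ) (heven τ)] at h1
    simp only [sl2Character_eq, ← mul_div_assoc, ← Finset.sum_div]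
    rw [← h1, mul_div_cancel_right₀ _ hz]
  · intro i hi
    ext τ
    dsimp only
    rw [← neg_neg (h (2 * i + 1) τ), ← hodd, ← hanti]
    congr 1
    push_cast [hi]
    ring
  · intro i
    refine (ha.holo _).mul ?_
    rw [UpperHalfPlane.mdifferentiable_iff]
    generalize (-((((2 * i + 1 : ℤ)) : ℝ) ^ 2 / (4 * (4 * N + 2 : ℕ)))) = x
    have : DifferentiableOn ℂ (fun w : ℂ => Complex.exp (2 * Real.pi * Complex.I * x * w))
        {w | 0 < w.im} := by fun_prop
    refine this.congr fun w hw => ?_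
    simp only [Function.comp_apply, qPow]
    rw [UpperHalfPlane.ofComplex_apply_of_im_pos hw]
  · intro i
    obtain ⟨u, _, _, M, hM⟩ := ha.growth
    refine ⟨u (2 * i + 1),
      M - 2 * Real.pi * (-((((2 * i + 1 : ℤ)) : ℝ) ^ 2 / (4 * (4 * N + 2 : ℕ)))), fun τ hτ => ?_⟩
    rw [norm_mul, norm_qPow, sub_mul, sub_eq_add_neg, Real.exp_add, ← mul_assoc]
    exact mul_le_mul_of_nonneg_right (hM _ τ hτ) (Real.exp_nonneg _)

/-! ### The representation of the modular group on the symmetrized characters -/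

/-- The factor `cτ + d`. -/
noncomputable def cocycleJ (γ : SL(2, ℤ)) (τ : ℍ) : ℂ :=
  ((γ 1 0 : ℤ) : ℂ) * (τ : ℂ) + ((γ 1 1 : ℤ) : ℂ)

theorem cocycleJ_ne_zero (γ : SL(2, ℤ)) (τ : ℍ) : cocycleJ γ τ ≠ 0 := by
  have := UpperHalfPlane.denom_ne_zero (γ : GL (Fin 2) ℝ) τ
  rwa [ModularGroup.denom_apply] at this

theorem coe_smul_eq (γ : SL(2, ℤ)) (τ : ℍ) : ((γ • τ : ℍ) : ℂ) =
    (((γ 0 0 : ℤ) : ℂ) * τ + ((γ 0 1 : ℤ) : ℂ)) / cocycleJ γ τ := by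
  rw [UpperHalfPlane.coe_specialLinearGroup_apply]
  simp [cocycleJ]

theorem cocycleJ_mul (γ γ' : SL(2, ℤ)) (τ : ℍ) :
    cocycleJ (γ * γ') τ = cocycleJ γ (γ' • τ) * cocycleJ γ' τ := by
  have h := cocycleJ_ne_zero γ' τ
  rw [cocycleJ, cocycleJ, coe_smul_eq, Matrix.SpecialLinearGroup.coe_mul, Matrix.mul_apply,
    Matrix.mul_apply, Fin.sum_univ_two, Fin.sum_univ_two]
  field_simp
  rw [cocycleJ]
  push_cast
  ring

theorem cocycleJ_one (τ : ℍ) : cocycleJ 1 τ = 1 := by simp [cocycleJ]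

theorem cocycleJ_S (τ : ℍ) : cocycleJ ModularGroup.S τ = τ := by
  simp [cocycleJ, ModularGroup.S]

theorem cocycleJ_T (τ : ℍ) : cocycleJ ModularGroup.T τ = 1 := by
  simp [cocycleJ, ModularGroup.T]

/-- The symmetrized characters multiplied by `e^(πN z²/Im τ)`. This factor absorbs the index-`N`
automorphy factor `e^(2πi N c z²/(cτ+d))` of Jacobi forms. -/
noncomputable def normCharVec (N : ℕ) (τ : ℍ) (z : ℂ) : Fin (N + 1) → ℂ :=
  Complex.exp (Real.pi * N * z ^ 2 / τ.im) • symmCharVec N τ z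

theorem normCharVec_T (N : ℕ) (τ : ℍ) (z : ℂ) :
    normCharVec N (ModularGroup.T • τ) z ᵥ* weilT N = normCharVec N τ z := by
  rw [normCharVec, Matrix.smul_vecMul, symmCharVec_T, im_T_smul, normCharVec]

theorem im_S_smul (τ : ℍ) : (ModularGroup.S • τ).im = τ.im / Complex.normSq τ := by
  have h := congrArg Complex.im (coe_S_smul τ)
  rw [neg_div, one_div, Complex.neg_im, Complex.inv_im, neg_div, neg_neg] at h
  exact h

theorem normCharVec_S (N : ℕ) (τ : ℍ) (z : ℂ) :
    normCharVec N (ModularGroup.S • τ) (z / τ) = normCharVec N τ z ᵥ* weilS N := by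
  have hτ : (τ : ℂ) ≠ 0 := UpperHalfPlane.ne_zero τ
  have hy : ((τ.im : ℝ) : ℂ) ≠ 0 := by exact_mod_cast τ.im_ne_zero
  rw [normCharVec, symmCharVec_S, smul_smul, normCharVec, Matrix.smul_vecMul, ← Complex.exp_add]
  congr 2
  have hconj : (starRingEnd ℂ) (τ : ℂ) = τ - 2 * τ.im * Complex.I := by
    apply Complex.ext <;> simp; ring
  have hc0 : (τ : ℂ) - 2 * τ.im * Complex.I ≠ 0 := by
    rw [← hconj]; simpa using hτ
  rw [im_S_smul, Complex.ofReal_div, Complex.normSq_eq_conj_mul_self, hconj]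
  field_simp
  ring

theorem normCharVec_neg (N : ℕ) (τ : ℍ) (z : ℂ) : normCharVec N τ (-z) = normCharVec N τ z := by
  rw [normCharVec, symmCharVec_neg, neg_sq, normCharVec]

/-- For fixed `τ`, a matrix is determined by its action on the vectors of characters. -/
theorem matrix_eq_of_normCharVec (N : ℕ) (τ : ℍ) {A B : Matrix (Fin (N + 1)) (Fin (N + 1)) ℂ}
    (h : ∀ z, normCharVec N τ z ᵥ* A = normCharVec N τ z ᵥ* B) : A = B := by
  have key : ∀ j, (fun i => A i j - B i j) = 0 := by
    intro j
    refine eq_zero_of_dotProduct_symmCharVec_eq_zero N (τ := τ) fun z _ => ?_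
    have h1 := congrFun (h z) j
    rw [normCharVec, Matrix.smul_vecMul, Matrix.smul_vecMul, Pi.smul_apply, Pi.smul_apply,
      smul_eq_mul, smul_eq_mul] at h1
    have h2 := mul_left_cancel₀ (Complex.exp_ne_zero _) h1
    simp only [Matrix.vecMul, dotProduct] at h2 ⊢
    simp only [mul_sub, Finset.sum_sub_distrib, h2, sub_self]
  ext i j
  exact sub_eq_zero.1 (congrFun (key j) i)

theorem S_smul_S_smul (τ : ℍ) : ModularGroup.S • ModularGroup.S • τ = τ := by
  ext
  have hτ : (τ : ℂ) ≠ 0 := UpperHalfPlane.ne_zero τ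
  rw [coe_S_smul, coe_S_smul]
  field_simp

theorem normCharVec_S' (N : ℕ) (τ : ℍ) (z : ℂ) :
    normCharVec N (ModularGroup.S • τ) (z / τ) ᵥ* weilS N = normCharVec N τ z := by
  have hτ : (τ : ℂ) ≠ 0 := UpperHalfPlane.ne_zero τ
  rw [← normCharVec_S, S_smul_S_smul, coe_S_smul, ← normCharVec_neg]
  congr 1
  field_simp

theorem weilS_mul_weilS (N : ℕ) : weilS N * weilS N = 1 := by
  refine matrix_eq_of_normCharVec N UpperHalfPlane.I fun z => ?_
  rw [← Matrix.vecMul_vecMul, ← normCharVec_S, normCharVec_S', Matrix.vecMul_one]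

/-- `A` is the matrix of `γ` on the vector of characters, under the weight-zero action of the
modular group on functions of `(τ, z)`. -/
def IsCharMatrix (N : ℕ) (γ : SL(2, ℤ)) (A : GL (Fin (N + 1)) ℂ) : Prop :=
  ∀ τ z, normCharVec N (γ • τ) (z / cocycleJ γ τ) ᵥ* (A : Matrix (Fin (N + 1)) (Fin (N + 1)) ℂ) =
    normCharVec N τ z

theorem IsCharMatrix.unique {N : ℕ} {γ : SL(2, ℤ)} {A B : GL (Fin (N + 1)) ℂ}
    (hA : IsCharMatrix N γ A) (hB : IsCharMatrix N γ B) : A = B := by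
  refine Units.ext (matrix_eq_of_normCharVec N (γ • UpperHalfPlane.I) fun z => ?_)
  have h1 := hA UpperHalfPlane.I (z * cocycleJ γ UpperHalfPlane.I)
  have h2 := hB UpperHalfPlane.I (z * cocycleJ γ UpperHalfPlane.I)
  rw [mul_div_cancel_right₀ _ (cocycleJ_ne_zero _ _)] at h1 h2
  rw [h1, h2]

theorem IsCharMatrix.mul {N : ℕ} {γ γ' : SL(2, ℤ)} {A A' : GL (Fin (N + 1)) ℂ}
    (hA : IsCharMatrix N γ A) (hA' : IsCharMatrix N γ' A') :
    IsCharMatrix N (γ * γ') (A * A') := by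
  intro τ z
  rw [Units.val_mul, ← Matrix.vecMul_vecMul, mul_smul, cocycleJ_mul, mul_comm (cocycleJ γ _),
    ← div_div, hA, hA']

theorem isCharMatrix_one (N : ℕ) : IsCharMatrix N 1 1 := by
  intro τ z
  rw [one_smul, cocycleJ_one, div_one, Units.val_one, Matrix.vecMul_one]

theorem IsCharMatrix.inv {N : ℕ} {γ : SL(2, ℤ)} {A : GL (Fin (N + 1)) ℂ}
    (hA : IsCharMatrix N γ A) : IsCharMatrix N γ⁻¹ A⁻¹ := by
  intro τ z
  have h1 := hA (γ⁻¹ • τ) (z / cocycleJ γ⁻¹ τ)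
  rw [smul_inv_smul, div_div, mul_comm, ← cocycleJ_mul, mul_inv_cancel, cocycleJ_one,
    div_one] at h1
  rw [← h1, Matrix.vecMul_vecMul, ← Units.val_mul, mul_inv_cancel, Units.val_one,
    Matrix.vecMul_one]

theorem isCharMatrix_neg_one (N : ℕ) : IsCharMatrix N (-1) 1 := by
  intro τ z
  have : cocycleJ (-1) τ = -1 := by simp [cocycleJ]
  rw [ModularGroup.SL_neg_smul, one_smul, this, div_neg, div_one, normCharVec_neg, Units.val_one,
    Matrix.vecMul_one]

/-- `weilS N` as an invertible matrix; it is an involution. -/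
noncomputable def weilSGL (N : ℕ) : GL (Fin (N + 1)) ℂ :=
  ⟨weilS N, weilS N, weilS_mul_weilS N, weilS_mul_weilS N⟩

theorem weilT_det_ne_zero (N : ℕ) : (weilT N).det ≠ 0 := by
  rw [weilT, Matrix.det_diagonal]
  exact Finset.prod_ne_zero_iff.2 fun a _ => phase_ne_zero _

/-- `weilT N` as an invertible matrix. -/
noncomputable def weilTGL (N : ℕ) : GL (Fin (N + 1)) ℂ :=
  Matrix.GeneralLinearGroup.mkOfDetNeZero (weilT N) (weilT_det_ne_zero N)

theorem isCharMatrix_S (N : ℕ) : IsCharMatrix N ModularGroup.S (weilSGL N) := by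
  intro τ z
  rw [cocycleJ_S]
  exact normCharVec_S' N τ z

theorem isCharMatrix_T (N : ℕ) : IsCharMatrix N ModularGroup.T (weilTGL N) := by
  intro τ z
  rw [cocycleJ_T, div_one]
  exact normCharVec_T N τ z

theorem exists_isCharMatrix (N : ℕ) (γ : SL(2, ℤ)) : ∃ A, IsCharMatrix N γ A := by
  have hγ : γ ∈ Subgroup.closure {ModularGroup.S, ModularGroup.T} := by
    rw [SpecialLinearGroup.SL2Z_generators]; trivial
  induction hγ using Subgroup.closure_induction with
  | mem x hx =>
    rcases hx with rfl | rfl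
    exacts [⟨_, isCharMatrix_S N⟩, ⟨_, isCharMatrix_T N⟩]
  | one => exact ⟨1, isCharMatrix_one N⟩
  | mul x y _ _ hx hy =>
    obtain ⟨A, hA⟩ := hx
    obtain ⟨B, hB⟩ := hy
    exact ⟨A * B, hA.mul hB⟩
  | inv x _ hx =>
    obtain ⟨A, hA⟩ := hx
    exact ⟨A⁻¹, hA.inv⟩

/-- The representation of `SL(2,ℤ)` on coefficient vectors: contragredient to the one on the
symmetrized characters, and well defined because these are linearly independent. -/
noncomputable def weilRep (N : ℕ) : SL(2, ℤ) →* GL (Fin (N + 1)) ℂ :=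
  MonoidHom.mk' (fun γ => (exists_isCharMatrix N γ).choose) fun γ γ' =>
    (exists_isCharMatrix N (γ * γ')).choose_spec.unique
      ((exists_isCharMatrix N γ).choose_spec.mul (exists_isCharMatrix N γ').choose_spec)

theorem isCharMatrix_weilRep (N : ℕ) (γ : SL(2, ℤ)) : IsCharMatrix N γ (weilRep N γ) :=
  (exists_isCharMatrix N γ).choose_spec

theorem weilRep_S (N : ℕ) : weilRep N ModularGroup.S = weilSGL N :=
  (isCharMatrix_weilRep N _).unique (isCharMatrix_S N)

theorem weilRep_T (N : ℕ) : weilRep N ModularGroup.T = weilTGL N :=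
  (isCharMatrix_weilRep N _).unique (isCharMatrix_T N)

theorem weilRep_neg_one (N : ℕ) : weilRep N (-1) = 1 :=
  (isCharMatrix_weilRep N _).unique (isCharMatrix_neg_one N)

/-! ### The coefficient vector -/

theorem IsCharacterDecomposition.sum_range {N : ℕ} {c : ℕ → ℍ → ℂ}
    (h : IsCharacterDecomposition N fun i => c i) (τ : ℍ) (z : ℂ) (hz : sl2Denominator τ z ≠ 0) :
    umbralPsi N τ z =
      ∑ i ∈ Finset.range (2 * N + 1), c i τ * sl2Character (4 * N) (2 * i) τ z := by
  rw [h τ z hz, Finset.sum_range]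

theorem IsCharacterDecomposition.unique {N : ℕ} {c c' : Fin (2 * N + 1) → ℍ → ℂ}
    (h : IsCharacterDecomposition N c) (h' : IsCharacterDecomposition N c') : c = c' := by
  ext i τ
  set d : ℕ → ℂ := fun j => if hj : j < 2 * N + 1 then c ⟨j, hj⟩ τ - c' ⟨j, hj⟩ τ else 0
  have e : ∀ j : Fin (2 * N + 1), d j = c j τ - c' j τ := fun j => dif_pos j.2
  have h0 : d i = 0 := by
    refine coeff_eq_zero_of_sum_sl2Character_eq_zero N (τ := τ) (fun z hz => ?_) i.2
    rw [Finset.sum_range]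
    simp only [e, sub_mul, Finset.sum_sub_distrib]
    rw [← h τ z hz, ← h' τ z hz, sub_self]
  rwa [e, sub_eq_zero] at h0

/-- `IsEvenTheta.exists_decomposition` for `ψ_{0,N}`, with coefficients indexed by `ℕ`. By
`IsCharacterDecomposition.unique`, any decomposition inherits the listed properties. -/
theorem IsCharacterDecomposition.exists_nat {N : ℕ} (hN : N ∈ ({1, 2, 3, 4, 6} : Finset ℕ)) :
    ∃ c : ℕ → ℍ → ℂ, IsCharacterDecomposition N (fun i => c i) ∧
      (∀ i ≤ 2 * N, c (2 * N - i) = c i) ∧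
      (∀ i, MDifferentiable (modelWithCornersSelf ℂ ℂ) (modelWithCornersSelf ℂ ℂ) (c i)) ∧
      ∀ i, ∃ C M : ℝ, ∀ τ : ℍ, 1 ≤ τ.im → ‖c i τ‖ ≤ C * Real.exp (M * τ.im) := by
  obtain ⟨c, h1, h2, h3, h4⟩ := (isEvenTheta_umbralPsi hN).exists_decomposition
  exact ⟨c, fun τ z hz => by rw [h1 τ z hz, Finset.sum_range], h2, h3, h4⟩

theorem existsUnique_isCharacterDecomposition {N : ℕ}
    (hN : N ∈ ({1, 2, 3, 4, 6} : Finset ℕ)) :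
    ∃! c : Fin (2 * N + 1) → ℍ → ℂ, IsCharacterDecomposition N c := by
  obtain ⟨c, hc, -⟩ := IsCharacterDecomposition.exists_nat hN
  exact ⟨_, hc, fun c' hc' => hc'.unique hc⟩

theorem IsCharacterDecomposition.rev {N : ℕ} (hN : N ∈ ({1, 2, 3, 4, 6} : Finset ℕ))
    {c : Fin (2 * N + 1) → ℍ → ℂ} (hc : IsCharacterDecomposition N c) (i : Fin (2 * N + 1)) :
    c i.rev = c i := by
  obtain ⟨c', hc', hsymm, -⟩ := IsCharacterDecomposition.exists_nat hN
  rw [hc.unique hc']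
  dsimp only
  rw [← hsymm i (by omega)]
  congr 1
  rw [Fin.val_rev]
  omega

theorem IsCharacterDecomposition.eq_dotProduct {N : ℕ} (hN : N ∈ ({1, 2, 3, 4, 6} : Finset ℕ))
    {c : Fin (2 * N + 1) → ℍ → ℂ} (hc : IsCharacterDecomposition N c) (τ : ℍ) (z : ℂ)
    (hz : sl2Denominator τ z ≠ 0) :
    umbralPsi N τ z = symmCharVec N τ z ⬝ᵥ coefficientVector N c τ := by
  obtain ⟨c', hc', hsymm, -⟩ := IsCharacterDecomposition.exists_nat hN
  rw [hc.unique hc', hc'.sum_range τ z hz, sum_range_eq_sum_orbitSum, Finset.sum_range]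
  · refine Finset.sum_congr rfl fun a _ => ?_
    rw [mul_comm]
    rfl
  · intro a ha
    rw [← hsymm (N + a) (by omega)]
    congr 1
    omega

theorem sl2Denominator_S_ne_zero {τ : ℍ} {z : ℂ} (hz : sl2Denominator τ z ≠ 0) :
    sl2Denominator (ModularGroup.S • τ) (z / τ) ≠ 0 := by
  rw [sl2Denominator_S]
  exact mul_ne_zero (mul_ne_zero (by simp) (thetaFactor_ne_zero (by norm_num) τ z)) hz

theorem sl2Denominator_T_ne_zero {τ : ℍ} {z : ℂ} :
    sl2Denominator (ModularGroup.T • τ) z ≠ 0 ↔ sl2Denominator τ z ≠ 0 := by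
  rw [sl2Denominator_T, mul_ne_zero_iff]
  exact and_iff_right (phase_ne_zero _)

theorem coefficientVector_T {N : ℕ} (hN : N ∈ ({1, 2, 3, 4, 6} : Finset ℕ))
    {c : Fin (2 * N + 1) → ℍ → ℂ} (hc : IsCharacterDecomposition N c) (τ : ℍ) :
    coefficientVector N c (ModularGroup.T • τ) = weilT N *ᵥ coefficientVector N c τ := by
  rw [← sub_eq_zero]
  refine eq_zero_of_dotProduct_symmCharVec_eq_zero N (τ := ModularGroup.T • τ) fun z hz => ?_
  rw [dotProduct_sub, Matrix.dotProduct_mulVec, symmCharVec_T, ← hc.eq_dotProduct hN _ _ hz,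
    ← hc.eq_dotProduct hN _ _ (sl2Denominator_T_ne_zero.1 hz), umbralPsi_T hN, sub_self]

theorem coefficientVector_S {N : ℕ} (hN : N ∈ ({1, 2, 3, 4, 6} : Finset ℕ))
    {c : Fin (2 * N + 1) → ℍ → ℂ} (hc : IsCharacterDecomposition N c) (τ : ℍ) :
    coefficientVector N c (ModularGroup.S • τ) = weilS N *ᵥ coefficientVector N c τ := by
  have key : weilS N *ᵥ coefficientVector N c (ModularGroup.S • τ) = coefficientVector N c τ := by
    rw [← sub_eq_zero]
    refine eq_zero_of_dotProduct_symmCharVec_eq_zero N (τ := τ) fun z hz => ?_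
    have h1 := umbralPsi_S hN τ z
    rw [hc.eq_dotProduct hN _ _ (sl2Denominator_S_ne_zero hz), hc.eq_dotProduct hN _ _ hz,
      symmCharVec_S, smul_dotProduct, smul_eq_mul] at h1
    rw [dotProduct_sub, Matrix.dotProduct_mulVec, mul_left_cancel₀ (Complex.exp_ne_zero _) h1,
      sub_self]
  rw [← key, Matrix.mulVec_mulVec, weilS_mul_weilS, Matrix.one_mulVec]

theorem coefficientVector_smul {N : ℕ} (hN : N ∈ ({1, 2, 3, 4, 6} : Finset ℕ))
    {c : Fin (2 * N + 1) → ℍ → ℂ} (hc : IsCharacterDecomposition N c) (γ : SL(2, ℤ)) :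
    ∀ τ, coefficientVector N c (γ • τ) =
      (weilRep N γ : Matrix (Fin (N + 1)) (Fin (N + 1)) ℂ) *ᵥ coefficientVector N c τ := by
  have hγ : γ ∈ Subgroup.closure {ModularGroup.S, ModularGroup.T} := by
    rw [SpecialLinearGroup.SL2Z_generators]; trivial
  induction hγ using Subgroup.closure_induction with
  | mem x hx =>
    rcases hx with rfl | rfl
    · rw [weilRep_S]; exact coefficientVector_S hN hc
    · rw [weilRep_T]; exact coefficientVector_T hN hc
  | one => intro τ; rw [one_smul, map_one, Units.val_one, Matrix.one_mulVec]
  | mul x y _ _ hx hy =>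
    intro τ
    rw [mul_smul, hx, hy, map_mul, Units.val_mul, Matrix.mulVec_mulVec]
  | inv x _ hx =>
    intro τ
    have h1 := hx (x⁻¹ • τ)
    rw [smul_inv_smul] at h1
    rw [h1, Matrix.mulVec_mulVec, map_inv, ← Units.val_mul, inv_mul_cancel, Units.val_one,
      Matrix.one_mulVec]

/-- The coefficient vector is a weight-zero vector-valued modular form. Its growth at every cusp
follows from that at `i∞` by the transformation law. -/
theorem isWeightZeroVVMF_coefficientVector {N : ℕ} (hN : N ∈ ({1, 2, 3, 4, 6} : Finset ℕ))
    {c : Fin (2 * N + 1) → ℍ → ℂ} (hc : IsCharacterDecomposition N c) :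
    IsWeightZeroVVMF (weilT N) (weilS N) (coefficientVector N c) := by
  obtain ⟨c', hc', -, hholo, hgrow⟩ := IsCharacterDecomposition.exists_nat hN
  refine ⟨weilRep N, by rw [weilRep_T]; rfl, by rw [weilRep_S]; rfl, ?_, ?_, ?_, ?_⟩
  · rw [weilRep_neg_one]; simp
  · intro γ τ
    rw [zpow_zero, one_smul]
    exact coefficientVector_smul hN hc γ τ
  · intro i
    rw [hc.unique hc']
    exact hholo _
  · intro γ i
    simp only [coefficientVector_smul hN hc γ]
    rw [hc.unique hc']
    choose C M hCM using hgrow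
    -- a common exponent for all entries
    set M' : ℝ := ∑ j : Fin (N + 1), |M (N - j)| with hM'
    refine ⟨1, ∑ j, ‖(weilRep N γ : Matrix (Fin (N + 1)) (Fin (N + 1)) ℂ) i j‖ * |C (N - j)|, M',
      fun τ hτ => ?_⟩
    rw [Matrix.mulVec, dotProduct, Finset.sum_mul]
    refine norm_sum_le_of_le _ fun j _ => ?_
    rw [norm_mul, mul_assoc]
    refine mul_le_mul_of_nonneg_left ((hCM (N - j) τ hτ).trans ?_) (norm_nonneg _)
    have h1 : M (N - j) ≤ M' := (le_abs_self _).trans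
      (Finset.single_le_sum (f := fun j : Fin (N + 1) => |M (N - j)|) (fun _ _ => abs_nonneg _)
        (Finset.mem_univ j))
    exact mul_le_mul (le_abs_self _)
      (Real.exp_le_exp.2 (mul_le_mul_of_nonneg_right h1 τ.im_pos.le)) (Real.exp_nonneg _)
      (abs_nonneg _)

/-! ### The identity `ψ_{0,4}(τ,z) = ϑ₁(τ,3z) / ϑ₁(τ,z)` -/

/-- The theta functions `∑ᵢ q^((i+s)²) r^(2(i+s))` of index one (for `s = 0, 1/2`), which arise from
products of two theta functions with characteristics. -/
noncomputable def indexOneTheta (s : ℝ) (τ : ℍ) (z : ℂ) : ℂ :=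
  ∑' i : ℤ, qPow τ (((i : ℝ) + s) ^ 2) * rPow z (2 * ((i : ℝ) + s))

theorem hasSum_indexOneTheta (s : ℝ) (τ : ℍ) (z : ℂ) :
    HasSum (fun i : ℤ => qPow τ (((i : ℝ) + s) ^ 2) * rPow z (2 * ((i : ℝ) + s)))
      (indexOneTheta s τ z) := by
  have h0 : 0 < (2 * (τ : ℂ)).im := by
    have := τ.im_pos
    simpa using this
  refine Summable.hasSum ?_
  have h1 := ((summable_jacobiTheta₂_term_iff (2 * z + 2 * s * τ) _).2 h0).mul_left
    (qPow τ (s ^ 2) * rPow z (2 * s))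
  refine h1.congr fun i => ?_
  rw [qPow, qPow, rPow, rPow, jacobiTheta₂_term, ← Complex.exp_add, ← Complex.exp_add,
    ← Complex.exp_add]
  congr 1; push_cast; ring

theorem indexOneTheta_one (τ : ℍ) (z : ℂ) : indexOneTheta 1 τ z = indexOneTheta 0 τ z := by
  rw [indexOneTheta, indexOneTheta, ← (Equiv.addRight (1 : ℤ)).tsum_eq
    (fun i : ℤ => qPow τ (((i : ℝ) + 0) ^ 2) * rPow z (2 * ((i : ℝ) + 0)))]
  congr 1; ext i
  rw [Equiv.coe_addRight]
  push_cast
  rw [add_zero]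

theorem hasSum_thetaCharacteristic (a b : ℕ) (τ : ℍ) (z : ℂ) :
    HasSum (fun l : ℤ => qPow τ (((l : ℝ) + (a : ℝ) / 2) ^ 2 / 2) *
      rPow z ((l : ℝ) + (a : ℝ) / 2) * Complex.exp (Complex.I * Real.pi * l * b))
      (thetaCharacteristic a b τ z) := by
  refine Summable.hasSum ?_
  have h1 := ((summable_jacobiTheta₂_term_iff (z + a / 2 * τ + b / 2) _).2 τ.im_pos).mul_left
    (qPow τ (((a : ℝ) / 2) ^ 2 / 2) * rPow z ((a : ℝ) / 2))
  refine h1.congr fun i => ?_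
  rw [qPow, qPow, rPow, rPow, jacobiTheta₂_term, ← Complex.exp_add, ← Complex.exp_add,
    ← Complex.exp_add, ← Complex.exp_add]
  congr 1; push_cast; ring

/-- Pairs of integers `(l, m)` split by the parity of `l + m`: `(i + j, i - j)` and
`(i + j + 1, i - j)`. -/
def parityEquiv : (ℤ × ℤ) ⊕ (ℤ × ℤ) ≃ ℤ × ℤ where
  toFun := Sum.elim (fun x => (x.1 + x.2, x.1 - x.2)) (fun x => (x.1 + x.2 + 1, x.1 - x.2))
  invFun y := if (y.1 + y.2) % 2 = 0 then Sum.inl ((y.1 + y.2) / 2, (y.1 - y.2) / 2) else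
    Sum.inr ((y.1 + y.2) / 2, (y.1 - y.2) / 2)
  left_inv x := by
    rcases x with ⟨i, j⟩ | ⟨i, j⟩
    · refine (if_pos (show (i + j + (i - j)) % 2 = 0 by omega)).trans ?_
      change Sum.inl ((i + j + (i - j)) / 2, (i + j - (i - j)) / 2) = _
      congr 2 <;> omega
    · refine (if_neg (show ¬ (i + j + 1 + (i - j)) % 2 = 0 by omega)).trans ?_
      change Sum.inr ((i + j + 1 + (i - j)) / 2, (i + j + 1 - (i - j)) / 2) = _
      congr 2 <;> omega
  right_inv y := by
    rcases y with ⟨l, m⟩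
    dsimp only
    split_ifs with h
    · simp only [Sum.elim_inl]
      congr 1 <;> omega
    · simp only [Sum.elim_inr]
      congr 1 <;> omega

theorem exp_I_pi_int_mul (n : ℤ) (b : ℕ) :
    Complex.exp (Complex.I * Real.pi * n * b) = (-1) ^ (n * b) := by
  rw [← phase_int, phase]; congr 1; push_cast; ring

/-- The addition formula: the double sum is rearranged along `l + m` and `l - m`. -/
theorem thetaCharacteristic_add_mul_sub (a b : ℕ) (τ : ℍ) (x y : ℂ) :
    thetaCharacteristic a b τ (x + y) * thetaCharacteristic a b τ (x - y) =
      indexOneTheta (a / 2) τ x * indexOneTheta 0 τ y +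
        (-1) ^ b * (indexOneTheta ((a + 1) / 2) τ x * indexOneTheta (1 / 2) τ y) := by
  have hprod : ∀ {f g : ℤ → ℂ} {A B : ℂ}, HasSum f A → HasSum g B →
      HasSum (fun p : ℤ × ℤ => f p.1 * g p.2) (A * B) := fun {f g A B} hf hg =>
    hf.mul hg (summable_mul_of_summable_norm (R := ℂ) hf.summable.norm hg.summable.norm)
  have h1 := hprod (hasSum_thetaCharacteristic a b τ (x + y))
    (hasSum_thetaCharacteristic a b τ (x - y))
  have h2 := hprod (hasSum_indexOneTheta (a / 2) τ x) (hasSum_indexOneTheta 0 τ y)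
  have h3 := (hprod (hasSum_indexOneTheta ((a + 1) / 2) τ x)
    (hasSum_indexOneTheta (1 / 2) τ y)).mul_left ((-1) ^ b)
  have e0 : ∀ l m : ℤ,
      (qPow τ (((l : ℝ) + (a : ℝ) / 2) ^ 2 / 2) * rPow (x + y) ((l : ℝ) + (a : ℝ) / 2) *
        Complex.exp (Complex.I * Real.pi * l * b)) *
      (qPow τ (((m : ℝ) + (a : ℝ) / 2) ^ 2 / 2) * rPow (x - y) ((m : ℝ) + (a : ℝ) / 2) *
        Complex.exp (Complex.I * Real.pi * m * b)) =
      (-1) ^ ((l + m) * b) * ((qPow τ (((l + m + a : ℝ) / 2) ^ 2) * rPow x (l + m + a : ℝ)) *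
        (qPow τ (((l - m : ℝ) / 2) ^ 2) * rPow y (l - m : ℝ))) := by
    intro l m
    rw [← exp_I_pi_int_mul]
    simp only [qPow, rPow, ← Complex.exp_add]
    congr 1; push_cast; ring
  simp only [e0] at h1
  rw [← parityEquiv.hasSum_iff] at h1
  refine h1.unique (HasSum.sum ?_ ?_)
  · convert h2 using 1
    ext ⟨i, j⟩
    simp only [Function.comp_apply, parityEquiv, Equiv.coe_fn_mk, Sum.elim_inl]
    rw [show (i + j + (i - j)) * (b : ℤ) = 2 * (i * b) by ring, (even_two_mul _).neg_one_zpow,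
      one_mul]
    congr 2 <;> congr 1 <;> push_cast <;> ring_nf
  · convert h3 using 1
    · rfl
    ext ⟨i, j⟩
    simp only [Function.comp_apply, parityEquiv, Equiv.coe_fn_mk, Sum.elim_inr]
    rw [show (i + j + 1 + (i - j)) * (b : ℤ) = 2 * (i * b) + b by ring,
      zpow_add₀ (by norm_num), (even_two_mul _).neg_one_zpow, one_mul, zpow_natCast]
    congr 2 <;> congr 1 <;> push_cast <;> ring_nf

theorem sl2Denominator_eq_theta1 (τ : ℍ) (z : ℂ) :
    sl2Denominator τ z = thetaCharacteristic 1 1 τ z := by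
  have h : thetaCharacteristic 1 1 τ z =
      coeffTheta 2 (fun n => residueInd 2 1 n * phase (((n : ℝ) - 1) / 2)) τ z := by
    simp only [coeffTheta, mul_assoc]
    rw [← tsum_arith_eq 2 1 two_ne_zero (fun n => phase (((n : ℝ) - 1) / 2) *
      (qPow τ ((n : ℝ) ^ 2 / (4 * (2 : ℕ))) * rPow z ((n : ℝ) / 2))), thetaCharacteristic]
    congr 1; ext l
    rw [mul_comm]
    congr 1
    · rw [phase]; congr 1; push_cast; ring
    · congr 2 <;> push_cast <;> ring
  rw [h, sl2Denominator_eq]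
  congr 1; ext n
  rcases Int.even_or_odd' n with ⟨k, rfl | rfl⟩
  · rw [residueInd_two_one, oddInd_four_one_cases, if_neg (by omega), if_neg (by omega),
      if_pos (by simp), zero_mul]
  · rw [residueInd_two_one, if_neg (by simp), one_mul, oddInd_four_one_cases,
      show (((2 * k + 1 : ℤ) : ℝ) - 1) / 2 = (k : ℝ) by push_cast; ring, phase_int]
    rcases Int.even_or_odd' k with ⟨j, rfl | rfl⟩
    · rw [if_pos (by omega), (even_two_mul j).neg_one_zpow]
    · rw [if_neg (by omega), if_pos (by omega), (odd_two_mul_add_one j).neg_one_zpow]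

/-- The tripling formula. By the addition formula all theta functions at `z`, `2z` and `3z` are
expressed through `indexOneTheta 0` and `indexOneTheta (1/2)` at `z` and at `0`, and the claim
becomes an identity of rational functions. -/
theorem umbralPsi4_mul_sq (τ : ℍ) (z : ℂ) :
    umbralPsi4 τ z * sl2Denominator τ z ^ 2 = sl2Denominator τ (3 * z) * sl2Denominator τ z := by
  have A : ∀ x y, thetaCharacteristic 0 0 τ (x + y) * thetaCharacteristic 0 0 τ (x - y) =
      indexOneTheta 0 τ x * indexOneTheta 0 τ y +
        indexOneTheta (1 / 2) τ x * indexOneTheta (1 / 2) τ y := fun x y => by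
    rw [thetaCharacteristic_add_mul_sub]; norm_num
  have B : ∀ x y, thetaCharacteristic 0 1 τ (x + y) * thetaCharacteristic 0 1 τ (x - y) =
      indexOneTheta 0 τ x * indexOneTheta 0 τ y -
        indexOneTheta (1 / 2) τ x * indexOneTheta (1 / 2) τ y := fun x y => by
    rw [thetaCharacteristic_add_mul_sub]; norm_num; ring
  have C : ∀ x y, thetaCharacteristic 1 0 τ (x + y) * thetaCharacteristic 1 0 τ (x - y) =
      indexOneTheta (1 / 2) τ x * indexOneTheta 0 τ y +
        indexOneTheta 0 τ x * indexOneTheta (1 / 2) τ y := fun x y => by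
    rw [thetaCharacteristic_add_mul_sub]; norm_num [indexOneTheta_one]
  have D : ∀ x y, sl2Denominator τ (x + y) * sl2Denominator τ (x - y) =
      indexOneTheta (1 / 2) τ x * indexOneTheta 0 τ y -
        indexOneTheta 0 τ x * indexOneTheta (1 / 2) τ y := fun x y => by
    rw [sl2Denominator_eq_theta1, sl2Denominator_eq_theta1, thetaCharacteristic_add_mul_sub]
    norm_num [indexOneTheta_one]; ring
  have A0 := A 0 0
  have B0 := B 0 0
  have C0 := C 0 0
  have Az := A z 0
  have Bz := B z 0
  have Cz := C z 0
  have Dz := D z 0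
  have A2 := A z z
  have B2 := B z z
  have A4 := A (z + z) 0
  have B4 := B (z + z) 0
  have D3 := D (z + z) z
  rw [show z + z + z = 3 * z by ring, show z + z - z = z by ring] at D3
  simp only [add_zero, sub_zero, sub_self] at A0 B0 C0 Az Bz Cz Dz A2 B2 A4 B4
  have h2 := theta2_zero_ne_zero τ
  have h3 := theta3_zero_ne_zero τ
  have h4 := theta4_zero_ne_zero τ
  have hX := div_pow (thetaCharacteristic 1 0 τ z) (thetaCharacteristic 1 0 τ 0) 2
  have hY := div_pow (thetaCharacteristic 0 0 τ z) (thetaCharacteristic 0 0 τ 0) 2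
  have hW := div_pow (thetaCharacteristic 0 1 τ z) (thetaCharacteristic 0 1 τ 0) 2
  rw [sq (thetaCharacteristic 1 0 τ z), sq (thetaCharacteristic 1 0 τ 0), Cz, C0] at hX
  rw [sq (thetaCharacteristic 0 0 τ z), sq (thetaCharacteristic 0 0 τ 0), Az, A0] at hY
  rw [sq (thetaCharacteristic 0 1 τ z), sq (thetaCharacteristic 0 1 τ 0), Bz, B0] at hW
  rw [umbralPsi4, umbralPsi1, umbralPsi2, umbralPsi3, umbralF2, umbralF3, umbralF4, D3,
    sq (sl2Denominator τ z), Dz, hX, hY, hW]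
  clear hX hY hW Cz Az Bz Dz D3 A B C D
  generalize indexOneTheta 0 τ z = α at *
  generalize indexOneTheta (1 / 2) τ z = β at *
  generalize indexOneTheta 0 τ (z + z) = α₂ at *
  generalize indexOneTheta (1 / 2) τ (z + z) = β₂ at *
  generalize indexOneTheta 0 τ 0 = u at *
  generalize indexOneTheta (1 / 2) τ 0 = v at *
  generalize thetaCharacteristic 0 0 τ (z + z) = t₃ at *
  generalize thetaCharacteristic 0 1 τ (z + z) = t₄ at *
  have hA : u * u + v * v ≠ 0 := A0 ▸ mul_ne_zero h3 h3
  have hB : u * u - v * v ≠ 0 := B0 ▸ mul_ne_zero h4 h4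
  have hC : v * u + u * v ≠ 0 := C0 ▸ mul_ne_zero h2 h2
  have hu : u ≠ 0 := by rintro rfl; simp at hC
  have hv : v ≠ 0 := by rintro rfl; simp at hC
  rw [← sq, ← sq] at hA hB
  -- duplication formulas for `ϑ₃` and `ϑ₄`, solved below for the index-one functions at `2z`
  have q3 : α₂ * u + β₂ * v = (α * α + β * β) ^ 2 / (u ^ 2 + v ^ 2) := by
    rw [eq_div_iff hA, sq u, sq v, ← A0, ← A2, ← A4]; ring
  have q4 : α₂ * u - β₂ * v = (α * α - β * β) ^ 2 / (u ^ 2 - v ^ 2) := by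
    rw [eq_div_iff hB, sq u, sq v, ← B0, ← B2, ← B4]; ring
  have hα : α₂ = ((α * α + β * β) ^ 2 / (u ^ 2 + v ^ 2) +
      (α * α - β * β) ^ 2 / (u ^ 2 - v ^ 2)) / (2 * u) := by
    rw [eq_div_iff (by simp [hu]), ← q3, ← q4]; ring
  have hβ : β₂ = ((α * α + β * β) ^ 2 / (u ^ 2 + v ^ 2) -
      (α * α - β * β) ^ 2 / (u ^ 2 - v ^ 2)) / (2 * v) := by
    rw [eq_div_iff (by simp [hv]), ← q3, ← q4]; ring
  rw [hα, hβ, show v * u + u * v = 2 * u * v by ring, ← sq u, ← sq v]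
  field_simp
  ring

theorem umbralPsi4_mul_sl2Denominator {τ : ℍ} {z : ℂ} (hz : sl2Denominator τ z ≠ 0) :
    umbralPsi4 τ z * sl2Denominator τ z = sl2Denominator τ (3 * z) := by
  refine mul_right_cancel₀ hz ?_
  rw [mul_assoc, ← sq, umbralPsi4_mul_sq]

theorem residueInd_twelve (a n : ℤ) : residueInd 12 a n =
    residueInd 36 a n + residueInd 36 (a + 12) n + residueInd 36 (a - 12) n := by
  simp only [residueInd]
  split_ifs <;> first | omega | norm_num

/-- The multiples of `3` among the `n ≡ ±3 mod 12`, sorted by residues modulo `36`; all of them are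
multiples of `3`, and `oddInd 36 27 = -oddInd 36 9`. -/
theorem residueInd_three_zero_mul_oddInd (n : ℤ) :
    residueInd 3 0 n * oddInd 12 3 n = -oddInd 36 9 n + (oddInd 36 3 n + oddInd 36 15 n) := by
  have h1 : residueInd 3 0 n * oddInd 12 3 n = oddInd 12 3 n := by
    simp only [oddInd, residueInd]
    split_ifs <;> first | omega | norm_num
  rw [h1, oddInd, residueInd_twelve, residueInd_twelve, oddInd, oddInd, oddInd]
  norm_num
  ring

/-- The terms `q^(n²/8) r^(3n/2)` of `D(τ,3z)` are the terms `q^(m²/72) r^(m/2)`, `m = 3n`, of theta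
functions of level `18`. -/
theorem sl2Denominator_three_mul (τ : ℍ) (z : ℂ) :
    sl2Denominator τ (3 * z) =
      -charNum 4 4 τ z + (charNum 4 1 τ z + charNum 4 7 τ z) := by
  have e : ∀ n : ℤ, oddInd 12 3 (3 * n + 0) = oddInd 4 1 n := by
    intro n
    simp only [oddInd, residueInd]
    congr 1 <;> refine if_congr ?_ rfl rfl <;> omega
  have h : sl2Denominator τ (3 * z) =
      coeffTheta 18 (fun n => residueInd 3 0 n * oddInd 12 3 n) τ z := by
    simp only [coeffTheta, mul_assoc]
    rw [← tsum_arith_eq 3 0 three_ne_zero (fun n => oddInd 12 3 n *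
      (qPow τ ((n : ℝ) ^ 2 / (4 * (18 : ℕ))) * rPow z ((n : ℝ) / 2))), sl2Denominator_eq,
      coeffTheta]
    congr 1; ext n
    rw [e, mul_assoc]
    congr 2
    · congr 1; push_cast; ring
    · rw [rPow, rPow]; congr 1; push_cast; ring
  rw [h]
  simp only [residueInd_three_zero_mul_oddInd]
  rw [coeffTheta_add (by norm_num) (fun n => (norm_neg (oddInd 36 9 n)).trans_le
      (norm_oddInd_le 36 9 n)) (fun n => norm_add_le_of_le (norm_oddInd_le 36 3 n)
      (norm_oddInd_le 36 15 n)), coeffTheta_add (by norm_num) (norm_oddInd_le 36 3)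
      (norm_oddInd_le 36 15), charNum_eq, charNum_eq, charNum_eq]
  have h9 := coeffTheta_smul 18 (-1) (oddInd 36 9) τ z
  simp only [neg_one_mul] at h9
  rw [h9]
  norm_num

theorem umbralPsi_four_eq {τ : ℍ} {z : ℂ} (hz : sl2Denominator τ z ≠ 0) :
    umbralPsi 4 τ z = umbralCombination4 τ z := by
  have h1 := sl2Character_eq 4 4 τ z
  have h2 := sl2Character_eq 4 1 τ z
  have h3 := sl2Character_eq 4 7 τ z
  norm_num at h1 h2 h3
  rw [umbralCombination4, h1, h2, h3, ← neg_div, ← add_div, ← add_div,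
    ← sl2Denominator_three_mul, ← umbralPsi4_mul_sl2Denominator hz, mul_div_cancel_right₀ _ hz]
  rfl

/-- The constants in the decomposition of `ψ_{0,4}`. -/
def umbralPsi4Coeff (i : Fin (2 * 4 + 1)) : ℂ := ![0, 1, 0, 0, -1, 0, 0, 1, 0] i

theorem isCharacterDecomposition_four :
    IsCharacterDecomposition 4 fun i _ => umbralPsi4Coeff i := by
  intro τ z hz
  rw [umbralPsi_four_eq hz, umbralCombination4]
  simp [Fin.sum_univ_succ, umbralPsi4Coeff]
  ring

theorem coefficientVector_four {c : Fin (2 * 4 + 1) → ℍ → ℂ} (hc : IsCharacterDecomposition 4 c)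
    (τ : ℍ) : coefficientVector 4 c τ = ![-1, 0, 0, 1, 0] := by
  rw [hc.unique isCharacterDecomposition_four]
  ext a
  fin_cases a <;> rfl

theorem umbralCombination4_T {τ : ℍ} {z : ℂ} (hz : sl2Denominator τ z ≠ 0) :
    umbralCombination4 (ModularGroup.T • τ) z = umbralCombination4 τ z := by
  rw [← umbralPsi_four_eq hz, ← umbralPsi_four_eq (sl2Denominator_T_ne_zero.2 hz),
    umbralPsi_T (by decide)]

theorem umbralCombination4_S {τ : ℍ} {z : ℂ} (hz : sl2Denominator τ z ≠ 0) :
    umbralCombination4 (ModularGroup.S • τ) (z / (τ : ℂ)) =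
      Complex.exp (2 * Real.pi * Complex.I * 4 * z ^ 2 / (τ : ℂ)) * umbralCombination4 τ z := by
  rw [← umbralPsi_four_eq hz, ← umbralPsi_four_eq (sl2Denominator_S_ne_zero hz),
    umbralPsi_S (by decide)]
  norm_num

/-! ### The explicit matrices -/

/-- `sin (π p / (2L))`. -/
noncomputable def sinQuot (L : ℕ) (p : ℤ) : ℝ := Real.sin (Real.pi * (p / (2 * L)))

/-- `sin (π p / (2L)) = e sin (π q / (2L))` holds for elementary reasons: the arguments are
congruent, up to the reflection of the sine at `π / 2` and the sign. -/
def SinRel (L : ℕ) (p e q : ℤ) : Prop :=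
  (e = 1 ∧ ((4 * L : ℤ) ∣ p - q ∨ (4 * L : ℤ) ∣ p + q - 2 * L)) ∨
    (e = -1 ∧ ((4 * L : ℤ) ∣ p + q ∨ (4 * L : ℤ) ∣ p - q - 2 * L))

instance (L : ℕ) (p e q : ℤ) : Decidable (SinRel L p e q) := by unfold SinRel; infer_instance

theorem sinQuot_neg (L : ℕ) (p : ℤ) : sinQuot L (-p) = -sinQuot L p := by
  rw [sinQuot, sinQuot, ← Real.sin_neg]; congr 1; push_cast; ring

theorem SinRel.sinQuot_eq {L : ℕ} (hL : 0 < L) {p e q : ℤ} (h : SinRel L p e q) :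
    sinQuot L p = e * sinQuot L q := by
  have hL' : (L : ℝ) ≠ 0 := by positivity
  have key : ∀ q' : ℤ, ((4 * L : ℤ) ∣ p - q' ∨ (4 * L : ℤ) ∣ p + q' - 2 * L) →
      sinQuot L p = sinQuot L q' := by
    rintro q' (⟨k, hk⟩ | ⟨k, hk⟩)
    · have : (p : ℝ) = q' + 4 * L * k := by
        rw [sub_eq_iff_eq_add'] at hk; rw [hk]; push_cast; ring
      exact sin_pi_mul_congr k (by rw [this]; field_simp; ring)
    · have : (p : ℝ) = 2 * L - q' + 4 * L * k := by
        rw [show p = 2 * L - q' + 4 * L * k by linear_combination hk]; push_cast; ring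
      exact sin_pi_mul_congr_sub k (by rw [this]; field_simp; ring)
  rcases h with ⟨rfl, h⟩ | ⟨rfl, h⟩
  · rw [key q h, Int.cast_one, one_mul]
  · rw [key (-q) (by simpa [sub_eq_add_neg] using h), sinQuot_neg]; push_cast; ring

theorem cos_eq_sinQuot {L : ℕ} (hL : 0 < L) (p : ℤ) :
    Real.cos (p * Real.pi / L) = sinQuot L (L - 2 * p) := by
  have hL' : (L : ℝ) ≠ 0 := by positivity
  rw [← Real.sin_pi_div_two_sub, sinQuot]
  congr 1; push_cast; field_simp

theorem sin_eq_sinQuot (L : ℕ) (p : ℤ) :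
    Real.sin (p * Real.pi / (2 * L)) = sinQuot L p := by
  rw [sinQuot]; congr 1; ring

theorem sinQuot_self {L : ℕ} (hL : 0 < L) : sinQuot L L = 1 := by
  have hL' : (L : ℝ) ≠ 0 := by positivity
  rw [sinQuot, ← Real.sin_pi_div_two]
  congr 1; push_cast; field_simp

/-- A criterion for a matrix to be `weilS N`: up to the factor of the column, its entries are the
signed sines `E a b * sin (π Q a b / 2L)` with `L = 2N + 1`, and the tables `E` and `Q` agree with
the general formula up to reflections. This agreement is a decidable condition on integers. -/
theorem map_ofReal_eq_weilS (N : ℕ) {s : ℝ} (hs : s = 1 / √(2 * N + 1))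
    (x : Matrix (Fin (N + 1)) (Fin (N + 1)) ℝ) (E Q : Fin (N + 1) → Fin (N + 1) → ℤ)
    (h : ∀ a b : Fin (N + 1), SinRel (2 * N + 1)
      ((2 * N + 1 - 2 * ((a : ℕ) : ℤ)) * (2 * N + 1 - 2 * ((b : ℕ) : ℤ))) (E a b) (Q a b))
    (hx : ∀ a b, x a b = (if b = 0 then 1 else 2) * (E a b * sinQuot (2 * N + 1) (Q a b))) :
    (s • x).map Complex.ofReal = weilS N := by
  ext a b
  have h1 := (h a b).sinQuot_eq (by omega)
  rw [hs, Matrix.map_apply, Matrix.smul_apply, hx, ← h1, weilS, sinQuot]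
  simp only [Matrix.of_apply]
  congr 1
  rw [smul_eq_mul, ← mul_assoc, one_div_mul_eq_div]
  congr 2
  push_cast; ring

theorem diagonal_eq_weilT (N : ℕ) (x : Fin (N + 1) → ℝ) (m : Fin (N + 1) → ℤ)
    (h : ∀ a, x a = ((2 * N + 1) - (2 * N + 1 - 2 * ((a : ℕ) : ℝ)) ^ 2) / (4 * (2 * N + 1)) +
      2 * m a) : Matrix.diagonal (fun a => phase (x a)) = weilT N := by
  rw [weilT]
  congr 1; ext a
  exact phase_congr (m a) (h a)

theorem umbralT1_eq : umbralT1 = weilT 1 := by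
  rw [← diagonal_eq_weilT 1 ![-1 / 2, 1 / 6] ![0, 0], umbralT1]
  · congr 1; ext a; fin_cases a <;> rfl
  · intro a; fin_cases a <;> norm_num

theorem umbralT2_eq : umbralT2 = weilT 2 := by
  rw [← diagonal_eq_weilT 2 ![1, -1 / 5, 1 / 5] ![1, 0, 0], umbralT2]
  · congr 1; ext a; fin_cases a <;> rfl
  · intro a; fin_cases a <;> norm_num

theorem umbralT3_eq : umbralT3 = weilT 3 := by
  rw [← diagonal_eq_weilT 3 ![1 / 2, 19 / 14, -1 / 14, 3 / 14] ![1, 1, 0, 0], umbralT3]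
  · congr 1; ext a; fin_cases a <;> rfl
  · intro a; fin_cases a <;> norm_num

theorem umbralT4_eq : umbralT4 = weilT 4 := by
  rw [umbralT4, weilT]
  congr 1; ext a
  norm_num

theorem umbralT6_eq : umbralT6 = weilT 6 := by
  rw [← diagonal_eq_weilT 6 ![1, -1 / 13, -17 / 13, -9 / 13, -3 / 13, 1 / 13, 3 / 13]
    ![2, 1, 0, 0, 0, 0, 0], umbralT6]
  · congr 1; ext a; fin_cases a <;> rfl
  · intro a; fin_cases a <;> norm_num

theorem umbralS1_eq : umbralS1 = weilS 1 := by
  have h3 : sinQuot 3 3 = 1 := sinQuot_self (by norm_num)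
  have h1 : sinQuot 3 1 = 1 / 2 := by
    rw [← Real.sin_pi_div_six, sinQuot]; congr 1; push_cast; ring
  refine map_ofReal_eq_weilS 1 (by norm_num) _
    ![![-1, 1], ![1, 1]]
    ![![3, 3], ![3, 1]] (by decide) fun a b => ?_
  fin_cases a <;> fin_cases b <;> simp [h1, h3]

theorem umbralS2_eq : umbralS2 = weilS 2 := by
  have h5 : sinQuot 5 5 = 1 := sinQuot_self (by norm_num)
  have h3 : sinQuot 5 3 = (1 + √5) / 4 := by
    have := cos_eq_sinQuot (L := 5) (by norm_num) 1
    norm_num at this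
    exact this.symm
  -- `sin (π/10) = cos (2π/5)` by the duplication formula
  have h1 : sinQuot 5 1 = (√5 - 1) / 4 := by
    have := cos_eq_sinQuot (L := 5) (by norm_num) 2
    norm_num at this
    rw [← this, show 2 * Real.pi / 5 = 2 * (Real.pi / 5) by ring, Real.cos_two_mul,
      Real.cos_pi_div_five]
    have h : √5 ^ 2 = 5 := Real.sq_sqrt (by norm_num)
    linear_combination h / 8
  refine map_ofReal_eq_weilS 2 (by norm_num) _
    ![![1, -1, 1], ![-1, 1, 1], ![1, 1, 1]]
    ![![5, 5, 5], ![5, 1, 3], ![5, 3, 1]] (by decide) fun a b => ?_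
  fin_cases a <;> fin_cases b <;> simp [h1, h3, h5]
  all_goals ring

theorem umbralS3_eq : umbralS3 = weilS 3 := by
  have h7 : sinQuot 7 7 = 1 := sinQuot_self (by norm_num)
  have h1 := sin_eq_sinQuot 7 1
  have h3 := sin_eq_sinQuot 7 3
  have h5 := cos_eq_sinQuot (L := 7) (by norm_num) 1
  norm_num at h1 h3 h5
  refine map_ofReal_eq_weilS 3 (by norm_num) _
    ![![-1, 1, -1, 1], ![1, -1, -1, 1], ![-1, -1, 1, 1], ![1, 1, 1, 1]]
    ![![7, 7, 7, 7], ![7, 3, 1, 5], ![7, 1, 5, 3], ![7, 5, 3, 1]] (by decide) fun a b => ?_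
  fin_cases a <;> fin_cases b <;> simp [h1, h3, h5, h7]

theorem umbralS6_eq : umbralS6 = weilS 6 := by
  have h13 : sinQuot 13 13 = 1 := sinQuot_self (by norm_num)
  have h1 := sin_eq_sinQuot 13 1
  have h3 := sin_eq_sinQuot 13 3
  have h5 := sin_eq_sinQuot 13 5
  have h7 := cos_eq_sinQuot (L := 13) (by norm_num) 3
  have h9 := cos_eq_sinQuot (L := 13) (by norm_num) 2
  have h11 := cos_eq_sinQuot (L := 13) (by norm_num) 1
  norm_num at h1 h3 h5 h7 h9 h11
  refine map_ofReal_eq_weilS 6 (by norm_num) _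
    ![![1, -1, 1, -1, 1, -1, 1],
    ![-1, 1, -1, 1, 1, -1, 1],
    ![1, -1, -1, 1, -1, -1, 1],
    ![-1, 1, 1, -1, -1, 1, 1],
    ![1, 1, -1, -1, 1, 1, 1],
    ![-1, -1, -1, 1, 1, 1, 1],
    ![1, 1, 1, 1, 1, 1, 1]]
    ![![13, 13, 13, 13, 13, 13, 13],
    ![13, 9, 5, 1, 3, 7, 11],
    ![13, 5, 3, 11, 7, 1, 9],
    ![13, 1, 11, 3, 9, 5, 7],
    ![13, 3, 7, 9, 1, 11, 5],
    ![13, 7, 1, 5, 11, 9, 3],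
    ![13, 11, 9, 7, 5, 3, 1]] (by decide) fun a b => ?_
  fin_cases a <;> fin_cases b <;> simp [h1, h3, h5, h7, h9, h11, h13]

theorem umbralS4_eq : umbralS4 = weilS 4 := by
  have h : √(9 : ℝ) = 3 := by
    rw [show (9 : ℝ) = 3 ^ 2 by norm_num]; exact Real.sqrt_sq (by norm_num)
  rw [umbralS4, weilS]
  congr 1; ext a b
  norm_num [h]

/-! ### The vectors fixed by `T` and `S` for `N = 4` -/

theorem phase_ne_one {x : ℝ} (h : ∀ n : ℤ, x ≠ 2 * n) : phase x ≠ 1 := by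
  intro h1
  rw [phase, Complex.exp_eq_one_iff] at h1
  obtain ⟨n, hn⟩ := h1
  refine h n ?_
  have hpi : (Real.pi : ℂ) ≠ 0 := by exact_mod_cast Real.pi_ne_zero
  have : (x : ℂ) = 2 * n := by
    refine mul_left_cancel₀ (mul_ne_zero Complex.I_ne_zero hpi) ?_
    rw [hn]; ring
  exact_mod_cast this

/-- The eigenvalues of `T` in the entries `1`, `2` and `4` differ from one, and the first row of `S`
determines the ratio of the other two entries. -/
theorem umbralTS4_fixed_iff (v : Fin 5 → ℂ) :
    umbralT4 *ᵥ v = v ∧ umbralS4 *ᵥ v = v ↔ ∃ x : ℂ, v = x • ![-1, 0, 0, 1, 0] := by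
  constructor
  · rintro ⟨hT, hS⟩
    have hv : ∀ a : Fin 5, (∀ n : ℤ, (9 - (9 - 2 * ((a : ℕ) : ℝ)) ^ 2) / 36 ≠ 2 * n) → v a = 0 := by
      intro a ha
      have h1 := congrFun hT a
      rw [umbralT4, Matrix.mulVec_diagonal] at h1
      by_contra h0
      exact phase_ne_one ha (mul_right_cancel₀ h0 (h1.trans (one_mul _).symm))
    have hne : ∀ (k : ℤ) (n : ℤ), ¬ (18 : ℤ) ∣ k → (k / 9 : ℝ) ≠ 2 * n := by
      intro k n hk h
      refine hk ⟨n, ?_⟩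
      have : (k : ℝ) = 18 * n := by linear_combination 9 * h
      exact_mod_cast this
    have v1 : v 1 = 0 := hv 1 fun n => by
      have := hne (-10) n (by decide)
      norm_num at this ⊢
      exact this
    have v2 : v 2 = 0 := hv 2 fun n => by
      have := hne (-4) n (by decide)
      norm_num at this ⊢
      exact this
    have v4 : v 4 = 0 := hv 4 fun n => by
      have := hne 2 n (by decide)
      norm_num at this ⊢
      exact this
    have h0 := congrFun hS 0
    have s0 : Real.sin (Real.pi * 9 * 9 / 18) = 1 := by
      rw [← Real.sin_pi_div_two, show Real.pi * 9 * 9 / 18 =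
        Real.pi / 2 + (2 : ℤ) * (2 * Real.pi) by push_cast; ring, Real.sin_add_int_mul_two_pi]
    have s3 : Real.sin (Real.pi * 9 * (9 - 2 * 3) / 18) = -1 := by
      rw [show Real.pi * 9 * (9 - 2 * 3) / 18 = Real.pi / 2 + Real.pi by ring, Real.sin_add_pi,
        Real.sin_pi_div_two]
    have e0 : umbralS4 0 0 = 1 / 3 := by
      rw [umbralS4, Matrix.of_apply, ← Complex.ofReal_one, ← Complex.ofReal_ofNat,
        ← Complex.ofReal_div, ← mul_one ((1 : ℝ) / 3), ← s0]
      simp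
    have e3 : umbralS4 0 3 = -(2 / 3) := by
      have : -(2 / 3 : ℂ) = ((2 / 3 * -1 : ℝ) : ℂ) := by push_cast; ring
      rw [umbralS4, Matrix.of_apply, this, ← s3]
      simp
    rw [Matrix.mulVec, dotProduct, Fin.sum_univ_five, v1, v2, v4, e0, e3] at h0
    have v3 : v 3 = -v 0 := by linear_combination -3 / 2 * h0
    refine ⟨v 3, ?_⟩
    ext a
    fin_cases a <;> simp [v1, v2, v4, v3]
  · rintro ⟨x, rfl⟩
    have h4 : 4 ∈ ({1, 2, 3, 4, 6} : Finset ℕ) := by decide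
    have hc := isCharacterDecomposition_four
    have hT := coefficientVector_T h4 hc UpperHalfPlane.I
    have hS := coefficientVector_S h4 hc UpperHalfPlane.I
    rw [coefficientVector_four hc, coefficientVector_four hc, ← umbralT4_eq] at hT
    rw [coefficientVector_four hc, coefficientVector_four hc, ← umbralS4_eq] at hS
    exact ⟨by rw [Matrix.mulVec_smul]; exact congrArg _ hT.symm,
      by rw [Matrix.mulVec_smul]; exact congrArg _ hS.symm⟩

theorem mainTheorem1 :
    -- existence and uniqueness of the decomposition, and symmetry of its coefficients
    (∀ N ∈ ({1, 2, 3, 4, 6} : Finset ℕ),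
      (∃! c : Fin (2 * N + 1) → ℍ → ℂ, IsCharacterDecomposition N c) ∧
      ∀ c : Fin (2 * N + 1) → ℍ → ℂ, IsCharacterDecomposition N c → ∀ i, c i.rev = c i) ∧
    -- N = 1, 2, 3, 6
    (∀ c : Fin (2 * 1 + 1) → ℍ → ℂ, IsCharacterDecomposition 1 c →
      IsWeightZeroVVMF umbralT1 umbralS1 (coefficientVector 1 c)) ∧
    (∀ c : Fin (2 * 2 + 1) → ℍ → ℂ, IsCharacterDecomposition 2 c →
      IsWeightZeroVVMF umbralT2 umbralS2 (coefficientVector 2 c)) ∧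
    (∀ c : Fin (2 * 3 + 1) → ℍ → ℂ, IsCharacterDecomposition 3 c →
      IsWeightZeroVVMF umbralT3 umbralS3 (coefficientVector 3 c)) ∧
    (∀ c : Fin (2 * 6 + 1) → ℍ → ℂ, IsCharacterDecomposition 6 c →
      IsWeightZeroVVMF umbralT6 umbralS6 (coefficientVector 6 c)) ∧
    -- N = 4
    (∀ c : Fin (2 * 4 + 1) → ℍ → ℂ, IsCharacterDecomposition 4 c →
      IsWeightZeroVVMF umbralT4 umbralS4 (coefficientVector 4 c) ∧
      ∀ τ : ℍ, coefficientVector 4 c τ = ![-1, 0, 0, 1, 0]) ∧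
    (∀ (τ : ℍ) (z : ℂ), sl2Denominator τ z ≠ 0 →
      umbralPsi 4 τ z = umbralCombination4 τ z ∧
      umbralCombination4 (ModularGroup.T • τ) z = umbralCombination4 τ z ∧
      umbralCombination4 (ModularGroup.S • τ) (z / (τ : ℂ)) =
        Complex.exp (2 * Real.pi * Complex.I * 4 * z ^ 2 / (τ : ℂ)) * umbralCombination4 τ z) ∧
    (∀ v : Fin 5 → ℂ, umbralT4 *ᵥ v = v ∧ umbralS4 *ᵥ v = v ↔
      ∃ x : ℂ, v = x • ![-1, 0, 0, 1, 0]) := by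
  refine ⟨fun N hN => ⟨existsUnique_isCharacterDecomposition hN, fun c hc => hc.rev hN⟩,
    fun c hc => ?_, fun c hc => ?_, fun c hc => ?_, fun c hc => ?_,
    fun c hc => ⟨?_, coefficientVector_four hc⟩,
    fun τ z hz => ⟨umbralPsi_four_eq hz, umbralCombination4_T hz, umbralCombination4_S hz⟩,
    umbralTS4_fixed_iff⟩
  · rw [umbralT1_eq, umbralS1_eq]
    exact isWeightZeroVVMF_coefficientVector (by decide) hc
  · rw [umbralT2_eq, umbralS2_eq]
    exact isWeightZeroVVMF_coefficientVector (by decide) hc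
  · rw [umbralT3_eq, umbralS3_eq]
    exact isWeightZeroVVMF_coefficientVector (by decide) hc
  · rw [umbralT6_eq, umbralS6_eq]
    exact isWeightZeroVVMF_coefficientVector (by decide) hc
  · rw [umbralT4_eq, umbralS4_eq]
    exact isWeightZeroVVMF_coefficientVector (by decide) hc
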